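/- Let $r,n\ge 1$, $\zeta=e^{2\pi i/r}$, $F=\mathbb{C}(\kappa,c_0,d_1,\dots,d_{r-1})$ the field of rational functions in independent parameters, and define $d_i$ for $i\in\mathbb{Z}$ by $d_0+\dots+d_{r-1}=0$ and $d_i=d_j$ if $i\equiv j \bmod r$. Let $W=G(r,1,n)$ be the group of $n\times n$ monomial matrices whose nonzero entries are $r$-th roots of $1$, $\zeta_i=\mathrm{diag}(1,\dots,\zeta,\dots,1)$ ($\zeta$ in position $i$), $s_{ij}=(ij)$, $s_i=s_{i,i+1}$. Let $\mathbb{H}$ be the rational Cherednik algebra: the $F$-algebra generated by $F[x_1,\dots,x_n]$, $F[y_1,\dots,y_n]$ and $FW$ (with basis $t_w$) with relations $t_wx=(wx)t_w$, $t_wy=(wy)t_w$ (where $y_1,\dots,y_n$ is the standard basis of $\mathbb{C}^n$ and $x_1,\dots,x_n$ the dual basis), $y_ix_j=x_jy_i+c_0\sum_{l=0}^{r-1}\zeta^{-l}t_{\zeta_i^ls_{ij}\zeta_i^{-l}}$ for $i\ne j$, and $$y_ix_i=x_iy_i+\kappa-\sum_{j=0}^{r-1}(d_j-d_{j-1})e_{ij}-c_0\sum_{j\neq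 i}\sum_{l=0}^{r-1}t_{\zeta_i^ls_{ij}\zeta_i^{-l}},\qquad e_{ij}=\frac1r\sum_{l=0}^{r-1}\zeta^{-lj}t_{\zeta_i^l}.$$ Put $\phi_i=\sum_{j<i}\sum_{l=0}^{r-1}t_{\zeta_i^ls_{ij}\zeta_i^{-l}}$, $z_i=y_ix_i+c_0\phi_i$, $\pi_i=\sum_{l=0}^{r-1}t_{\zeta_i\zeta_{i+1}^{-1}}^l$, and let $\mathfrak{t}\subseteq\mathbb{H}$ be the subalgebra generated by $z_1,\dots,z_n,t_{\zeta_1},\dots,t_{\zeta_n}$. The intertwiners are $$\sigma_i=t_{s_i}+\frac{c_0}{z_i-z_{i+1}}\pi_i\ (1\le i\le n-1),\qquad \Phi=x_nt_{s_{n-1}\cdots s_1},\qquad \Psi=y_1t_{s_1\cdots s_{n-1}},$$ $\sigma_i$ being defined on those generalized $\mathfrak{t}$-weight spaces on which $z_i-z_{i+1}$ is invertible or $\pi_i$ is zero. Let $\lambda=(\lambda^0,\dots,\lambda^{r-1})$ be an $r$-partition of $n$. For a box $b$ in row $p$ and column $q$ of $\lambda^k$ put $\mathrm{ct}(b)=q-p$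 and $\beta(b)=k$. A standard Young tableau $T$ on $\lambda$ is a bijection $i\mapsto T(i)$ from $\{1,\dots,n\}$ to the boxes of $\lambda$ such that in each component the entries increase along rows and down columns; $s_j.T$ is $T$ with the entries $j,j+1$ exchanged. Let $S^\lambda$ be the irreducible $W$-module (scalars extended to $F$) with basis $v_T$, $T\in\mathrm{SYT}(\lambda)$, in Young's orthonormal form: $t_{\zeta_i}v_T=\zeta^{\beta(T(i))}v_T$, $\phi_iv_T=r\,\mathrm{ct}(T(i))v_T$, and $\left(t_{s_i}+\frac1{\phi_i-\phi_{i+1}}\pi_i\right)v_T$ is $0$ if $s_i.T$ is not standard, $v_{s_i.T}$ if $\beta(T(i))\ne\beta(T(i+1))$, and $\left(1-\left(\mathrm{ct}(T(i+1))-\mathrm{ct}(T(i))\right)^{-2}\right)^{1/2}v_{s_i.T}$ otherwise. Let $M(\lambda)=\mathrm{Ind}_{FW\otimes F[y_1,\dots,y_n]}^{\mathbb{H}}S^\lambda$, where each $y_i$ acts on $S^\lambda$ by $0$. For $\mu\in\mathbb{Z}_{\ge0}^n$ let $w_\mu\in S_n$ be given by $w_\mu(i)=|\{j<i:\mu_j<\mu_i\}|+|\{j\ge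 i:\mu_j\le\mu_i\}|$, and put $v_T^\mu=t_{w_\mu}^{-1}v_T$. Let $\mu^+$ be the non-increasing rearrangement of $\mu$, and write $\nu<\mu$ if $\nu^+$ is strictly smaller than $\mu^+$ in dominance order, or $\nu^+=\mu^+$ and $w_\nu<w_\mu$ in Bruhat order. For each $\mu$ and each $T\in\mathrm{SYT}(\lambda)$ there is a unique $\mathfrak{t}$-eigenvector $f_{\mu,T}\in M(\lambda)$ that differs from $x^\mu v_T^\mu$ by a linear combination of the $x^\nu v_S^\nu$ with $\nu<\mu$, $S\in\mathrm{SYT}(\lambda)$. Put $\phi.\mu=(\mu_2,\dots,\mu_n,\mu_1+1)$, $\psi.\mu=(\mu_n-1,\mu_1,\dots,\mu_{n-1})$, and let $s_i.\mu$ be $\mu$ with $\mu_i,\mu_{i+1}$ exchanged. Then for all $\mu\in\mathbb{Z}_{\ge0}^n$, all $T\in\mathrm{SYT}(\lambda)$ and, in (a)–(c), all $1\le i\le n-1$, where $\sigma_i$ is defined at $f_{\mu,T}$: (a) If $\mu_i\neq\mu_{i+1}$, and $\mu_i<\mu_{i+1}$ or $\mu_i-\mu_{i+1}\not\equiv\beta(T(w_\mu(i)))-\beta(T(w_\mu(i+1)))\bmod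 r$, then $\sigma_i.f_{\mu,T}=f_{s_i.\mu,T}$. (b) If $\mu_i>\mu_{i+1}$ and $\mu_i-\mu_{i+1}\equiv\beta(T(w_\mu(i)))-\beta(T(w_\mu(i+1)))\bmod r$, then $\sigma_i.f_{\mu,T}=\frac{(\delta-rc_0)(\delta+rc_0)}{\delta^2}f_{s_i.\mu,T}$, where $$\delta=\kappa(\mu_i-\mu_{i+1})-\left(d_{\beta(T(w_\mu(i)))}-d_{\beta(T(w_\mu(i+1)))}\right)-c_0r\left(\mathrm{ct}(T(w_\mu(i)))-\mathrm{ct}(T(w_\mu(i+1)))\right)\neq0.$$ (c) If $\mu_i=\mu_{i+1}$ and $j=w_\mu(i)$ (so that $j\ge2$), then $\sigma_i.f_{\mu,T}$ equals $0$ if $s_{j-1}.T$ is not standard; $f_{\mu,s_{j-1}.T}$ if $\beta(T(j))\neq\beta(T(j-1))$ (and then $s_{j-1}.T$ is standard); and $\left(1-\left(\frac1{\mathrm{ct}(T(j-1))-\mathrm{ct}(T(j))}\right)^2\right)^{1/2}f_{\mu,s_{j-1}.T}$ otherwise. (d) $\Phi.f_{\mu,T}=f_{\phi.\mu,T}$.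 (e) $\Psi.f_{\mu,T}=\left(\kappa\mu_n-\left(d_{\beta(T(w_\mu(n)))}-d_{\beta(T(w_\mu(n)))-\mu_n}\right)-r\,\mathrm{ct}(T(w_\mu(n)))c_0\right)f_{\psi.\mu,T}$ if $\mu_n>0$, and $\Psi.f_{\mu,T}=0$ if $\mu_n=0$. -/

import Mathlib

namespace Cherednik

noncomputable section

/-! ### The group `G(r,1,n)`

Indices `1, …, n` are represented by `Fin n`, so the index `i` of the usual notation is the
element of `Fin n` with value `i - 1`. -/

/-- The primitive `r`-th root of unity `ζ = e^{2πi/r}`. -/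
def zeta (r : ℕ) : ℂ := Complex.exp (2 * (Real.pi : ℂ) * Complex.I / (r : ℂ))

theorem zeta_pow (r : ℕ) [NeZero r] : zeta r ^ r = 1 := by
  have h : (r : ℂ) ≠ 0 := Nat.cast_ne_zero.mpr (NeZero.ne r)
  rw [zeta, ← Complex.exp_nat_mul, mul_div_cancel₀ _ h, Complex.exp_two_pi_mul_I]

theorem zeta_ne_zero (r : ℕ) : zeta r ≠ 0 := Complex.exp_ne_zero _

/-- `g` is monomial, its nonzero entries being `r`-th roots of unity. -/
def IsMonomial (r n : ℕ) (g : Matrix (Fin n) (Fin n) ℂ) : Prop :=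
  ∃ w : Equiv.Perm (Fin n), (∀ j, g (w j) j ^ r = 1) ∧ ∀ i j, i ≠ w j → g i j = 0

/-- `G(r,1,n)`: the group of `n × n` monomial matrices with entries `r`-th roots of unity. -/
def G (r n : ℕ) : Subgroup (Matrix.GeneralLinearGroup (Fin n) ℂ) where
  carrier := {g | IsMonomial r n (g : Matrix (Fin n) (Fin n) ℂ)}
  one_mem' := ⟨1, by simp, fun i j h => Matrix.one_apply_ne h⟩
  mul_mem' := by
    rintro a b ⟨u, hu1, hu2⟩ ⟨v, hv1, hv2⟩
    have key : ∀ i j, (a * b : Matrix.GeneralLinearGroup (Fin n) ℂ).1 i j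
        = a.1 i (v j) * b.1 (v j) j := by
      intro i j
      rw [Units.val_mul, Matrix.mul_apply]
      exact Finset.sum_eq_single _ (fun k _ hk => by rw [hv2 k j hk, mul_zero]) (by simp)
    refine ⟨u * v, fun j => ?_, fun i j h => ?_⟩
    · rw [key, mul_pow, Equiv.Perm.mul_apply, hu1, hv1, one_mul]
    · rw [key, hu2 i (v j) h, zero_mul]
  inv_mem' := by
    rintro a ⟨u, hu1, hu2⟩
    have key : ∀ i j, (a⁻¹ : Matrix.GeneralLinearGroup (Fin n) ℂ).1 i (u j) * a.1 (u j) j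
        = (1 : Matrix (Fin n) (Fin n) ℂ) i j := by
      intro i j
      have h : (a⁻¹ : Matrix.GeneralLinearGroup (Fin n) ℂ).1 * a.1 = 1 := by
        rw [← Units.val_mul, inv_mul_cancel, Units.val_one]
      rw [← h, Matrix.mul_apply]
      symm
      exact Finset.sum_eq_single _ (fun k _ hk => by rw [hu2 k j hk, mul_zero]) (by simp)
    have hinv : ∀ j, u (u⁻¹ j) = j := fun j => u.apply_symm_apply j
    refine ⟨u⁻¹, fun j => ?_, fun i j h => ?_⟩
    · have h := key (u⁻¹ j) (u⁻¹ j)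
      rw [hinv, Matrix.one_apply_eq] at h
      have h2 := congrArg (· ^ r) h
      simp only [mul_pow, one_pow] at h2
      have h3 := hu1 (u⁻¹ j)
      rw [hinv] at h3
      rwa [h3, mul_one] at h2
    · have h1 := key i (u⁻¹ j)
      rw [hinv, Matrix.one_apply_ne h] at h1
      rcases mul_eq_zero.mp h1 with h2 | h2
      · exact h2
      · have h3 := key (u⁻¹ j) (u⁻¹ j)
        rw [hinv, h2, mul_zero, Matrix.one_apply_eq] at h3
        exact absurd h3 zero_ne_one

/-- The permutation matrix of `w`, with `w y_j = y_{w(j)}` on the standard basis. -/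
def permMat (n : ℕ) (w : Equiv.Perm (Fin n)) : Matrix (Fin n) (Fin n) ℂ :=
  Matrix.of fun i j => if i = w j then 1 else 0

theorem permMat_mul (n : ℕ) (u v : Equiv.Perm (Fin n)) :
    permMat n u * permMat n v = permMat n (u * v) := by
  ext i j
  simp only [permMat, Matrix.mul_apply, Matrix.of_apply, Equiv.Perm.mul_apply, mul_ite, mul_one,
    mul_zero, Finset.sum_ite_eq', Finset.mem_univ, if_true]
  congr

theorem permMat_one (n : ℕ) : permMat n 1 = 1 := by
  ext i j
  simp only [permMat, Matrix.of_apply, Matrix.one_apply, Equiv.Perm.one_apply]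
  congr

/-- The symmetric group inside `G(r,1,n)`. -/
def permG (r : ℕ) {n : ℕ} (w : Equiv.Perm (Fin n)) : G r n :=
  ⟨⟨permMat n w, permMat n w⁻¹, by rw [permMat_mul, mul_inv_cancel, permMat_one],
    by rw [permMat_mul, inv_mul_cancel, permMat_one]⟩,
    w, fun j => by simp [permMat], fun i j h => by simp [permMat, h]⟩

/-- The diagonal matrix `ζ_i` with `ζ` in position `i` and `1` elsewhere on the diagonal. -/
def diagG (r : ℕ) [NeZero r] {n : ℕ} (i : Fin n) : G r n :=
  ⟨⟨Matrix.diagonal fun k => if k = i then zeta r else 1,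
    Matrix.diagonal fun k => if k = i then (zeta r)⁻¹ else 1,
    by
      rw [Matrix.diagonal_mul_diagonal, ← Matrix.diagonal_one]
      congr 1
      funext k
      split_ifs <;> simp [zeta_ne_zero],
    by
      rw [Matrix.diagonal_mul_diagonal, ← Matrix.diagonal_one]
      congr 1
      funext k
      split_ifs <;> simp [zeta_ne_zero]⟩,
    1, fun j => by
      simp only [Equiv.Perm.one_apply, Matrix.diagonal_apply_eq]
      split_ifs
      · exact zeta_pow r
      · exact one_pow r,
    fun i j h => Matrix.diagonal_apply_ne _ h⟩

/-- The reflection `ζ_i^l s_{ij} ζ_i^{-l}`. -/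
def reflG (r : ℕ) [NeZero r] {n : ℕ} (i j : Fin n) (l : ℕ) : G r n :=
  diagG r i ^ l * permG r (Equiv.swap i j) * (diagG r i ^ l)⁻¹

/-! ### The rational Cherednik algebra -/

/-- Parameters `κ, c₀, d_j` (`j` an integer modulo `r`) with `d_0 + ⋯ + d_{r-1} = 0`. -/
structure Params (F : Type) [Field F] (r : ℕ) [NeZero r] where
  κ : F
  c₀ : F
  d : ZMod r → F
  sum_d : ∑ j, d j = 0

/-- Algebra generators `x_i`, `y_i`, `t_w`. -/
inductive Gen (r n : ℕ) : Type
  | x (i : Fin n)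
  | y (i : Fin n)
  | t (w : G r n)

section FreeGenerators

variable (F : Type) [Field F] {r n : ℕ}

/-- The free generator `x_i`. -/
def fx (i : Fin n) : FreeAlgebra F (Gen r n) := FreeAlgebra.ι F (Gen.x i)

/-- The free generator `y_i`. -/
def fy (i : Fin n) : FreeAlgebra F (Gen r n) := FreeAlgebra.ι F (Gen.y i)

/-- The free generator `t_w`. -/
def ft (w : G r n) : FreeAlgebra F (Gen r n) := FreeAlgebra.ι F (Gen.t w)

/-- The idempotent `e_{ij} = (1/r) ∑_l ζ^{-lj} t_{ζ_i^l}`, written in the free generators. -/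
def fe [Algebra ℂ F] [NeZero r] (i : Fin n) (j : ℕ) : FreeAlgebra F (Gen r n) :=
  (r : F)⁻¹ • ∑ l ∈ Finset.range r, algebraMap ℂ F ((zeta r ^ (l * j))⁻¹) • ft F (diagG r i ^ l)

end FreeGenerators

/-- Defining relations of the rational Cherednik algebra. The matrix `w` acts on the standard
basis `y_j` by `w y_j = ∑_i w_{ij} y_i` and on the dual basis by `w x_j = ∑_i (w⁻¹)_{ji} x_i`. -/
inductive Rel {F : Type} [Field F] [Algebra ℂ F] {r : ℕ} [NeZero r] (P : Params F r) (n : ℕ) :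
    FreeAlgebra F (Gen r n) → FreeAlgebra F (Gen r n) → Prop
  | xx (i j : Fin n) : Rel P n (fx F i * fx F j) (fx F j * fx F i)
  | yy (i j : Fin n) : Rel P n (fy F i * fy F j) (fy F j * fy F i)
  | t_one : Rel P n (ft F 1) 1
  | t_mul (u w : G r n) : Rel P n (ft F u * ft F w) (ft F (u * w))
  | tx (w : G r n) (j : Fin n) : Rel P n (ft F w * fx F j)
      ((∑ i, algebraMap ℂ F ((w⁻¹ : G r n).1.1 j i) • fx F i) * ft F w)
  | ty (w : G r n) (j : Fin n) : Rel P n (ft F w * fy F j)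
      ((∑ i, algebraMap ℂ F (w.1.1 i j) • fy F i) * ft F w)
  | yx_ne (i j : Fin n) (h : i ≠ j) : Rel P n (fy F i * fx F j)
      (fx F j * fy F i
        + P.c₀ • ∑ l ∈ Finset.range r, algebraMap ℂ F ((zeta r ^ l)⁻¹) • ft F (reflG r i j l))
  | yx_eq (i : Fin n) : Rel P n (fy F i * fx F i)
      (fx F i * fy F i + algebraMap F _ P.κ
        - ∑ j ∈ Finset.range r, (P.d (j : ZMod r) - P.d ((j : ZMod r) - 1)) • fe F i j
        - P.c₀ • ∑ j ∈ Finset.univ.erase i, ∑ l ∈ Finset.range r, ft F (reflG r i j l))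

section Algebra

variable {F : Type} [Field F] [Algebra ℂ F] {r : ℕ} [NeZero r] (P : Params F r) (n : ℕ)

/-- The rational Cherednik algebra `ℍ` of type `G(r,1,n)`. -/
def H : Type := RingQuot (Rel P n)

instance : Ring (H P n) := inferInstanceAs (Ring (RingQuot (Rel P n)))

instance : Algebra F (H P n) := inferInstanceAs (Algebra F (RingQuot (Rel P n)))

/-- The quotient map from the free algebra. -/
def toH : FreeAlgebra F (Gen r n) →ₐ[F] H P n := RingQuot.mkAlgHom F (Rel P n)

variable {n}

/-- `x_i ∈ ℍ`. -/
def x (i : Fin n) : H P n := toH P n (fx F i)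

/-- `y_i ∈ ℍ`. -/
def y (i : Fin n) : H P n := toH P n (fy F i)

/-- `t_w ∈ ℍ`. -/
def t (w : G r n) : H P n := toH P n (ft F w)

/-- The monomial `x^μ = x_1^{μ_1} ⋯ x_n^{μ_n}`. -/
def xpow (μ : Fin n → ℕ) : H P n := (List.ofFn fun i => x P i ^ μ i).prod

/-- The Jucys–Murphy element `φ_i = ∑_{j<i} ∑_l t_{ζ_i^l s_{ij} ζ_i^{-l}}`. -/
def jm (i : Fin n) : H P n := ∑ j ∈ Finset.Iio i, ∑ l ∈ Finset.range r, t P (reflG r i j l)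

/-- The Dunkl–Opdam element `z_i = y_i x_i + c₀ φ_i`. -/
def z (i : Fin n) : H P n := y P i * x P i + P.c₀ • jm P i

/-- `∑_l t_{ζ_i ζ_j^{-1}}^l`; this is `π_i` when `j = i + 1`. -/
def piH (i j : Fin n) : H P n := ∑ l ∈ Finset.range r, t P (diagG r i * (diagG r j)⁻¹) ^ l

/-- The subalgebra `𝔱` of `ℍ` generated by the `z_i` and the `t_{ζ_i}`. -/
def tAlg (n : ℕ) : Subalgebra F (H P n) :=
  Algebra.adjoin F (Set.range (fun i : Fin n => z P i)
    ∪ Set.range (fun i : Fin n => t P (diagG r i)))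

end Algebra

/-- The list `s_1, s_2, …, s_{n-1}` of simple transpositions. -/
def simpleList (n : ℕ) : List (Equiv.Perm (Fin n)) :=
  List.ofFn fun k : Fin (n - 1) =>
    Equiv.swap ⟨k.1, by have := k.2; omega⟩ ⟨k.1 + 1, by have := k.2; omega⟩

/-- The last index. -/
def lastIdx (n : ℕ) [NeZero n] : Fin n := ⟨n - 1, Nat.sub_lt (NeZero.pos n) one_pos⟩

section Intertwiners

variable {F : Type} [Field F] [Algebra ℂ F] {r : ℕ} [NeZero r] (P : Params F r)
  (n : ℕ) [NeZero n]

/-- `Φ = x_n t_{s_{n-1} ⋯ s_1}`. -/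
def Phi : H P n := x P (lastIdx n) * t P (permG r (simpleList n).reverse.prod)

/-- `Ψ = y_1 t_{s_1 ⋯ s_{n-1}}`. -/
def Psi : H P n := y P (0 : Fin n) * t P (permG r (simpleList n).prod)

end Intertwiners

/-! ### The combinatorics of compositions -/

section Compositions

variable {n : ℕ}

/-- The function `w_μ`: in one-based indexing
`w_μ(i) = |{j < i : μ_j < μ_i}| + |{j ≥ i : μ_j ≤ μ_i}|`;
in zero-based indexing the contribution of `j = i` is dropped. -/
def wFun (μ : Fin n → ℕ) (i : Fin n) : ℕ :=
  (Finset.univ.filter fun j => j < i ∧ μ j < μ i).card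
    + (Finset.univ.filter fun j => i < j ∧ μ j ≤ μ i).card

theorem wFun_eq (μ : Fin n → ℕ) (i : Fin n) :
    wFun μ i = (Finset.univ.filter fun j => μ j < μ i ∨ (μ j = μ i ∧ i < j)).card := by
  rw [wFun, ← Finset.card_union_of_disjoint]
  · congr 1
    ext j
    simp only [Finset.mem_union, Finset.mem_filter, Finset.mem_univ, true_and]
    constructor
    · rintro (⟨_, h⟩ | ⟨h, h'⟩)
      · exact Or.inl h
      · rcases h'.lt_or_eq with h2 | h2
        · exact Or.inl h2
        · exact Or.inr ⟨h2, h⟩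
    · rintro (h | ⟨h, h'⟩)
      · rcases lt_trichotomy j i with h2 | h2 | h2
        · exact Or.inl ⟨h2, h⟩
        · subst h2
          exact absurd h (lt_irrefl _)
        · exact Or.inr ⟨h2, h.le⟩
      · exact Or.inr ⟨h', h.le⟩
  · rw [Finset.disjoint_left]
    intro j h1 h2
    simp only [Finset.mem_filter, Finset.mem_univ, true_and] at h1 h2
    exact absurd (h1.1.trans h2.1) (lt_irrefl _)

theorem wFun_lt (μ : Fin n → ℕ) (i : Fin n) : wFun μ i < n := by
  rw [wFun_eq]
  calc _ < (Finset.univ : Finset (Fin n)).card :=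
        Finset.card_lt_card (Finset.filter_ssubset.mpr ⟨i, Finset.mem_univ i, by simp⟩)
    _ = n := by simp

theorem wFun_strict (μ : Fin n → ℕ) (i k : Fin n) (h : μ i < μ k ∨ (μ i = μ k ∧ k < i)) :
    wFun μ i < wFun μ k := by
  rw [wFun_eq, wFun_eq]
  apply Finset.card_lt_card
  rw [Finset.ssubset_iff_of_subset]
  · refine ⟨i, by simpa using h, by simp⟩
  · intro j hj
    simp only [Finset.mem_filter, Finset.mem_univ, true_and] at hj ⊢
    omega

/-- The permutation `w_μ`: the longest `w ∈ S_n` such that `w.μ` is non-decreasing. -/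
def wPerm (μ : Fin n → ℕ) : Equiv.Perm (Fin n) :=
  Equiv.ofBijective (fun i => (⟨wFun μ i, wFun_lt μ i⟩ : Fin n)) <| by
    apply Finite.injective_iff_bijective.mp
    intro i k hik
    have h : wFun μ i = wFun μ k := congrArg Fin.val hik
    by_contra hne
    rcases lt_trichotomy (μ i) (μ k) with h1 | h1 | h1
    · exact absurd h (wFun_strict μ i k (Or.inl h1)).ne
    · rcases lt_or_gt_of_ne hne with h2 | h2
      · exact absurd h (wFun_strict μ k i (Or.inr ⟨h1.symm, h2⟩)).ne'
      · exact absurd h (wFun_strict μ i k (Or.inr ⟨h1, h2⟩)).ne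
    · exact absurd h (wFun_strict μ k i (Or.inl h1)).ne'

/-- The length of a permutation: its number of inversions. -/
def len (w : Equiv.Perm (Fin n)) : ℕ :=
  (Finset.univ.filter fun p : Fin n × Fin n => p.1 < p.2 ∧ w p.2 < w p.1).card

/-- The strict Bruhat order on `S_n`. -/
def BruhatLT : Equiv.Perm (Fin n) → Equiv.Perm (Fin n) → Prop :=
  Relation.TransGen fun u w => (∃ a b : Fin n, w = u * Equiv.swap a b) ∧ len u < len w

/-- The non-increasing rearrangement `μ⁺`. -/
def decr (μ : Fin n → ℕ) : Fin n → ℕ := fun i => μ (Tuple.sort μ i.rev)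

/-- The strict dominance order `a <_d b`. -/
def DomLT (a b : Fin n → ℕ) : Prop :=
  a ≠ b ∧ ∑ i, a i = ∑ i, b i
    ∧ ∀ m : Fin n, ∑ i ∈ Finset.Iic m, a i ≤ ∑ i ∈ Finset.Iic m, b i

/-- The partial order on compositions. -/
def CompLT (μ ν : Fin n → ℕ) : Prop :=
  DomLT (decr μ) (decr ν) ∨ (decr μ = decr ν ∧ BruhatLT (wPerm μ) (wPerm ν))

/-- `φ.μ = (μ_2, …, μ_n, μ_1 + 1)`. -/
def phiC [NeZero n] (μ : Fin n → ℕ) : Fin n → ℕ := fun i =>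
  if h : i.1 + 1 < n then μ ⟨i.1 + 1, h⟩ else μ 0 + 1

/-- `ψ.μ = (μ_n - 1, μ_1, …, μ_{n-1})`, to be used when `μ_n > 0`. -/
def psiC [NeZero n] (μ : Fin n → ℕ) : Fin n → ℕ := fun i =>
  if i.1 = 0 then μ (lastIdx n) - 1 else μ ⟨i.1 - 1, lt_of_le_of_lt (Nat.sub_le _ _) i.2⟩

end Compositions

/-! ### `r`-partitions and standard Young tableaux -/

/-- An `r`-partition `(λ^0, …, λ^{r-1})` of `n`, through Young diagrams. -/
structure RPartition (r n : ℕ) where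
  shape : Fin r → YoungDiagram
  card_eq : ∑ p, (shape p).card = n

/-- The boxes of an `r`-partition; a cell is a pair (row, column). -/
def Box {r n : ℕ} (lam : RPartition r n) : Type :=
  Σ p : Fin r, {c : ℕ × ℕ // c ∈ (lam.shape p).cells}

section Tableaux

variable {r n : ℕ} {lam : RPartition r n}

/-- `β(b) = p` for a box `b` of `λ^p`. -/
def beta (b : Box lam) : Fin r := b.1

/-- The content: column minus row. -/
def ct (b : Box lam) : ℤ := (b.2.1.2 : ℤ) - (b.2.1.1 : ℤ)

/-- A tableau is standard if, inside each component, its entries increase strictly along rows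
and down columns. `T i` is the box containing `i`. -/
def IsStandard (T : Fin n ≃ Box lam) : Prop :=
  ∀ i j : Fin n, beta (T i) = beta (T j) →
    ((T i).2.1.1 = (T j).2.1.1 ∧ (T i).2.1.2 < (T j).2.1.2
      ∨ (T i).2.1.2 = (T j).2.1.2 ∧ (T i).2.1.1 < (T j).2.1.1) → i < j

variable (lam) in
/-- Standard Young tableaux on `λ`. -/
def SYT : Type := {T : Fin n ≃ Box lam // IsStandard T}

/-- The tableau `s_{kj}.T`: the entries `k` and `j` are interchanged. -/
def swapT (k j : Fin n) (T : SYT lam) : Fin n ≃ Box lam := (Equiv.swap k j).trans T.1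

/-- The number `(1 - (1/(ct(T(k)) - ct(T(j))))²)^{1/2}`. -/
def seminormal (k j : Fin n) (T : SYT lam) : ℂ :=
  ((Real.sqrt (1 - (1 / ((ct (T.1 k) - ct (T.1 j) : ℤ) : ℝ)) ^ 2) : ℝ) : ℂ)

end Tableaux

/-! ### The standard module `M(λ)` -/

section StandardModule

variable {F : Type} [Field F] [Algebra ℂ F] {r : ℕ} [NeZero r] (P : Params F r)
  {n : ℕ} (lam : RPartition r n)

open Classical in
/-- The value of `τ_i v_T` for `j = i + 1`, as an element of the free `ℍ`-module on the `v_T`: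
`0`, `v_{s_i.T}` or `(1 - (ct(T(j)) - ct(T(i)))⁻²)^{1/2} v_{s_i.T}`. -/
def tauValue (i j : Fin n) (T : SYT lam) : SYT lam →₀ H P n :=
  if h : IsStandard (swapT i j T) then
    (if beta (T.1 i) ≠ beta (T.1 j) then Finsupp.single ⟨swapT i j T, h⟩ 1
     else Finsupp.single ⟨swapT i j T, h⟩
       (algebraMap F (H P n) (algebraMap ℂ F (seminormal j i T))))
  else 0

/-- Relations of the standard module on the generators `v_T` (`Finsupp.single T h` is `h v_T`).
The first three families present the irreducible representation `S^λ` of `G(r,1,n)` in Young's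
orthonormal form:
`t_{ζ_i} v_T = ζ^{β(T(i))} v_T`, `φ_i v_T = r ct(T(i)) v_T` and
`τ_i v_T = (t_{s_i} + (φ_i - φ_{i+1})⁻¹ π_i) v_T` as prescribed by `tauValue`
(`π_i v_T = 0` if `β(T(i)) ≠ β(T(i+1))`, and `ct(T(i)) ≠ ct(T(i+1))` otherwise).
The last one is `y_i v_T = 0`. -/
inductive StdRel : (SYT lam →₀ H P n) → Prop
  | diag (i : Fin n) (T : SYT lam) : StdRel
      (Finsupp.single T (t P (diagG r i)
        - algebraMap F (H P n) (algebraMap ℂ F (zeta r ^ (beta (T.1 i) : ℕ)))))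
  | jm (i : Fin n) (T : SYT lam) : StdRel
      (Finsupp.single T (jm P i - algebraMap F (H P n) ((r : F) * ((ct (T.1 i) : ℤ) : F))))
  | tau (i j : Fin n) (hij : i.1 + 1 = j.1) (T : SYT lam) : StdRel
      (Finsupp.single T (t P (permG r (Equiv.swap i j))
          + ((r : F) * ((ct (T.1 i) : ℤ) : F) - (r : F) * ((ct (T.1 j) : ℤ) : F))⁻¹ • piH P i j)
        - tauValue P lam i j T)
  | y (i : Fin n) (T : SYT lam) : StdRel (Finsupp.single T (y P i))

/-- The standard module `M(λ) = Ind_{FW ⊗ F[y]}^ℍ S^λ`: since `S^λ` is presented by the generators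
`v_T`, the induced module is the `ℍ`-module presented by the same generators and relations. -/
def M : Type := (SYT lam →₀ H P n) ⧸ Submodule.span (H P n) {m | StdRel P lam m}

instance : AddCommGroup (M P lam) :=
  inferInstanceAs (AddCommGroup
    ((SYT lam →₀ H P n) ⧸ Submodule.span (H P n) {m | StdRel P lam m}))

instance : Module (H P n) (M P lam) :=
  inferInstanceAs (Module (H P n)
    ((SYT lam →₀ H P n) ⧸ Submodule.span (H P n) {m | StdRel P lam m}))

instance : Module F (M P lam) := Module.compHom (M P lam) (algebraMap F (H P n))

variable {lam}

/-- The generator `v_T` of `M(λ)`. -/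
def v (T : SYT lam) : M P lam :=
  Submodule.Quotient.mk (p := Submodule.span (H P n) {m | StdRel P lam m}) (Finsupp.single T 1)

/-- The element `x^μ v_T^μ` with `v_T^μ = t_{w_μ}⁻¹ v_T`. -/
def xv (μ : Fin n → ℕ) (T : SYT lam) : M P lam := xpow P μ • t P (permG r (wPerm μ)⁻¹) • v P T

/-- `m` is an eigenvector of `𝔱`. -/
def IsEigenvector (m : M P lam) : Prop := m ≠ 0 ∧ ∀ a ∈ tAlg P n, ∃ c : F, a • m = c • m

/-- `m` is a `𝔱`-eigenvector of the form `x^μ v_T^μ + lower terms`; the lower terms are linear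
combinations of the `x^ν v_S^ν` with `ν < μ`. -/
def IsLeadingEigenvector (μ : Fin n → ℕ) (T : SYT lam) (m : M P lam) : Prop :=
  IsEigenvector P m ∧
    m - xv P μ T ∈ Submodule.span F {u | ∃ ν S, CompLT ν μ ∧ u = xv P ν S}

variable (lam) in
/-- The generalized `𝔱`-weight space `M(λ)_α`. -/
def weightSpace (α : tAlg P n →ₐ[F] F) : Set (M P lam) :=
  {m | ∃ q : ℕ, 0 < q ∧ ∀ a : tAlg P n, ((a : H P n) - algebraMap F (H P n) (α a)) ^ q • m = 0}

/-- For `j = i + 1`: the intertwining operator `σ_i = t_{s_i} + c₀ (z_i - z_{i+1})⁻¹ π_i` is defined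
at `m`, and `σ_i m = m'`. The operator is defined on the weight spaces on which `z_i - z_{i+1}` is
invertible or `π_i` is zero. -/
def SigmaEq (i j : Fin n) (m m' : M P lam) : Prop :=
  ∃ α : tAlg P n →ₐ[F] F, m ∈ weightSpace P lam α ∧
    ((Set.BijOn (fun u => (z P i - z P j) • u) (weightSpace P lam α) (weightSpace P lam α) ∧
        ∃ u ∈ weightSpace P lam α, (z P i - z P j) • u = piH P i j • m ∧
          m' = t P (permG r (Equiv.swap i j)) • m + P.c₀ • u)
      ∨ ((∀ u ∈ weightSpace P lam α, piH P i j • u = 0) ∧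
          m' = t P (permG r (Equiv.swap i j)) • m))

end StandardModule

/-! ### Generic parameters -/

/-- Names of the independent parameters `κ, c₀, d_1, …, d_{r-1}`. -/
inductive ParamIndex (r : ℕ) : Type
  | κ
  | c₀
  | d (j : {j : ZMod r // j ≠ 0})

/-- The field of rational functions `ℂ(κ, c₀, d_1, …, d_{r-1})`. -/
abbrev RatField (r : ℕ) : Type := FractionRing (MvPolynomial (ParamIndex r) ℂ)

/-- An indeterminate, in the field of rational functions. -/
def indet {r : ℕ} (a : ParamIndex r) : RatField r :=
  algebraMap (MvPolynomial (ParamIndex r) ℂ) (RatField r) (MvPolynomial.X a)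

/-- The generic parameters, with `d_0 = -(d_1 + ⋯ + d_{r-1})`. -/
def genericParams (r : ℕ) [NeZero r] : Params (RatField r) r where
  κ := indet ParamIndex.κ
  c₀ := indet ParamIndex.c₀
  d := fun j => if h : j ≠ 0 then indet (ParamIndex.d ⟨j, h⟩)
    else - ∑ k : {k : ZMod r // k ≠ 0}, indet (ParamIndex.d k)
  sum_d := by
    rw [← Finset.add_sum_erase _ _ (Finset.mem_univ (0 : ZMod r))]
    have h : ∑ j ∈ Finset.univ.erase (0 : ZMod r), (if h : j ≠ 0 then
        indet (ParamIndex.d ⟨j, h⟩) else - ∑ k : {k : ZMod r // k ≠ 0}, indet (ParamIndex.d k))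
        = ∑ k : {k : ZMod r // k ≠ 0}, indet (ParamIndex.d k) := by
      symm
      refine Finset.sum_bij (fun k _ => k.1) (fun k _ => by simpa using k.2)
        (fun a _ b _ hab => Subtype.ext hab) (fun b hb => ⟨⟨b, by simpa using hb⟩, by simp⟩) ?_
      intro k _
      rw [dif_pos k.2]
    rw [h]
    simp

end

end Cherednik

open Cherednik

namespace Cherednik

noncomputable section

/-! ### Normal forms in `G(r,1,n)` -/

section Group

variable {r n : ℕ} [NeZero r]

set_option linter.unusedSectionVars false

/-! For generic parameters the commutative family `z_i`, `t_{ζ_i}` acts on `M(λ)` with simple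
spectrum, and the intertwiners move its weights around. Numbering indices from 1, the relations
behind this are `t_{s_i} z_i = z_{i+1} t_{s_i} - c₀ π_i` (`t_swap_mul_z`) and `z_i Φ = Φ z_{i+1}`
for `i < n`, with a shift for `z_n` (`z_mul_Phi`, `z_last_mul_Phi`). So `σ_i` exchanges two
coordinates of a weight and `Φ` rotates them. Moreover `σ_i²` is a scalar on a weight vector
(`sigma_sq`), and `ΨΦ = z_1`.

Existence. Every composition is reached from 0 by `φ` and by exchanges of neighbours `μ_i <
μ_{i+1}`. Applying `Φ` and `σ_i` along the way to the degree-zero vector attached to `T` yields a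
vector of the right weight (`exists_isLeading`). It does not vanish, because the scalars `1 - e²`
and `z_1` met on the way are nonzero for generic parameters. The lower terms are tracked by an
auxiliary relation `AffLT`, an affine Bruhat order. It is preserved by `φ`, has the lifting property
of Bruhat orders for simple transpositions (`topSwap_mono`), and implies the order `CompLT` of the
theorem (`Step.compLT`).

Basis and uniqueness. The coefficients of `κ` and `c₀` in the eigenvalues of the `z_i` give `μ` and
the contents of `T`; the eigenvalues of the `t_{ζ_i}` give the components of the boxes. Hence a
weight determines `(μ, T)` (`weight_injective`), and the vectors `f_{μ,T}` are independent. They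
span by triangularity, since the `x^μ v_T^μ` span (`span_xv_eq_top`). In this eigenbasis, a weight
vector made of terms below `μ`, whose weight can only belong to the composition `μ`, is zero
(`eq_zero_of_mem_compLower`). This yields uniqueness of `f_{μ,T}`, and it turns equality of weights
and leading terms into equality of vectors.

The formulas. The ascending case of (a), and (d), are the construction itself. The descending cases
of (a) and (b) follow from `σ_i² = 1 - e²`. For (c), `t_{s_i} t_{w_μ}⁻¹ = t_{w_μ}⁻¹ t_{s_{j-1}}`
moves `σ_i` onto `v_T`, where Young's form applies. For (e) with `μ_n > 0` one uses `ΨΦ = z_1`. If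
`μ_n = 0` then `ΦΨ f = 0`, because the box `T(1)` has content 0, and `Φ` is injective.

Nonvanishing. `M(λ)` is given by generators and relations, so it must be shown that `v_T ≠ 0`.
Young's orthonormal representation is constructed from the Coxeter presentation of the symmetric
group, and Dunkl–Opdam operators make `F[x] ⊗ S^λ` an `ℍ`-module satisfying all the relations
(`v_ne_zero`). Nothing more about the size of `M(λ)` is needed in advance, as independence comes
from the weights. -/

theorem zeta_isPrimitiveRoot (r : ℕ) [NeZero r] : IsPrimitiveRoot (zeta r) r :=
  Complex.isPrimitiveRoot_exp r (NeZero.ne r)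

variable (r) in
/-- `ζ` as an element of the group of `r`-th roots of unity. -/
def zetaRoot : rootsOfUnity r ℂ :=
  ⟨Units.mk0 (zeta r) (zeta_ne_zero r), by
    rw [mem_rootsOfUnity]; ext; simpa using zeta_pow r⟩

@[simp] theorem coe_zetaRoot : ((zetaRoot r : ℂˣ) : ℂ) = zeta r := rfl

theorem coe_zetaRoot_pow (l : ℕ) : (((zetaRoot r ^ l : rootsOfUnity r ℂ) : ℂˣ) : ℂ) = zeta r ^ l := by
  simp

theorem rootsOfUnity_ext {a b : rootsOfUnity r ℂ} (h : ((a : ℂˣ) : ℂ) = ((b : ℂˣ) : ℂ)) : a = b :=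
  Subtype.ext (Units.ext h)

theorem coe_root_pow (a : rootsOfUnity r ℂ) : ((a : ℂˣ) : ℂ) ^ r = 1 := by
  have := a.2
  rw [mem_rootsOfUnity] at this
  rw [← Units.val_pow_eq_pow_val, this, Units.val_one]

instance : Fintype (rootsOfUnity r ℂ) := Fintype.ofFinite _

/-- Indexing by the roots of unity themselves makes the sums over `l` invariant under translation
and inversion of the index, which is how they are handled from here on. -/
theorem sum_range_zetaRoot {A : Type*} [AddCommMonoid A] (f : rootsOfUnity r ℂ → A) :
    ∑ l ∈ Finset.range r, f (zetaRoot r ^ l) = ∑ η, f η := by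
  refine Finset.sum_bij (fun l _ => zetaRoot r ^ l) (fun _ _ => Finset.mem_univ _) ?_ ?_ ?_
  · intro a ha b hb h
    have h2 := congrArg (fun u : rootsOfUnity r ℂ => ((u : ℂˣ) : ℂ)) h
    simp only [coe_zetaRoot_pow] at h2
    exact (zeta_isPrimitiveRoot r).pow_inj (Finset.mem_range.mp ha) (Finset.mem_range.mp hb) h2
  · intro η _
    obtain ⟨i, hi, h⟩ := (zeta_isPrimitiveRoot r).eq_pow_of_pow_eq_one (coe_root_pow η)
    exact ⟨i, Finset.mem_range.mpr hi, rootsOfUnity_ext (by rw [coe_zetaRoot_pow, h])⟩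
  · intros; rfl

/-- The monomial matrix with entry `e j` at position `(w j, j)`. -/
def monMat (w : Equiv.Perm (Fin n)) (e : Fin n → rootsOfUnity r ℂ) : Matrix (Fin n) (Fin n) ℂ :=
  Matrix.of fun i j => if i = w j then ((e j : ℂˣ) : ℂ) else 0

theorem monMat_mul (w w' : Equiv.Perm (Fin n)) (e e' : Fin n → rootsOfUnity r ℂ) :
    monMat w e * monMat w' e' = monMat (w * w') (fun j => e (w' j) * e' j) := by
  ext i j
  simp only [monMat, Matrix.mul_apply, Matrix.of_apply, Equiv.Perm.mul_apply]
  rw [Finset.sum_eq_single (w' j) (fun b _ hb => by rw [if_neg hb, mul_zero]) (by simp)]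
  simp only [if_true, ite_mul, zero_mul]
  congr

theorem monMat_one : monMat (1 : Equiv.Perm (Fin n)) (fun _ => (1 : rootsOfUnity r ℂ)) = 1 := by
  ext i j
  simp only [monMat, Matrix.one_apply, Matrix.of_apply, Equiv.Perm.one_apply, OneMemClass.coe_one,
    Units.val_one]
  congr

/-- The element of `G(r,1,n)` sending `y_j` to `e_j y_{w(j)}`. -/
def monG (w : Equiv.Perm (Fin n)) (e : Fin n → rootsOfUnity r ℂ) : G r n :=
  ⟨⟨monMat w e, monMat w⁻¹ (fun j => (e (w⁻¹ j))⁻¹),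
    by rw [monMat_mul, mul_inv_cancel, ← monMat_one (r := r)]; simp,
    by rw [monMat_mul, inv_mul_cancel, ← monMat_one (r := r)]; simp⟩,
    w, fun j => by simp [monMat, coe_root_pow], fun i j h => by simp [monMat, h]⟩

theorem monG_apply (w : Equiv.Perm (Fin n)) (e : Fin n → rootsOfUnity r ℂ) (i j : Fin n) :
    (monG w e).1.1 i j = if i = w j then ((e j : ℂˣ) : ℂ) else 0 := rfl

theorem G_ext {a b : G r n} (h : ∀ i j, a.1.1 i j = b.1.1 i j) : a = b :=
  Subtype.ext (Units.ext (Matrix.ext h))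

theorem monG_mul (w w' : Equiv.Perm (Fin n)) (e e' : Fin n → rootsOfUnity r ℂ) :
    monG w e * monG w' e' = monG (w * w') (fun j => e (w' j) * e' j) :=
  Subtype.ext (Units.ext (monMat_mul w w' e e'))

theorem monG_one : monG (1 : Equiv.Perm (Fin n)) (fun _ => (1 : rootsOfUnity r ℂ)) = 1 :=
  Subtype.ext (Units.ext monMat_one)

theorem monG_inv (w : Equiv.Perm (Fin n)) (e : Fin n → rootsOfUnity r ℂ) :
    (monG w e)⁻¹ = monG w⁻¹ (fun j => (e (w⁻¹ j))⁻¹) := by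
  apply inv_eq_of_mul_eq_one_right
  rw [monG_mul, mul_inv_cancel, ← monG_one]
  congr 1; funext j; simp

theorem exists_monG (g : G r n) : ∃ w e, g = monG w e := by
  obtain ⟨w, h1, h2⟩ := g.2
  have hne : ∀ j, g.1.1 (w j) j ≠ 0 := fun j h => by
    have := h1 j
    rw [h, zero_pow (NeZero.ne r)] at this
    exact zero_ne_one this
  refine ⟨w, fun j => ⟨Units.mk0 _ (hne j), ?_⟩, G_ext fun i j => ?_⟩
  · rw [mem_rootsOfUnity]; ext; simpa using h1 j
  · rw [monG_apply]
    split_ifs with h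
    · rw [h]; rfl
    · exact h2 i j h

theorem monG_injective {w w' : Equiv.Perm (Fin n)} {e e' : Fin n → rootsOfUnity r ℂ}
    (h : monG w e = monG w' e') : w = w' ∧ e = e' := by
  have key : ∀ j, w j = w' j := fun j => by
    by_contra hne
    have h2 : (monG w e).1.1 (w j) j = (monG w' e').1.1 (w j) j := by rw [h]
    rw [monG_apply, monG_apply, if_pos rfl, if_neg hne] at h2
    exact (e j : ℂˣ).ne_zero h2
  refine ⟨Equiv.ext key, funext fun j => rootsOfUnity_ext ?_⟩
  have h2 : (monG w e).1.1 (w j) j = (monG w' e').1.1 (w j) j := by rw [h]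
  rwa [monG_apply, monG_apply, if_pos rfl, if_pos (key j)] at h2

theorem permG_eq (w : Equiv.Perm (Fin n)) : permG r w = monG w (fun _ => 1) := by
  apply G_ext
  intro i j
  rw [monG_apply]
  simp [permG, permMat]

theorem permG_mul (u w : Equiv.Perm (Fin n)) : permG r (u * w) = permG r u * permG r w := by
  simp [permG_eq, monG_mul]

theorem permG_one : permG r (1 : Equiv.Perm (Fin n)) = 1 := by
  rw [permG_eq, monG_one]

theorem permG_inv (w : Equiv.Perm (Fin n)) : permG r w⁻¹ = (permG r w)⁻¹ := by
  simp [permG_eq, monG_inv]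

/-- The diagonal matrix with entry `η` at position `i`. -/
def diagRoot (i : Fin n) (η : rootsOfUnity r ℂ) : G r n :=
  monG 1 (fun k => if k = i then η else 1)

theorem diagG_eq (i : Fin n) : diagG r i = diagRoot i (zetaRoot r) := by
  apply G_ext
  intro k j
  rw [diagRoot, monG_apply]
  simp only [diagG, Matrix.diagonal_apply, Equiv.Perm.one_apply]
  split_ifs with h1 h2 <;> first | rfl | simp_all

theorem diagRoot_mul (i : Fin n) (η θ : rootsOfUnity r ℂ) :
    diagRoot i η * diagRoot i θ = diagRoot i (η * θ) := by
  rw [diagRoot, diagRoot, monG_mul, diagRoot]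
  congr 1
  funext k
  by_cases hk : k = i <;> simp [hk]

theorem diagRoot_one (i : Fin n) : diagRoot i (1 : rootsOfUnity r ℂ) = 1 := by
  rw [diagRoot, ← monG_one]; congr 1; funext k; simp

theorem diagRoot_inv (i : Fin n) (η : rootsOfUnity r ℂ) : (diagRoot i η)⁻¹ = diagRoot i η⁻¹ := by
  apply inv_eq_of_mul_eq_one_right
  rw [diagRoot_mul, mul_inv_cancel, diagRoot_one]

theorem diagG_pow (i : Fin n) (l : ℕ) : diagG r i ^ l = diagRoot i (zetaRoot r ^ l) := by
  induction l with
  | zero => rw [pow_zero, pow_zero, diagRoot_one]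
  | succ l ih => rw [pow_succ, pow_succ, ih, diagG_eq, diagRoot_mul]

/-- The reflection exchanging the lines of `y_i` and `y_j`, with `y_j ↦ η y_i`. -/
def reflRoot (i j : Fin n) (η : rootsOfUnity r ℂ) : G r n :=
  monG (Equiv.swap i j) (fun k => if k = i then η⁻¹ else if k = j then η else 1)

theorem diagRoot_swap_diagRoot (i j : Fin n) (h : i ≠ j) (η : rootsOfUnity r ℂ) :
    diagRoot i η * permG r (Equiv.swap i j) * (diagRoot i η)⁻¹ = reflRoot i j η := by
  rw [diagRoot_inv, diagRoot, diagRoot, permG_eq, monG_mul, monG_mul, one_mul, mul_one, reflRoot]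
  congr 1
  funext k
  simp only [Equiv.Perm.one_apply, mul_one]
  by_cases h1 : k = i
  · subst h1; simp [h.symm]
  · by_cases h2 : k = j
    · subst h2; simp [h1]
    · simp [h1, h2, Equiv.swap_apply_of_ne_of_ne h1 h2]

theorem reflG_eq (i j : Fin n) (h : i ≠ j) (l : ℕ) :
    reflG r i j l = reflRoot i j (zetaRoot r ^ l) := by
  rw [reflG, diagG_pow, diagRoot_swap_diagRoot i j h]

theorem reflRoot_comm (i j : Fin n) (h : i ≠ j) (η : rootsOfUnity r ℂ) :
    reflRoot i j η = reflRoot j i η⁻¹ := by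
  rw [reflRoot, reflRoot, Equiv.swap_comm]
  congr 1
  funext k
  by_cases h1 : k = i
  · subst h1; simp [h]
  · by_cases h2 : k = j
    · subst h2; simp [h1]
    · simp [h1, h2]

/-- Conjugation moves the two lines by `w` and rescales `η` by `e_i / e_j`. The rescaling disappears
once one sums over `η`. -/
theorem monG_mul_reflRoot (w : Equiv.Perm (Fin n)) (e : Fin n → rootsOfUnity r ℂ) (i j : Fin n)
    (h : i ≠ j) (η : rootsOfUnity r ℂ) :
    monG w e * reflRoot i j η = reflRoot (w i) (w j) (η * (e i * (e j)⁻¹)) * monG w e := by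
  rw [reflRoot, reflRoot, monG_mul, monG_mul]
  have hw : w * Equiv.swap i j = Equiv.swap (w i) (w j) * w := by
    rw [Equiv.swap_apply_apply]; group
  rw [hw]
  congr 1
  funext k
  by_cases h1 : k = i
  · subst h1
    simp [mul_comm, mul_left_comm]
  · by_cases h2 : k = j
    · subst h2
      simp [h1, mul_comm, mul_left_comm]
    · simp [h1, h2, Equiv.swap_apply_of_ne_of_ne h1 h2]

theorem monG_mul_diagRoot (w : Equiv.Perm (Fin n)) (e : Fin n → rootsOfUnity r ℂ) (i : Fin n)
    (η : rootsOfUnity r ℂ) :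
    monG w e * diagRoot i η = diagRoot (w i) η * monG w e := by
  rw [diagRoot, diagRoot, monG_mul, monG_mul, mul_one, one_mul]
  congr 1
  funext k
  simp [mul_comm]

theorem perm_induction {p : Equiv.Perm (Fin n) → Prop} (h1 : p 1)
    (hs : ∀ (i j : Fin n), i.1 + 1 = j.1 → ∀ w, p w → p (w * Equiv.swap i j))
    (w : Equiv.Perm (Fin n)) : p w := by
  rcases n with _ | n
  · rw [Subsingleton.elim w 1]; exact h1
  · have hw : w ∈ Submonoid.closure
        (Set.range fun i : Fin n => Equiv.swap i.castSucc i.succ) := by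
      rw [Equiv.Perm.mclosure_swap_castSucc_succ]; trivial
    induction hw using Submonoid.closure_induction_right with
    | one => exact h1
    | mul_right x _ y hy ih =>
      obtain ⟨i, rfl⟩ := hy
      exact hs _ _ (by simp) _ ih

/-- The relations of `M(λ)` prescribe only the action of the `ζ_i` and of the simple transpositions,
so statements about all of `G(r,1,n)` are reduced to these generators. -/
theorem G_induction {p : G r n → Prop} (hd : ∀ i, p (diagG r i))
    (hs : ∀ (i j : Fin n), i.1 + 1 = j.1 → p (permG r (Equiv.swap i j))) (h1 : p 1)
    (hm : ∀ a b, p a → p b → p (a * b)) (g : G r n) : p g := by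
  have hperm : ∀ w : Equiv.Perm (Fin n), p (permG r w) := fun w => by
    induction w using perm_induction with
    | h1 => rwa [permG_one]
    | hs i j hij w ih => rw [permG_mul]; exact hm _ _ ih (hs i j hij)
  have hroot : ∀ i (η : rootsOfUnity r ℂ), p (diagRoot i η) := fun i η => by
    obtain ⟨l, _, hl⟩ := (zeta_isPrimitiveRoot r).eq_pow_of_pow_eq_one (coe_root_pow η)
    have : η = zetaRoot r ^ l := rootsOfUnity_ext (by rw [coe_zetaRoot_pow, hl])
    rw [this, ← diagG_pow]
    clear this hl
    induction l with
    | zero => rwa [pow_zero]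
    | succ l ih => rw [pow_succ]; exact hm _ _ (ih (by omega)) (hd i)
  have hdiag : ∀ (s : Finset (Fin n)) (e : Fin n → rootsOfUnity r ℂ),
      p (monG 1 (fun k => if k ∈ s then e k else 1)) := fun s e => by
    induction s using Finset.induction_on with
    | empty => simpa [monG_one] using h1
    | insert a s ha ih =>
      have : (monG 1 (fun k => if k ∈ insert a s then e k else 1) : G r n)
          = diagRoot a (e a) * monG 1 (fun k => if k ∈ s then e k else 1) := by
        rw [diagRoot, monG_mul, one_mul]
        congr 1
        funext k
        by_cases hk : k = a
        · subst hk; simp [ha]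
        · simp [hk]
      rw [this]
      exact hm _ _ (hroot _ _) ih
  obtain ⟨w, e, rfl⟩ := exists_monG g
  have : monG w e = permG r w * monG 1 (fun k => if k ∈ Finset.univ then e k else 1) := by
    rw [permG_eq, monG_mul]
    simp
  rw [this]
  exact hm _ _ (hperm w) (hdiag _ _)

end Group

end

end Cherednik

namespace Cherednik

noncomputable section

/-! ### Relations in the rational Cherednik algebra -/

section Relations

set_option linter.unusedSectionVars false

variable {F : Type} [Field F] [Algebra ℂ F] {r n : ℕ} [NeZero r] (P : Params F r)

variable (F) in
/-- The image of a root of unity in the base field. -/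
def rootF (η : rootsOfUnity r ℂ) : F := algebraMap ℂ F ((η : ℂˣ) : ℂ)

theorem rootF_mul (a b : rootsOfUnity r ℂ) : rootF F (a * b) = rootF F a * rootF F b := by
  simp [rootF]

theorem rootF_one : rootF F (1 : rootsOfUnity r ℂ) = 1 := by
  simp [rootF]

theorem rootF_inv (a : rootsOfUnity r ℂ) : rootF F a⁻¹ = (rootF F a)⁻¹ := by
  simp [rootF]

theorem rootF_inv_mul (a : rootsOfUnity r ℂ) : rootF F a⁻¹ * rootF F a = 1 := by
  rw [← rootF_mul, inv_mul_cancel, rootF_one]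

theorem toH_rel {a b : FreeAlgebra F (Gen r n)} (h : Rel P n a b) : toH P n a = toH P n b :=
  RingQuot.mkAlgHom_rel F h

theorem t_one : t P (1 : G r n) = 1 := by
  have := toH_rel P (Rel.t_one (P := P) (n := n))
  rwa [map_one] at this

theorem t_mul (u w : G r n) : t P (u * w) = t P u * t P w := by
  have := toH_rel P (Rel.t_mul (P := P) u w)
  rw [map_mul] at this
  exact this.symm

theorem t_inv_mul (u : G r n) : t P u⁻¹ * t P u = 1 := by
  rw [← t_mul, inv_mul_cancel, t_one]

theorem t_mul_inv (u : G r n) : t P u * t P u⁻¹ = 1 := by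
  rw [← t_mul, mul_inv_cancel, t_one]

theorem t_pow (u : G r n) (l : ℕ) : t P (u ^ l) = t P u ^ l := by
  induction l with
  | zero => rw [pow_zero, pow_zero, t_one]
  | succ l ih => rw [pow_succ, pow_succ, t_mul, ih]

theorem x_comm (i j : Fin n) : x P i * x P j = x P j * x P i := by
  have := toH_rel P (Rel.xx (P := P) i j)
  rwa [map_mul, map_mul] at this

theorem t_x (w : Equiv.Perm (Fin n)) (e : Fin n → rootsOfUnity r ℂ) (j : Fin n) :
    t P (monG w e) * x P j = rootF F (e j)⁻¹ • (x P (w j) * t P (monG w e)) := by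
  have := toH_rel P (Rel.tx (P := P) (monG w e) j)
  rw [map_mul, map_mul, map_sum, monG_inv] at this
  rw [t, x, this, Finset.sum_eq_single (w j)]
  · rw [monG_apply]
    simp [x, rootF]
  · intro b _ hb
    rw [monG_apply, if_neg, map_zero, zero_smul, map_zero]
    rintro rfl
    simp at hb
  · simp

theorem t_y (w : Equiv.Perm (Fin n)) (e : Fin n → rootsOfUnity r ℂ) (j : Fin n) :
    t P (monG w e) * y P j = rootF F (e j) • (y P (w j) * t P (monG w e)) := by
  have := toH_rel P (Rel.ty (P := P) (monG w e) j)
  rw [map_mul, map_mul, map_sum] at this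
  rw [t, y, this, Finset.sum_eq_single (w j)]
  · rw [monG_apply, if_pos rfl, map_smul, smul_mul_assoc]
    rfl
  · intro b _ hb
    rw [monG_apply, if_neg hb, map_zero, zero_smul, map_zero]
  · simp

theorem t_perm_x (w : Equiv.Perm (Fin n)) (j : Fin n) :
    t P (permG r w) * x P j = x P (w j) * t P (permG r w) := by
  rw [permG_eq, t_x, inv_one, rootF_one, one_smul]

theorem t_perm_y (w : Equiv.Perm (Fin n)) (j : Fin n) :
    t P (permG r w) * y P j = y P (w j) * t P (permG r w) := by
  rw [permG_eq, t_y, rootF_one, one_smul]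

theorem t_refl_x_left (i j : Fin n) (η : rootsOfUnity r ℂ) :
    t P (reflRoot i j η) * x P i = rootF F η • (x P j * t P (reflRoot i j η)) := by
  rw [reflRoot, t_x]; simp

theorem t_refl_x_of_ne (i j k : Fin n) (hi : k ≠ i) (hj : k ≠ j) (η : rootsOfUnity r ℂ) :
    t P (reflRoot i j η) * x P k = x P k * t P (reflRoot i j η) := by
  rw [reflRoot, t_x, Equiv.swap_apply_of_ne_of_ne hi hj]; simp [hi, hj, rootF_one]

/-- The sum of the reflections exchanging the lines of `y_i` and `y_j`. -/
def reflSum (i j : Fin n) : H P n := ∑ η : rootsOfUnity r ℂ, t P (reflRoot i j η)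

theorem sum_reflG (i j : Fin n) (h : i ≠ j) :
    ∑ l ∈ Finset.range r, t P (reflG r i j l) = reflSum P i j := by
  rw [reflSum, ← sum_range_zetaRoot]
  exact Finset.sum_congr rfl fun l _ => by rw [reflG_eq i j h]

/-- The factor `e_i / e_j` produced by conjugation is absorbed by a translation of the summation
variable. -/
theorem t_mul_reflSum (w : Equiv.Perm (Fin n)) (e : Fin n → rootsOfUnity r ℂ) (i j : Fin n)
    (h : i ≠ j) :
    t P (monG w e) * reflSum P i j = reflSum P (w i) (w j) * t P (monG w e) := by
  simp only [reflSum, Finset.mul_sum, Finset.sum_mul, ← t_mul, monG_mul_reflRoot w e i j h]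
  exact Equiv.sum_comp (Equiv.mulRight (e i * (e j)⁻¹))
    (fun η => t P (reflRoot (w i) (w j) η * monG w e))

theorem t_perm_reflSum (w : Equiv.Perm (Fin n)) (i j : Fin n) (h : i ≠ j) :
    t P (permG r w) * reflSum P i j = reflSum P (w i) (w j) * t P (permG r w) := by
  rw [permG_eq, t_mul_reflSum P w _ i j h]

theorem jm_eq (i : Fin n) : jm P i = ∑ j ∈ Finset.Iio i, reflSum P i j :=
  Finset.sum_congr rfl fun j hj => sum_reflG P i j (Finset.mem_Iio.mp hj).ne'

theorem yx_ne (i j : Fin n) (h : i ≠ j) :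
    y P i * x P j = x P j * y P i
      + P.c₀ • ∑ η : rootsOfUnity r ℂ, rootF F η⁻¹ • t P (reflRoot i j η) := by
  have := toH_rel P (Rel.yx_ne (P := P) i j h)
  rw [map_mul, map_add, map_mul, map_smul, map_sum] at this
  rw [x, y, this, ← sum_range_zetaRoot]
  congr 2
  refine Finset.sum_congr rfl fun l _ => ?_
  rw [map_smul, reflG_eq i j h, rootF, t]
  simp

/-- The element `∑_j (d_j - d_{j-1}) e_{ij}`. -/
def dSum (i : Fin n) : H P n :=
  ∑ j ∈ Finset.range r, (P.d (j : ZMod r) - P.d ((j : ZMod r) - 1)) • toH P n (fe F i j)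

theorem yx_eq (i : Fin n) :
    y P i * x P i = x P i * y P i + algebraMap F _ P.κ - dSum P i
      - P.c₀ • ∑ j ∈ Finset.univ.erase i, reflSum P i j := by
  have := toH_rel P (Rel.yx_eq (P := P) i)
  rw [map_mul, map_sub, map_sub, map_add, map_mul, AlgHom.commutes, map_smul, map_sum,
    map_sum] at this
  rw [x, y, this, dSum]
  congr 2
  · exact Finset.sum_congr rfl fun l _ => by rw [map_smul]
  · refine Finset.sum_congr rfl fun j hj => ?_
    rw [← sum_reflG P i j (Finset.ne_of_mem_erase hj).symm, map_sum]
    rfl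

theorem diagRoot_comm (i j : Fin n) (η θ : rootsOfUnity r ℂ) :
    Commute (diagRoot i η) (diagRoot j θ) := by
  rw [Commute, SemiconjBy, diagRoot, diagRoot, monG_mul, monG_mul]
  congr 1
  funext k
  exact mul_comm _ _

theorem piH_eq (i j : Fin n) :
    piH P i j = ∑ η : rootsOfUnity r ℂ, t P (diagRoot i η * diagRoot j η⁻¹) := by
  rw [piH, ← sum_range_zetaRoot]
  refine Finset.sum_congr rfl fun l _ => ?_
  rw [← t_pow]
  congr 1
  rw [diagG_eq, diagG_eq, diagRoot_inv, (diagRoot_comm i j _ _).mul_pow, ← diagG_eq, diagG_pow,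
    ← diagRoot_inv, inv_pow, ← diagG_eq, diagG_pow, diagRoot_inv]

/-- A reflection in the lines `i, j` times the transposition is the diagonal element with entries
`η, η⁻¹`. This is the origin of `π_i` in the intertwiner. -/
theorem reflSum_mul_swap (i j : Fin n) (h : i ≠ j) :
    reflSum P j i * t P (permG r (Equiv.swap i j)) = piH P i j := by
  rw [piH_eq, reflSum, Finset.sum_mul, ← Equiv.sum_comp (Equiv.inv (rootsOfUnity r ℂ))]
  refine Finset.sum_congr rfl fun η _ => ?_
  rw [← t_mul]
  congr 1
  rw [permG_eq, reflRoot, monG_mul, diagRoot, diagRoot, monG_mul, Equiv.swap_comm,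
    Equiv.swap_mul_self, mul_one]
  congr 1
  funext k
  simp only [Equiv.inv_apply, Equiv.Perm.one_apply, inv_inv, mul_one]
  by_cases hi : k = i
  · subst hi; simp [h]
  · by_cases hj : k = j
    · subst hj; simp [h, h.symm]
    · simp [hi, hj, Equiv.swap_apply_of_ne_of_ne hi hj]

theorem Iio_succ_eq {i j : Fin n} (hij : i.1 + 1 = j.1) :
    Finset.Iio j = insert i (Finset.Iio i) := by
  ext k
  simp only [Finset.mem_Iio, Finset.mem_insert, Fin.lt_def, Fin.ext_iff]
  omega

theorem t_swap_mul_yx (w : Equiv.Perm (Fin n)) (i : Fin n) :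
    t P (permG r w) * (y P i * x P i) = y P (w i) * x P (w i) * t P (permG r w) := by
  rw [← mul_assoc, t_perm_y, mul_assoc, t_perm_x, mul_assoc]

/-- Conjugation by `s_i` turns `y_i x_i` into `y_{i+1} x_{i+1}`, and `φ_i` into `φ_{i+1}` without
its term exchanging the two neighbouring lines; that term, multiplied by `s_i`, is `π_i`. -/
theorem t_swap_mul_z {i j : Fin n} (hij : i.1 + 1 = j.1) :
    t P (permG r (Equiv.swap i j)) * z P i
      = z P j * t P (permG r (Equiv.swap i j)) - P.c₀ • piH P i j := by
  have hne : i ≠ j := fun h => by subst h; omega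
  rw [z, z, mul_add, t_swap_mul_yx, jm_eq, jm_eq, Iio_succ_eq hij,
    Finset.sum_insert (by simp), Equiv.swap_apply_left, add_mul, smul_mul_assoc, add_mul,
    reflSum_mul_swap P i j hne, mul_smul_comm, Finset.mul_sum, Finset.sum_mul]
  have : ∀ k ∈ Finset.Iio i, t P (permG r (Equiv.swap i j)) * reflSum P i k
      = reflSum P j k * t P (permG r (Equiv.swap i j)) := fun k hk => by
    have hk' := Finset.mem_Iio.mp hk
    rw [t_perm_reflSum P _ i k hk'.ne', Equiv.swap_apply_left,
      Equiv.swap_apply_of_ne_of_ne hk'.ne (fun h => by rw [Fin.lt_def, h] at hk'; omega)]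
  rw [Finset.sum_congr rfl this, smul_add]
  abel

theorem t_swap_sq (i j : Fin n) :
    t P (permG r (Equiv.swap i j)) * t P (permG r (Equiv.swap i j)) = 1 := by
  rw [← t_mul, ← permG_mul, Equiv.swap_mul_self, permG_one, t_one]

theorem swap_mul_piH (i j : Fin n) :
    t P (permG r (Equiv.swap i j)) * piH P i j = piH P i j * t P (permG r (Equiv.swap i j)) := by
  rw [piH_eq, Finset.mul_sum, Finset.sum_mul, ← Equiv.sum_comp (Equiv.inv (rootsOfUnity r ℂ))]
  refine Finset.sum_congr rfl fun η _ => ?_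
  rw [← t_mul, ← t_mul, permG_eq, ← mul_assoc, diagRoot, diagRoot, diagRoot, diagRoot]
  simp only [monG_mul, mul_one, one_mul, Equiv.inv_apply, Equiv.Perm.one_apply, inv_inv]
  congr 2
  funext k
  by_cases hi : k = i
  · subst hi
    simp [eq_comm]
  · by_cases hj : k = j
    · subst hj; simp [hi, Ne.symm hi]
    · simp [hi, hj, Equiv.swap_apply_of_ne_of_ne hi hj]

theorem z_mul_t_swap {i j : Fin n} (hij : i.1 + 1 = j.1) :
    z P i * t P (permG r (Equiv.swap i j))
      = t P (permG r (Equiv.swap i j)) * z P j - P.c₀ • piH P i j := by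
  have h := t_swap_mul_z P hij
  set s := t P (permG r (Equiv.swap i j)) with hs
  have hss : s * s = 1 := t_swap_sq P i j
  have hp : s * piH P i j = piH P i j * s := swap_mul_piH P i j
  have h1 : z P i = s * (z P j * s - P.c₀ • piH P i j) := by
    rw [← h, ← mul_assoc, hss, one_mul]
  rw [h1, mul_sub, sub_mul, mul_assoc s, mul_assoc (z P j), hss, mul_one, mul_smul_comm, hp,
    smul_mul_assoc, mul_assoc, hss, mul_one]

/-- The neighbours `i, j` lie on the same side of `k`, so the transposition permutes the terms of
the Jucys–Murphy sum at `k`. -/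
theorem z_mul_t_swap_of_ne {i j k : Fin n} (hij : i.1 + 1 = j.1) (hi : k ≠ i) (hj : k ≠ j) :
    z P k * t P (permG r (Equiv.swap i j)) = t P (permG r (Equiv.swap i j)) * z P k := by
  symm
  rw [z, mul_add, t_swap_mul_yx, add_mul, Equiv.swap_apply_of_ne_of_ne hi hj, mul_smul_comm,
    smul_mul_assoc, jm_eq, Finset.mul_sum, Finset.sum_mul]
  congr 2
  have h1 : ∀ l ∈ Finset.Iio k, t P (permG r (Equiv.swap i j)) * reflSum P k l
      = reflSum P k (Equiv.swap i j l) * t P (permG r (Equiv.swap i j)) := fun l hl => by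
    rw [t_perm_reflSum P _ k l (Finset.mem_Iio.mp hl).ne', Equiv.swap_apply_of_ne_of_ne hi hj]
  rw [Finset.sum_congr rfl h1]
  refine Finset.sum_equiv (Equiv.swap i j) (fun l => ?_) (fun _ _ => rfl)
  simp only [Finset.mem_Iio, Equiv.swap_apply_def, Fin.lt_def]
  simp only [ne_eq, Fin.ext_iff] at hi hj
  split_ifs with h1 h2
  · subst h1; omega
  · subst h2; omega
  · rfl

/-! ### The operators `Φ` and `Ψ` -/

theorem prefix_prod_apply (m : ℕ) (hm : m + 1 ≤ n) (i : Fin n) :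
    ((List.ofFn fun k : Fin m => Equiv.swap (⟨k.1, by omega⟩ : Fin n) ⟨k.1 + 1, by omega⟩).prod
      i).1 = if i.1 < m then i.1 + 1 else if i.1 = m then 0 else i.1 := by
  induction m generalizing i with
  | zero => simp
  | succ m ih =>
    rw [List.ofFn_succ', List.concat_eq_append, List.prod_append, List.prod_singleton,
      Equiv.Perm.mul_apply]
    have := ih (by omega)
    simp only [Fin.val_castSucc, Fin.val_last] at this ⊢
    rw [this, Equiv.swap_apply_def]
    simp only [Fin.ext_iff]
    split_ifs <;> simp_all <;> try omega

/-- The cycle `s_{n-1} ⋯ s_1`. -/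
def rot (n : ℕ) : Equiv.Perm (Fin n) := (simpleList n).reverse.prod

theorem simpleList_prod : (simpleList n).prod = (rot n)⁻¹ := by
  rw [rot, List.prod_inv_reverse, ← List.map_reverse, List.reverse_reverse]
  congr 1
  rw [simpleList, List.map_ofFn]
  congr 1

theorem rot_symm_apply [NeZero n] (i : Fin n) :
    ((rot n)⁻¹ i).1 = if i.1 + 1 < n then i.1 + 1 else 0 := by
  rw [← simpleList_prod, simpleList]
  have hn := NeZero.pos n
  have := prefix_prod_apply (n - 1) (by omega) i
  rw [this]
  split_ifs <;> omega

theorem rot_of_lt {i i' : Fin n} [NeZero n] (h : i.1 + 1 = i'.1) : rot n i' = i := by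
  have h2 : (rot n)⁻¹ i = i' := by
    ext
    rw [rot_symm_apply, if_pos (by omega), h]
  rw [← h2]; simp

theorem rot_zero [NeZero n] : rot n 0 = lastIdx n := by
  have h2 : (rot n)⁻¹ (lastIdx n) = 0 := by
    ext
    have hn := NeZero.pos n
    rw [rot_symm_apply, if_neg (by simp only [lastIdx]; omega)]
    simp
  rw [← h2]; simp

theorem rot_zero_or {i : Fin n} [NeZero n] : i = lastIdx n ∨ ∃ i' : Fin n, i.1 + 1 = i'.1 := by
  by_cases h : i.1 + 1 < n
  · exact Or.inr ⟨⟨i.1 + 1, h⟩, rfl⟩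
  · left; ext; simp only [lastIdx]; omega

variable [NeZero n]

theorem Phi_eq : Phi P n = x P (lastIdx n) * t P (permG r (rot n)) := rfl

theorem Psi_eq : Psi P n = y P 0 * t P (permG r (rot n)⁻¹) := by
  rw [Psi, simpleList_prod]

theorem z_zero : z P (0 : Fin n) = y P 0 * x P 0 := by
  rw [z, jm_eq, show (Finset.Iio (0 : Fin n)) = ∅ by
    ext k; simp, Finset.sum_empty, smul_zero, add_zero]

/-- The two cycles cancel after carrying `x_n` to `x_1`; what remains is `y_1 x_1`, which is `z_1`
because its Jucys–Murphy sum is empty. -/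
theorem Psi_mul_Phi : Psi P n * Phi P n = z P 0 := by
  have h : (rot n)⁻¹ (lastIdx n) = 0 := by rw [← rot_zero]; simp
  rw [Psi_eq, Phi_eq, z_zero, mul_assoc, ← mul_assoc (t P _), t_perm_x, h, mul_assoc,
    ← t_mul, ← permG_mul, inv_mul_cancel, permG_one, t_one, mul_one]

theorem Iio_last : Finset.Iio (lastIdx n) = Finset.univ.erase (lastIdx n) := by
  ext k
  have hn := NeZero.pos n
  simp only [Finset.mem_Iio, Finset.mem_erase, Finset.mem_univ, and_true, ne_eq, Fin.ext_iff,
    Fin.lt_def, lastIdx]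
  omega

/-- For the last index the Jucys–Murphy sum runs over all other indices, so it cancels the
reflections in the relation for `y_n x_n`. -/
theorem z_last : z P (lastIdx n) = x P (lastIdx n) * y P (lastIdx n) + algebraMap F _ P.κ
    - dSum P (lastIdx n) := by
  rw [z, yx_eq, jm_eq, Iio_last]
  abel

theorem Phi_mul_Psi : Phi P n * Psi P n
    = z P (lastIdx n) - algebraMap F _ P.κ + dSum P (lastIdx n) := by
  rw [Psi_eq, Phi_eq, z_last, mul_assoc, ← mul_assoc (t P _), t_perm_y, rot_zero, mul_assoc,
    ← t_mul, ← permG_mul, mul_inv_cancel, permG_one, t_one, mul_one]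
  abel

theorem z_last_mul_Phi : z P (lastIdx n) * Phi P n
    = Phi P n * z P 0 + (algebraMap F _ P.κ - dSum P (lastIdx n)) * Phi P n := by
  have h : Phi P n * z P 0 = x P (lastIdx n) * y P (lastIdx n) * Phi P n := by
    rw [z_zero, Phi_eq, mul_assoc, t_swap_mul_yx, rot_zero]
    simp only [mul_assoc]
  rw [h, z_last]
  noncomm_ring

/-- Two corrections cancel: the rotation turns the reflections pairing `i'` with the first line into
those pairing `i` with the last line, and the commutator of `y_i` with `x_n` produces exactly the
same sum. -/
theorem z_mul_Phi {i i' : Fin n} (h : i.1 + 1 = i'.1) : z P i * Phi P n = Phi P n * z P i' := by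
  have hn := NeZero.pos n
  have hlast : ∀ k : Fin n, k ≤ i → k ≠ lastIdx n := fun k hk e => by
    have := i'.2
    subst e
    simp only [lastIdx, Fin.le_def] at hk
    omega
  have h0 : i' ≠ 0 := fun e => by rw [e, Fin.val_zero] at h; omega
  -- The rotation sends index 0 to the last one, which lies outside the range `k < i`; this accounts
  -- for the extra reflection sum.
  have key : t P (permG r (rot n)) * z P i'
      = (z P i + P.c₀ • reflSum P i (lastIdx n)) * t P (permG r (rot n)) := by
    have hI : Finset.Iio i' = insert 0 ((Finset.Iio i').erase 0) :=
      (Finset.insert_erase (Finset.mem_Iio.mpr (Fin.pos_iff_ne_zero.mpr h0))).symm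
    rw [z, mul_add, t_swap_mul_yx, rot_of_lt h, mul_smul_comm, jm_eq, hI,
      Finset.sum_insert (by simp), mul_add, t_perm_reflSum P _ _ _ h0, rot_of_lt h, rot_zero, z,
      jm_eq, add_mul, add_mul, smul_mul_assoc, smul_mul_assoc, Finset.mul_sum, Finset.sum_mul,
      add_assoc, smul_add, add_comm (P.c₀ • _)]
    congr 3
    refine Finset.sum_bij (fun k _ => rot n k) (fun k hk => ?_) (fun _ _ _ _ e => (rot n).injective e)
      (fun k hk => ?_) (fun k hk => ?_)
    · obtain ⟨hk0, hk⟩ := Finset.mem_erase.mp hk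
      have hk1 : k.1 ≠ 0 := fun e => hk0 (Fin.ext (by simpa using e))
      rw [rot_of_lt (i := ⟨k.1 - 1, by omega⟩) (i' := k) (by simp only; omega)]
      simp only [Finset.mem_Iio, Fin.lt_def] at hk ⊢
      omega
    · have hk' := Finset.mem_Iio.mp hk
      rw [Fin.lt_def] at hk'
      refine ⟨⟨k.1 + 1, by omega⟩, ?_, rot_of_lt rfl⟩
      simp only [Finset.mem_erase, Finset.mem_Iio, Fin.lt_def, ne_eq, Fin.ext_iff, Fin.val_zero]
      omega
    · obtain ⟨hk0, hk⟩ := Finset.mem_erase.mp hk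
      rw [t_perm_reflSum P _ _ _ (Finset.mem_Iio.mp hk).ne', rot_of_lt h]
  -- Moving the remaining `x_i` across the reflections turns it into `x_n` and cancels the
  -- characters `η⁻¹` of the commutator. The Jucys–Murphy part involves only lines other than the
  -- last and commutes with `x_n`.
  have hx : z P i * x P (lastIdx n)
      = x P (lastIdx n) * (z P i + P.c₀ • reflSum P i (lastIdx n)) := by
    have hil := hlast i le_rfl
    have h1 : y P i * x P i * x P (lastIdx n) = x P (lastIdx n) * (y P i * x P i)
        + P.c₀ • (x P (lastIdx n) * reflSum P i (lastIdx n)) := by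
      rw [mul_assoc, x_comm, ← mul_assoc, yx_ne P i _ hil, add_mul, mul_assoc, smul_mul_assoc,
        Finset.sum_mul, reflSum, Finset.mul_sum]
      congr 2
      refine Finset.sum_congr rfl fun η _ => ?_
      rw [smul_mul_assoc, t_refl_x_left, smul_smul, rootF_inv_mul, one_smul]
    have h2 : jm P i * x P (lastIdx n) = x P (lastIdx n) * jm P i := by
      rw [jm_eq, Finset.sum_mul, Finset.mul_sum]
      refine Finset.sum_congr rfl fun k hk => ?_
      rw [reflSum, Finset.sum_mul, Finset.mul_sum]
      refine Finset.sum_congr rfl fun η _ => ?_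
      exact t_refl_x_of_ne P i k _ hil.symm (hlast k (Finset.mem_Iio.mp hk).le).symm η
    rw [z, add_mul, h1, smul_mul_assoc, h2, mul_add, mul_add, mul_smul_comm, mul_smul_comm]
    abel
  rw [Phi_eq, ← mul_assoc, hx, mul_assoc, ← key, mul_assoc]

theorem t_diag_mul_Phi {i i' : Fin n} (h : i.1 + 1 = i'.1) :
    t P (diagG r i) * Phi P n = Phi P n * t P (diagG r i') := by
  have hn := NeZero.pos n
  have hil : lastIdx n ≠ i := fun e => by
    have := i'.2
    rw [← e] at h
    simp only [lastIdx] at h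
    omega
  rw [Phi_eq, mul_assoc, ← t_mul, permG_eq, diagG_eq i', monG_mul_diagRoot, rot_of_lt h, ← diagG_eq,
    t_mul, ← mul_assoc, ← mul_assoc, diagG_eq, diagRoot, t_x]
  simp [hil, rootF_one]

/-- The factor `ζ⁻¹` comes from `x_n` and records that the entry moved to the last place has grown
by one. -/
theorem t_diag_last_mul_Phi :
    t P (diagG r (lastIdx n)) * Phi P n
      = algebraMap ℂ F (zeta r)⁻¹ • (Phi P n * t P (diagG r 0)) := by
  rw [Phi_eq, mul_assoc, ← t_mul, permG_eq, diagG_eq 0, monG_mul_diagRoot, rot_zero, diagG_eq,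
    t_mul, ← mul_assoc, ← mul_assoc, diagRoot, t_x]
  simp [rootF]

end Relations

end

end Cherednik

namespace Cherednik

noncomputable section

/-! ### Combinatorics of compositions -/

section CompositionOrder

variable {n : ℕ}

theorem wPerm_lt (μ : Fin n → ℕ) {i k : Fin n} (h : μ i < μ k ∨ (μ i = μ k ∧ k < i)) :
    wPerm μ i < wPerm μ k := wFun_strict μ i k h

theorem perm_eq_of_lt_imp {σ τ : Equiv.Perm (Fin n)}
    (h : ∀ i k, τ i < τ k → σ i < σ k) : σ = τ := by
  have hmono : StrictMono (τ.symm.trans σ) := fun a b hab => by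
    have := h (τ.symm a) (τ.symm b) (by simpa using hab)
    simpa using this
  have h2 : (hmono.orderIsoOfSurjective _ (Equiv.surjective _)) = OrderIso.refl (Fin n) :=
    Subsingleton.elim _ _
  ext i
  have h3 := DFunLike.congr_fun h2 (τ i)
  simp only [StrictMono.coe_orderIsoOfSurjective, OrderIso.refl_apply, Equiv.trans_apply,
    Equiv.symm_apply_apply] at h3
  rw [h3]

/-- `w_μ` is the rank function of a total order on positions: smaller entries first, ties from right
to left. A permutation increasing for this order is therefore `w_μ`, and the identities for `w_μ`
under moves of `μ` are proved this way. -/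
theorem wPerm_unique {μ : Fin n → ℕ} {σ : Equiv.Perm (Fin n)}
    (h : ∀ i k, (μ i < μ k ∨ (μ i = μ k ∧ k < i)) → σ i < σ k) : σ = wPerm μ := by
  refine perm_eq_of_lt_imp fun i k hik => h i k ?_
  by_contra hcon
  have hne : i ≠ k := fun e => by subst e; exact lt_irrefl _ hik
  have : μ k < μ i ∨ (μ k = μ i ∧ i < k) := by
    rcases lt_trichotomy (μ i) (μ k) with h1 | h1 | h1
    · exact absurd (Or.inl h1) hcon
    · rcases lt_or_gt_of_ne hne with h2 | h2
      · exact Or.inr ⟨h1.symm, h2⟩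
      · exact absurd (Or.inr ⟨h1, h2⟩) hcon
    · exact Or.inl h1
  exact absurd (wPerm_lt μ this) hik.not_gt

/-- The condition on intermediate entries is needed because ties are ordered by position: an entry
carried past an equal one would change rank. -/
theorem wPerm_comp_swap {μ : Fin n → ℕ} {i j : Fin n} (hij : i < j) (h : μ i ≠ μ j)
    (htie : ∀ k, i < k → k < j → μ k ≠ μ i ∧ μ k ≠ μ j) :
    wPerm (μ ∘ Equiv.swap i j) = wPerm μ * Equiv.swap i j := by
  symm
  apply wPerm_unique
  intro a b hab
  rw [Equiv.Perm.mul_apply, Equiv.Perm.mul_apply]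
  apply wPerm_lt
  simp only [Function.comp_apply] at hab
  rcases hab with hab | ⟨hab, hba⟩
  · exact Or.inl hab
  · refine Or.inr ⟨hab, ?_⟩
    have key : ∀ k, i < k → k < j → μ k ≠ μ i ∧ μ k ≠ μ j := htie
    have ka := key a
    have kb := key b
    simp only [Equiv.swap_apply_def] at hab ⊢
    by_cases ha1 : a = i <;> by_cases ha2 : a = j <;> by_cases hb1 : b = i <;>
      by_cases hb2 : b = j <;> simp only [ha1, ha2, hb1, hb2, if_true, if_false] at hab ⊢ <;>
      grind

theorem wPerm_comp_swap_adj {μ : Fin n → ℕ} {i j : Fin n} (hij : i.1 + 1 = j.1) (h : μ i ≠ μ j) :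
    wPerm (μ ∘ Equiv.swap i j) = wPerm μ * Equiv.swap i j := by
  refine wPerm_comp_swap (by rw [Fin.lt_def]; omega) h fun k h1 h2 => ?_
  rw [Fin.lt_def] at h1 h2
  omega

theorem wPerm_tie {μ : Fin n → ℕ} {i j : Fin n} (hij : i.1 + 1 = j.1) (h : μ i = μ j) :
    (wPerm μ j).1 + 1 = (wPerm μ i).1 := by
  change wFun μ j + 1 = wFun μ i
  rw [wFun_eq, wFun_eq]
  have : (Finset.univ.filter fun k => μ k < μ i ∨ (μ k = μ i ∧ i < k))
      = insert j (Finset.univ.filter fun k => μ k < μ j ∨ (μ k = μ j ∧ j < k)) := by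
    ext k
    simp only [Finset.mem_filter, Finset.mem_univ, true_and, Finset.mem_insert, h, Fin.lt_def,
      Fin.ext_iff]
    by_cases hk : k = j
    · subst hk; simp; omega
    · have : k.1 ≠ j.1 := fun e => hk (Fin.ext e)
      omega
  rw [this, Finset.card_insert_of_notMem (by simp)]

variable [NeZero n]

theorem phiC_of_lt {μ : Fin n → ℕ} {i i' : Fin n} (h : i.1 + 1 = i'.1) : phiC μ i = μ i' := by
  rw [phiC, dif_pos (by omega)]
  congr 1
  exact Fin.ext h

theorem phiC_last (μ : Fin n → ℕ) : phiC μ (lastIdx n) = μ 0 + 1 := by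
  have := NeZero.pos n
  rw [phiC, dif_neg (by simp only [lastIdx]; omega)]

/-- In first place an entry `a` ranks above all other entries at most `a`. In last place `a + 1`
ranks below all other entries at least `a + 1`. These are the same rank, so only the position
changes. -/
theorem wPerm_phiC (μ : Fin n → ℕ) : wPerm (phiC μ) = wPerm μ * (rot n)⁻¹ := by
  symm
  apply wPerm_unique
  have hval : ∀ i : Fin n, (i = lastIdx n ∧ (rot n)⁻¹ i = 0 ∧ phiC μ i = μ 0 + 1) ∨
      ∃ i' : Fin n, i.1 + 1 = i'.1 ∧ (rot n)⁻¹ i = i' ∧ phiC μ i = μ i' := fun i => by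
    rcases rot_zero_or (i := i) with rfl | ⟨i', h⟩
    · exact Or.inl ⟨rfl, by rw [← rot_zero]; simp, phiC_last μ⟩
    · exact Or.inr ⟨i', h, by rw [← rot_of_lt h]; simp, phiC_of_lt h⟩
  intro a b hab
  rw [Equiv.Perm.mul_apply, Equiv.Perm.mul_apply]
  apply wPerm_lt
  have hl : (lastIdx n).1 = n - 1 := rfl
  simp only [Fin.lt_def] at hab ⊢
  rcases hval a with ⟨rfl, ha, ha2⟩ | ⟨a', ha1, ha, ha2⟩ <;>
    rcases hval b with ⟨rfl, hb, hb2⟩ | ⟨b', hb1, hb, hb2⟩ <;>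
    simp only [ha, hb] <;> simp only [ha2, hb2] at hab <;> (try simp only [Fin.val_zero]) <;> omega

theorem wPerm_last {μ : Fin n → ℕ} (h : μ (lastIdx n) = 0) : (wPerm μ (lastIdx n)).1 = 0 := by
  change wFun μ _ = 0
  rw [wFun_eq, Finset.card_eq_zero, Finset.filter_eq_empty_iff]
  intro k _ hk
  have := k.2
  rcases hk with hk | ⟨_, hk⟩
  · omega
  · simp only [Fin.lt_def, lastIdx] at hk
    omega

theorem phiC_psiC {μ : Fin n → ℕ} (h : 0 < μ (lastIdx n)) : phiC (psiC μ) = μ := by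
  funext i
  rcases rot_zero_or (i := i) with rfl | ⟨i', h1⟩
  · rw [phiC_last, psiC, if_pos (by simp)]
    omega
  · rw [phiC_of_lt h1, psiC, if_neg (by omega)]
    congr 1
    ext
    simp only
    omega

theorem phiC_injective : Function.Injective (phiC (n := n)) := by
  intro μ ν h
  funext i
  by_cases hi : i = 0
  · subst hi
    have := congrFun h (lastIdx n)
    rw [phiC_last, phiC_last] at this
    omega
  · have hi0 : i.1 ≠ 0 := fun e => hi (Fin.ext (by simpa using e))
    have h2 : (⟨i.1 - 1, by omega⟩ : Fin n).1 + 1 = i.1 := by simp only; omega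
    have := congrFun h ⟨i.1 - 1, by omega⟩
    rwa [phiC_of_lt h2, phiC_of_lt h2] at this

omit [NeZero n]

/-! ### Lengths and the Bruhat order -/

/-- The inversions of the shorter permutation inject into those of `w`, and the image misses the
inversion `(i, j)`. -/
theorem len_mul_swap_lt {w : Equiv.Perm (Fin n)} {i j : Fin n} (hij : i < j) (h : w j < w i) :
    len (w * Equiv.swap i j) < len w := by
  set s := Equiv.swap i j with hs
  have hss : ∀ k, s (s k) = k := fun k => Equiv.swap_apply_self i j k
  -- Both positions are exchanged when their order survives, and the pair is kept otherwise. This is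
  -- an involution on increasing pairs, hence injective there.
  let f : Fin n × Fin n → Fin n × Fin n := fun p => if s p.1 < s p.2 then (s p.1, s p.2) else p
  have hcases : ∀ k, (k = i ∧ s k = j) ∨ (k = j ∧ s k = i) ∨ (k ≠ i ∧ k ≠ j ∧ s k = k) := by
    intro k
    by_cases h1 : k = i
    · exact Or.inl ⟨h1, by rw [h1, hs, Equiv.swap_apply_left]⟩
    · by_cases h2 : k = j
      · exact Or.inr (Or.inl ⟨h2, by rw [h2, hs, Equiv.swap_apply_right]⟩)
      · exact Or.inr (Or.inr ⟨h1, h2, Equiv.swap_apply_of_ne_of_ne h1 h2⟩)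
  have hf : ∀ p : Fin n × Fin n, p.1 < p.2 → f (f p) = p := by
    rintro ⟨a, b⟩ hab
    simp only [f]
    by_cases h1 : s a < s b
    · rw [if_pos h1]
      simp only [hss]
      rw [if_pos hab]
    · rw [if_neg h1]
      simp only [if_neg h1]
  have hmem : ∀ p ∈ (Finset.univ.filter fun p : Fin n × Fin n =>
        p.1 < p.2 ∧ (w * s) p.2 < (w * s) p.1),
      f p ∈ (Finset.univ.filter fun p : Fin n × Fin n => p.1 < p.2 ∧ w p.2 < w p.1).erase
        (i, j) := by
    rintro ⟨a, b⟩ hp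
    obtain ⟨hab, hw⟩ := (Finset.mem_filter.mp hp).2
    rw [Equiv.Perm.mul_apply, Equiv.Perm.mul_apply] at hw
    simp only at hab hw
    simp only [Finset.mem_erase, Finset.mem_filter, Finset.mem_univ, true_and, f]
    by_cases h1 : s a < s b
    · rw [if_pos h1]
      refine ⟨fun e => ?_, h1, hw⟩
      simp only [Prod.mk.injEq] at e
      have ha : a = j := by rw [← hss a, e.1, hs, Equiv.swap_apply_left]
      have hb : b = i := by rw [← hss b, e.2, hs, Equiv.swap_apply_right]
      subst ha hb
      exact absurd hij hab.not_gt
    · rw [if_neg h1]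
      rcases hcases a with ⟨ha, ha'⟩ | ⟨ha, ha'⟩ | ⟨ha, ha1, ha'⟩ <;>
        rcases hcases b with ⟨hb, hb'⟩ | ⟨hb, hb'⟩ | ⟨hb, hb1, hb'⟩ <;>
        rw [ha', hb'] at hw h1 <;> (try subst ha) <;> (try subst hb) <;>
        simp only [ne_eq, Prod.mk.injEq] <;> grind
  have hinj : Set.InjOn f (Finset.univ.filter fun p : Fin n × Fin n =>
      p.1 < p.2 ∧ (w * s) p.2 < (w * s) p.1) := by
    intro p hp q hq hpq
    rw [← hf p (Finset.mem_filter.mp hp).2.1, ← hf q (Finset.mem_filter.mp hq).2.1, hpq]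
  refine lt_of_le_of_lt (Finset.card_le_card_of_injOn f hmem hinj) ?_
  apply Finset.card_lt_card
  apply Finset.erase_ssubset
  simp [hij, h]

theorem BruhatLT.len_lt {u w : Equiv.Perm (Fin n)} (h : BruhatLT u w) : len u < len w := by
  induction h with
  | single h => exact h.2
  | tail _ h ih => exact ih.trans h.2

/-! ### Rearrangements and dominance -/

/-- The permutation sorting `μ` in non-increasing order. -/
def decrPerm (μ : Fin n → ℕ) : Equiv.Perm (Fin n) := Fin.revPerm.trans (Tuple.sort μ)

theorem decr_antitone (μ : Fin n → ℕ) : Antitone (decr μ) := fun _ _ h =>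
  Tuple.monotone_sort μ (Fin.rev_le_rev.mpr h)

theorem decr_comp_perm (μ : Fin n → ℕ) (σ : Equiv.Perm (Fin n)) : decr (μ ∘ σ) = decr μ := by
  funext i
  exact congrFun (Tuple.comp_perm_comp_sort_eq_comp_sort (f := μ) (σ := σ)) i.rev

theorem sum_decr {A : Type*} [AddCommMonoid A] (μ : Fin n → ℕ) (g : ℕ → A) :
    ∑ i, g (decr μ i) = ∑ i, g (μ i) :=
  Equiv.sum_comp (decrPerm μ) (fun i => g (μ i))

/-- With truncated subtraction, `a ≤ c + (a - c)` for any threshold `c`. Equality of the two sides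
holds at `c = decr μ m`, which is the next lemma. Together they reduce dominance to comparing the
sums of `(μ_i - c)₊`, where no sorting is involved. -/
theorem sum_decr_Iic_le (μ : Fin n → ℕ) (m : Fin n) (c : ℕ) :
    ∑ i ∈ Finset.Iic m, decr μ i ≤ ∑ _i ∈ Finset.Iic m, c + ∑ i, (μ i - c) := by
  rw [← sum_decr μ (fun a => a - c)]
  calc _ ≤ ∑ i ∈ Finset.Iic m, (c + (decr μ i - c)) := Finset.sum_le_sum fun i _ => by omega
    _ = ∑ _i ∈ Finset.Iic m, c + ∑ i ∈ Finset.Iic m, (decr μ i - c) := Finset.sum_add_distrib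
    _ ≤ _ := by
      gcongr
      exact Finset.subset_univ _

theorem sum_decr_Iic_eq (μ : Fin n → ℕ) (m : Fin n) :
    ∑ i ∈ Finset.Iic m, decr μ i
      = ∑ _i ∈ Finset.Iic m, decr μ m + ∑ i, (μ i - decr μ m) := by
  rw [← sum_decr μ (fun a => a - decr μ m),
    ← Finset.sum_subset (Finset.subset_univ (Finset.Iic m)), ← Finset.sum_add_distrib]
  · refine Finset.sum_congr rfl fun i hi => ?_
    have := decr_antitone μ (Finset.mem_Iic.mp hi)
    omega
  · intro i _ hi
    have := decr_antitone μ (not_le.mp (fun h => hi (Finset.mem_Iic.mpr h))).le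
    omega

theorem sum_eq_pair {A : Type*} [AddCommMonoid A] {i j : Fin n} (hij : i ≠ j) (g : Fin n → A) :
    ∑ k, g k = g i + g j + ∑ k ∈ (Finset.univ.erase i).erase j, g k := by
  rw [← Finset.add_sum_erase _ _ (Finset.mem_univ i),
    ← Finset.add_sum_erase _ _ (Finset.mem_erase.mpr ⟨hij.symm, Finset.mem_univ j⟩), add_assoc]

/-- Moving two entries towards each other with fixed sum does not increase the sum of the convex
function `a ↦ (a - c)₊`, for any threshold `c`. -/
theorem domLT_of_inner {ν μ : Fin n → ℕ} {i j : Fin n} (hij : i ≠ j)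
    (hoff : ∀ k, k ≠ i → k ≠ j → ν k = μ k) (hsum : ν i + ν j = μ i + μ j)
    (h1 : μ i < ν i) (h2 : ν i < μ j) : DomLT (decr ν) (decr μ) := by
  have hrest : ∀ (g : ℕ → ℕ), ∑ k ∈ (Finset.univ.erase i).erase j, g (ν k)
      = ∑ k ∈ (Finset.univ.erase i).erase j, g (μ k) := fun g => by
    refine Finset.sum_congr rfl fun k hk => ?_
    simp only [Finset.mem_erase, Finset.mem_univ, and_true] at hk
    rw [hoff k hk.2 hk.1]
  refine ⟨fun e => ?_, ?_, fun m => ?_⟩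
  -- The sum of squares strictly drops, so the two rearrangements differ.
  · have h3 : ∑ k, (decr ν k) * (decr ν k) = ∑ k, (decr μ k) * (decr μ k) := by rw [e]
    rw [sum_decr ν (fun a => a * a), sum_decr μ (fun a => a * a), sum_eq_pair hij,
      sum_eq_pair hij (fun k => μ k * μ k), hrest (fun a => a * a)] at h3
    have h4 : ν i * ν i + ν j * ν j = μ i * μ i + μ j * μ j := by omega
    have h5 : ν j = μ i + μ j - ν i := by omega
    obtain ⟨a, ha⟩ := Nat.exists_eq_add_of_lt h1
    obtain ⟨b, hb⟩ := Nat.exists_eq_add_of_lt h2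
    have h6 : ν j = μ i + b + 1 := by omega
    rw [h6, hb, ha] at h4
    nlinarith
  · have := sum_decr ν id
    have h2 := sum_decr μ id
    have h3 := hrest id
    simp only [id] at this h2 h3
    rw [this, h2, sum_eq_pair hij, sum_eq_pair hij μ, h3, hsum]
  -- The threshold is the `m`-th largest entry of `μ`, where the bound is an equality for `μ`.
  · rw [sum_decr_Iic_eq μ m]
    refine (sum_decr_Iic_le ν m (decr μ m)).trans ?_
    gcongr 1
    rw [sum_eq_pair hij, sum_eq_pair hij (fun k => μ k - decr μ m), hrest (fun a => a - decr μ m)]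
    omega

theorem DomLT.trans {a b c : Fin n → ℕ} (h1 : DomLT a b) (h2 : DomLT b c) : DomLT a c := by
  refine ⟨fun e => ?_, h1.2.1.trans h2.2.1, fun m => (h1.2.2 m).trans (h2.2.2 m)⟩
  subst e
  refine h1.1 ?_
  have hs : ∀ m, ∑ i ∈ Finset.Iic m, a i = ∑ i ∈ Finset.Iic m, b i := fun m =>
    le_antisymm (h1.2.2 m) (h2.2.2 m)
  exact eq_of_sum_Iic_eq hs
where
  eq_of_sum_Iic_eq {a b : Fin n → ℕ}
      (hs : ∀ m, ∑ i ∈ Finset.Iic m, a i = ∑ i ∈ Finset.Iic m, b i) : a = b := by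
    funext m
    induction m using WellFoundedLT.induction with
    | ind m ih =>
      have h := hs m
      rw [← Finset.Iio_insert, Finset.sum_insert (by simp), Finset.sum_insert (by simp)] at h
      have h2 : ∑ k ∈ Finset.Iio m, a k = ∑ k ∈ Finset.Iio m, b k :=
        Finset.sum_congr rfl fun k hk => ih k (Finset.mem_Iio.mp hk)
      omega

theorem CompLT.trans {a b c : Fin n → ℕ} (h1 : CompLT a b) (h2 : CompLT b c) : CompLT a c := by
  rcases h1 with h1 | ⟨e1, h1⟩ <;> rcases h2 with h2 | ⟨e2, h2⟩
  · exact Or.inl (h1.trans h2)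
  · exact Or.inl (by rwa [← e2])
  · exact Or.inl (by rwa [e1])
  · exact Or.inr ⟨e1.trans e2, Relation.TransGen.trans h1 h2⟩

theorem DomLT.sum_lt {a b : Fin n → ℕ} (h : DomLT a b) :
    ∑ m, ∑ i ∈ Finset.Iic m, a i < ∑ m, ∑ i ∈ Finset.Iic m, b i := by
  refine lt_of_le_of_ne (Finset.sum_le_sum fun m _ => h.2.2 m) fun e => h.1 ?_
  refine DomLT.trans.eq_of_sum_Iic_eq fun m => ?_
  exact (Finset.sum_eq_sum_iff_of_le fun m _ => h.2.2 m).mp e m (Finset.mem_univ m)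

/-- A strict drop in dominance lowers the total of all partial sums; with equal rearrangements that
total is constant and the length of `w_μ` drops. The lexicographic pair is the rank. -/
theorem compLT_wf : WellFounded (CompLT (n := n)) := by
  refine Subrelation.wf (r := InvImage (Prod.Lex (· < ·) (· < ·)) fun μ : Fin n → ℕ =>
    (∑ m, ∑ i ∈ Finset.Iic m, decr μ i, len (wPerm μ))) ?_
    (InvImage.wf _ (WellFounded.prod_lex wellFounded_lt wellFounded_lt))
  intro a b h
  rcases h with h | ⟨e, h⟩
  · exact Prod.Lex.left _ _ h.sum_lt
  · simp only [InvImage, e]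
    exact Prod.Lex.right _ h.len_lt

theorem CompLT.ne {a b : Fin n → ℕ} (h : CompLT a b) : a ≠ b := fun e => by
  subst e
  exact (compLT_wf.irrefl.irrefl a) h

/-! ### The affine Bruhat order on compositions -/

/-- A single step down in the affine Bruhat order: two entries are moved towards each other, or
exchanged when the first is larger. -/
def Step (ν μ : Fin n → ℕ) : Prop :=
  ∃ i j, i < j ∧ (∀ k, k ≠ i → k ≠ j → ν k = μ k) ∧ ν i + ν j = μ i + μ j ∧
    ((μ i < ν i ∧ ν i < μ j) ∨ (μ j ≤ ν i ∧ ν i < μ i))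

/-- The affine Bruhat order on compositions. -/
def AffLT : (Fin n → ℕ) → (Fin n → ℕ) → Prop := Relation.TransGen Step

/-- Without intermediate ties `w_μ` changes by one transposition that shortens it. If position `k`
in between carries one of the two values, the exchange factors through `k` into two exchanges over
shorter distances; `d` bounds the distance. -/
theorem bruhatLT_of_swap (d : ℕ) {μ : Fin n → ℕ} {i j : Fin n} (hd : j.1 ≤ i.1 + d) (hij : i < j)
    (h : μ j < μ i) : BruhatLT (wPerm (μ ∘ Equiv.swap i j)) (wPerm μ) := by
  induction d generalizing μ i j with
  | zero => rw [Fin.lt_def] at hij; omega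
  | succ d ih =>
    by_cases htie : ∀ k, i < k → k < j → μ k ≠ μ i ∧ μ k ≠ μ j
    · refine Relation.TransGen.single ⟨⟨i, j, ?_⟩, ?_⟩
      · rw [wPerm_comp_swap hij h.ne' htie, mul_assoc, Equiv.swap_mul_self, mul_one]
      · rw [wPerm_comp_swap hij h.ne' htie]
        exact len_mul_swap_lt hij (wPerm_lt μ (Or.inl h))
    · push Not at htie
      obtain ⟨k, hik, hkj, hk⟩ := htie
      have hij' := hij.ne
      by_cases hk1 : μ k = μ i
      · have e : μ ∘ Equiv.swap i j = (μ ∘ Equiv.swap k j) ∘ Equiv.swap i k := by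
          funext a
          simp only [Function.comp_apply, Equiv.swap_apply_def]
          grind
        rw [e]
        refine Relation.TransGen.trans (ih (i := i) (j := k) ?_ hik ?_)
          (ih (i := k) (j := j) ?_ hkj ?_)
        · rw [Fin.lt_def] at hkj; omega
        · simp only [Function.comp_apply, Equiv.swap_apply_def]
          grind
        · rw [Fin.lt_def] at hik; omega
        · omega
      · have hk2 := hk hk1
        have e : μ ∘ Equiv.swap i j = (μ ∘ Equiv.swap i k) ∘ Equiv.swap k j := by
          funext a
          simp only [Function.comp_apply, Equiv.swap_apply_def]
          grind
        rw [e]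
        refine Relation.TransGen.trans (ih (i := k) (j := j) ?_ hkj ?_)
          (ih (i := i) (j := k) ?_ hik ?_)
        · rw [Fin.lt_def] at hik; omega
        · simp only [Function.comp_apply, Equiv.swap_apply_def]
          grind
        · rw [Fin.lt_def] at hkj; omega
        · omega

/-- An exact exchange keeps the rearrangement and lowers `w_μ` in Bruhat order; every other step
moves two entries strictly inside their old range and lowers dominance. -/
theorem Step.compLT {ν μ : Fin n → ℕ} (h : Step ν μ) : CompLT ν μ := by
  obtain ⟨i, j, hij, hoff, hsum, h⟩ := h
  rcases h with ⟨h1, h2⟩ | ⟨h1, h2⟩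
  · exact Or.inl (domLT_of_inner hij.ne hoff hsum h1 h2)
  · rcases h1.lt_or_eq with h1 | h1
    · exact Or.inl (domLT_of_inner hij.ne' (fun k a b => hoff k b a) (by omega) (by omega)
        (by omega))
    · have e : ν = μ ∘ Equiv.swap i j := by
        funext k
        simp only [Function.comp_apply, Equiv.swap_apply_def]
        split_ifs with h3 h4
        · rw [h3, h1]
        · rw [h4]; omega
        · exact hoff k h3 h4
      rw [e]
      exact Or.inr ⟨decr_comp_perm _ _, bruhatLT_of_swap _ (Nat.le_add_left _ _) hij (by omega)⟩

theorem AffLT.compLT {ν μ : Fin n → ℕ} (h : AffLT ν μ) : CompLT ν μ := by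
  induction h with
  | single h => exact h.compLT
  | tail _ h ih => exact ih.trans h.compLT

/-- When the first entry is involved it becomes the last one, increased by 1, and the two
alternatives of a step are interchanged. The increase converts a strict bound into a weak one and
back, which is why the alternatives have different bounds. -/
theorem Step.phi [NeZero n] {ν μ : Fin n → ℕ} (h : Step ν μ) : Step (phiC ν) (phiC μ) := by
  obtain ⟨i, j, hij, hoff, hsum, h⟩ := h
  have hn := NeZero.pos n
  rw [Fin.lt_def] at hij
  have hj : (⟨j.1 - 1, by omega⟩ : Fin n).1 + 1 = j.1 := by simp only; omega
  have hl : (lastIdx n).1 = n - 1 := rfl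
  by_cases hi0 : i = 0
  · subst hi0
    refine ⟨⟨j.1 - 1, by omega⟩, lastIdx n, ?_, ?_, ?_⟩
    · rw [Fin.lt_def]; simp only; omega
    · intro k h1 h2
      rcases rot_zero_or (i := k) with rfl | ⟨k', hk⟩
      · exact absurd rfl h2
      · rw [phiC_of_lt hk, phiC_of_lt hk]
        refine hoff k' (fun e => ?_) (fun e => h1 (Fin.ext ?_))
        · rw [e, Fin.val_zero] at hk; omega
        · subst e; simp only; omega
    · rw [phiC_of_lt hj, phiC_of_lt hj, phiC_last, phiC_last]
      omega
  · have hi0' : i.1 ≠ 0 := fun e => hi0 (Fin.ext (by simpa using e))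
    have hi : (⟨i.1 - 1, by omega⟩ : Fin n).1 + 1 = i.1 := by simp only; omega
    refine ⟨⟨i.1 - 1, by omega⟩, ⟨j.1 - 1, by omega⟩, ?_, ?_, ?_⟩
    · rw [Fin.lt_def]; simp only; omega
    · intro k h1 h2
      rcases rot_zero_or (i := k) with rfl | ⟨k', hk⟩
      · rw [phiC_last, phiC_last, hoff 0 (Ne.symm hi0) (fun e => by
          rw [← e, Fin.val_zero] at hij; omega)]
      · rw [phiC_of_lt hk, phiC_of_lt hk]
        refine hoff k' (fun e => h1 (Fin.ext ?_)) (fun e => h2 (Fin.ext ?_))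
        · subst e; simp only; omega
        · subst e; simp only; omega
    · rw [phiC_of_lt hj, phiC_of_lt hj, phiC_of_lt hi, phiC_of_lt hi]
      exact ⟨hsum, h⟩

theorem AffLT.phi [NeZero n] {ν μ : Fin n → ℕ} (h : AffLT ν μ) : AffLT (phiC ν) (phiC μ) := by
  induction h with
  | single h => exact Relation.TransGen.single h.phi
  | tail _ h ih => exact ih.tail h.phi

theorem step_swap {μ : Fin n → ℕ} {i j : Fin n} (hij : i < j) (h : μ i < μ j) :
    Step μ (μ ∘ Equiv.swap i j) := by
  refine ⟨i, j, hij, fun k h1 h2 => ?_, ?_, ?_⟩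
  · simp [Equiv.swap_apply_of_ne_of_ne h1 h2]
  · simp [add_comm]
  · simp [h]

/-- This is the lifting property for one step. Relabelling by the transposition gives a step again
unless it reverses the two positions, and then the exchanged `ν` lies between the same bounds
relative to `μ` itself. -/
theorem Step.comp_swap {ν μ : Fin n → ℕ} (h : Step ν μ) {i j : Fin n} (hij : i.1 + 1 = j.1) :
    ν ∘ Equiv.swap i j = μ ∨ Step (ν ∘ Equiv.swap i j) μ
      ∨ Step (ν ∘ Equiv.swap i j) (μ ∘ Equiv.swap i j) := by
  obtain ⟨a, b, hab, hoff, hsum, h⟩ := h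
  have hne : i ≠ j := fun e => by subst e; omega
  by_cases hs : Equiv.swap i j a < Equiv.swap i j b
  · refine Or.inr (Or.inr ⟨_, _, hs, fun k h1 h2 => ?_, ?_⟩)
    · refine hoff _ (fun e => h1 ?_) (fun e => h2 ?_)
      · rw [← e, Equiv.swap_apply_self]
      · rw [← e, Equiv.swap_apply_self]
    · simp only [Function.comp_apply, Equiv.swap_apply_self]
      exact ⟨hsum, h⟩
  · have hab' : a = i ∧ b = j := by
      simp only [Equiv.swap_apply_def, Fin.lt_def] at hs hab
      simp only [Fin.ext_iff] at hs ⊢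
      split_ifs at hs <;> omega
    obtain ⟨rfl, rfl⟩ := hab'
    by_cases he : ν b = μ a
    · left
      funext k
      simp only [Function.comp_apply, Equiv.swap_apply_def]
      split_ifs with h1 h2
      · rw [h1, he]
      · rw [h2]; omega
      · exact hoff k h1 h2
    · refine Or.inr (Or.inl ⟨a, b, hab, fun k h1 h2 => ?_, ?_⟩)
      · simp only [Function.comp_apply, Equiv.swap_apply_of_ne_of_ne h1 h2]
        exact hoff k h1 h2
      · simp only [Function.comp_apply, Equiv.swap_apply_left, Equiv.swap_apply_right]
        omega

/-- The larger of `μ` and `s_{ij}.μ` for `i < j`. -/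
def topSwap (i j : Fin n) (μ : Fin n → ℕ) : Fin n → ℕ :=
  if μ i < μ j then μ ∘ Equiv.swap i j else μ

theorem le_topSwap {i j : Fin n} (hij : i < j) (μ : Fin n → ℕ) :
    Relation.ReflTransGen Step μ (topSwap i j μ) := by
  rw [topSwap]
  split_ifs with h
  · exact Relation.ReflTransGen.single (step_swap hij h)
  · exact Relation.ReflTransGen.refl

theorem comp_swap_le_topSwap {i j : Fin n} (hij : i < j) (μ : Fin n → ℕ) :
    Relation.ReflTransGen Step (μ ∘ Equiv.swap i j) (topSwap i j μ) := by
  rw [topSwap]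
  split_ifs with h
  · exact Relation.ReflTransGen.refl
  · rcases (not_lt.mp h).lt_or_eq with h | h
    · have := step_swap (μ := μ ∘ Equiv.swap i j) hij (by simpa using h)
      rw [Function.comp_assoc, ← Equiv.coe_trans] at this
      simp only [Equiv.swap_swap, Equiv.coe_refl, Function.comp_id] at this
      exact Relation.ReflTransGen.single this
    · have : μ ∘ Equiv.swap i j = μ := by
        funext k
        simp only [Function.comp_apply, Equiv.swap_apply_def]
        split_ifs with h1 h2
        · rw [h1, h]
        · rw [h2, h]
        · rfl
      rw [this]

/-- Both `b` and its exchange lie weakly below the top of the pair of `c`, by the three cases of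
`Step.comp_swap`; hence so does the top of the pair of `b`. -/
theorem topSwap_mono {i j : Fin n} (hij : i.1 + 1 = j.1) {ν μ : Fin n → ℕ}
    (h : Relation.ReflTransGen Step ν μ) :
    Relation.ReflTransGen Step (topSwap i j ν) (topSwap i j μ) := by
  have hlt : i < j := by rw [Fin.lt_def]; omega
  induction h with
  | refl => exact Relation.ReflTransGen.refl
  | @tail b c _ hs ih =>
    refine ih.trans ?_
    have h1 : Relation.ReflTransGen Step b (topSwap i j c) :=
      Relation.ReflTransGen.head hs (le_topSwap hlt c)
    have h2 : Relation.ReflTransGen Step (b ∘ Equiv.swap i j) (topSwap i j c) := by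
      rcases hs.comp_swap hij with e | e | e
      · rw [e]; exact le_topSwap hlt c
      · exact Relation.ReflTransGen.head e (le_topSwap hlt c)
      · exact Relation.ReflTransGen.head e (comp_swap_le_topSwap hlt c)
    conv_lhs => rw [topSwap]
    split_ifs
    · exact h2
    · exact h1

/-- The exchange of `ν` lies weakly below the top of its pair, hence below the top of the pair of
`μ`, which is the exchange of `μ`. Equality would give `ν = μ`. -/
theorem AffLT.comp_swap {ν μ : Fin n → ℕ} (h : AffLT ν μ) {i j : Fin n} (hij : i.1 + 1 = j.1)
    (hμ : μ i < μ j) :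
    AffLT (ν ∘ Equiv.swap i j) (μ ∘ Equiv.swap i j) := by
  have hlt : i < j := by rw [Fin.lt_def]; omega
  have h1 := (comp_swap_le_topSwap hlt ν).trans (topSwap_mono hij h.to_reflTransGen)
  rw [topSwap, if_pos hμ] at h1
  rcases Relation.reflTransGen_iff_eq_or_transGen.mp h1 with e | e
  · refine absurd ?_ h.compLT.ne
    funext k
    have := congrFun e (Equiv.swap i j k)
    simpa using this.symm
  · exact e

theorem AffLT.comp_swap_of_eq {ν μ : Fin n → ℕ} (h : AffLT ν μ) {i j : Fin n}
    (hij : i.1 + 1 = j.1) (hμ : μ i = μ j) : AffLT (ν ∘ Equiv.swap i j) μ := by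
  have hlt : i < j := by rw [Fin.lt_def]; omega
  have h1 := (comp_swap_le_topSwap hlt ν).trans (topSwap_mono hij h.to_reflTransGen)
  rw [topSwap, if_neg (by omega)] at h1
  rcases Relation.reflTransGen_iff_eq_or_transGen.mp h1 with e | e
  · refine absurd ?_ h.compLT.ne
    funext k
    have := congrFun e (Equiv.swap i j k)
    simp only [Function.comp_apply, Equiv.swap_apply_self] at this
    rw [← this, Equiv.swap_apply_def]
    split_ifs with h1 h2
    · rw [h1, hμ]
    · rw [h2, hμ]
    · rfl
  · exact e

theorem AffLT.lt_swap {ν μ : Fin n → ℕ} (h : AffLT ν μ) {i j : Fin n} (hij : i.1 + 1 = j.1)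
    (hμ : μ i < μ j) : AffLT ν (μ ∘ Equiv.swap i j) :=
  Relation.TransGen.tail h (step_swap (by rw [Fin.lt_def]; omega) hμ)

end CompositionOrder

end

end Cherednik

namespace Cherednik

noncomputable section

/-! ### Combinatorics of standard tableaux -/

section TableauLemmas

variable {r n : ℕ} {lam : RPartition r n}

theorem box_ext {b c : Box lam} (h : beta b = beta c) (h1 : b.2.1.1 = c.2.1.1)
    (h2 : b.2.1.2 = c.2.1.2) : b = c := by
  obtain ⟨p, ⟨⟨a, a'⟩, ha⟩⟩ := b
  obtain ⟨q, ⟨⟨c, c'⟩, hc⟩⟩ := c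
  simp only [beta] at h
  subst h
  simp only at h1 h2
  subst h1 h2
  rfl

/-- The box north-west of `b` in row `p` and column `q`. -/
def subBox (b : Box lam) (p q : ℕ) (hp : p ≤ b.2.1.1) (hq : q ≤ b.2.1.2) : Box lam :=
  ⟨b.1, ⟨(p, q), (lam.shape b.1).isLowerSet (a := b.2.1) (b := (p, q)) ⟨hp, hq⟩ b.2.2⟩⟩

/-- Go from `T(i)` along its row to the column of `T(j)`, then down; the corner box belongs to the
diagram because it lies north-west of `T(j)`. -/
theorem box_lt_of_le {T : Fin n ≃ Box lam} (hT : IsStandard T) {i j : Fin n}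
    (h : beta (T i) = beta (T j)) (h1 : (T i).2.1.1 ≤ (T j).2.1.1)
    (h2 : (T i).2.1.2 ≤ (T j).2.1.2) (hne : i ≠ j) : i < j := by
  obtain ⟨k, hk⟩ := T.surjective (subBox (T j) (T i).2.1.1 (T j).2.1.2 h1 le_rfl)
  have hk0 : beta (T k) = beta (T j) := by rw [hk]; rfl
  have hk1 : (T k).2.1.1 = (T i).2.1.1 := by rw [hk]; rfl
  have hk2 : (T k).2.1.2 = (T j).2.1.2 := by rw [hk]; rfl
  have hik : i = k ∨ i < k := by
    rcases h2.lt_or_eq with h2 | h2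
    · exact Or.inr (hT i k (h.trans hk0.symm) (Or.inl ⟨hk1.symm, by rw [hk2]; exact h2⟩))
    · exact Or.inl (T.injective (box_ext (h.trans hk0.symm) hk1.symm (h2.trans hk2.symm)))
  have hkj : k = j ∨ k < j := by
    rcases h1.lt_or_eq with h1 | h1
    · exact Or.inr (hT k j hk0 (Or.inr ⟨hk2, by rw [hk1]; exact h1⟩))
    · exact Or.inl (T.injective (box_ext hk0 (hk1.trans h1) hk2))
  rcases hik with rfl | hik
  · rcases hkj with rfl | hkj
    · exact absurd rfl hne
    · exact hkj
  · rcases hkj with rfl | hkj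
    · exact hik
    · exact hik.trans hkj

theorem exists_subBox {T : Fin n ≃ Box lam} (hT : IsStandard T) (j : Fin n) {p q : ℕ}
    (hp : p ≤ (T j).2.1.1) (hq : q ≤ (T j).2.1.2) (hne : p ≠ (T j).2.1.1 ∨ q ≠ (T j).2.1.2) :
    ∃ k, k < j ∧ beta (T k) = beta (T j) ∧ (T k).2.1.1 = p ∧ (T k).2.1.2 = q := by
  obtain ⟨k, hk⟩ := T.surjective (subBox (T j) p q hp hq)
  have hk0 : beta (T k) = beta (T j) := by rw [hk]; rfl
  have hk1 : (T k).2.1.1 = p := by rw [hk]; rfl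
  have hk2 : (T k).2.1.2 = q := by rw [hk]; rfl
  refine ⟨k, box_lt_of_le hT hk0 (by rw [hk1]; exact hp) (by rw [hk2]; exact hq) ?_, hk0, hk1, hk2⟩
  rintro rfl
  rcases hne with h | h
  · exact h hk1.symm
  · exact h hk2.symm

theorem ct_first {T : Fin n ≃ Box lam} (hT : IsStandard T) {i : Fin n} (hi : i.1 = 0) :
    ct (T i) = 0 := by
  by_contra hne
  have hne' : 0 ≠ (T i).2.1.1 ∨ 0 ≠ (T i).2.1.2 := by
    rw [ct] at hne
    omega
  obtain ⟨k, hk, -⟩ := exists_subBox hT i (Nat.zero_le _) (Nat.zero_le _) hne'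
  rw [Fin.lt_def] at hk
  omega

/-- The exchange of consecutive entries can only violate standardness if the two boxes share a row
or a column. They are then neighbours, since a box in between would hold an entry strictly between
`i` and `i + 1`. -/
theorem isStandard_swapT_or (T : SYT lam) {i j : Fin n} (hij : i.1 + 1 = j.1) :
    IsStandard (swapT i j T) ∨ (beta (T.1 i) = beta (T.1 j) ∧
      (ct (T.1 i) - ct (T.1 j) = 1 ∨ ct (T.1 i) - ct (T.1 j) = -1)) := by
  by_contra! hcon
  obtain ⟨hns, hcon⟩ := hcon
  apply hns
  intro a b hab hpos
  simp only [swapT, Equiv.trans_apply] at hab hpos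
  have hlt := T.2 _ _ hab hpos
  by_contra hba
  have key : Equiv.swap i j a = i ∧ Equiv.swap i j b = j := by
    simp only [Equiv.swap_apply_def, Fin.lt_def] at hlt hba ⊢
    simp only [Fin.ext_iff] at hlt ⊢
    split_ifs at hlt ⊢ <;> simp_all <;> omega
  rw [key.1, key.2] at hab hpos
  obtain ⟨h1, h2⟩ := hcon hab
  simp only [ct] at h1 h2
  rcases hpos with ⟨hr, hc⟩ | ⟨hc, hr⟩
  · obtain ⟨k, hk, hk0, hk1, hk2⟩ := exists_subBox T.2 j (p := (T.1 j).2.1.1)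
      (q := (T.1 j).2.1.2 - 1) le_rfl (Nat.sub_le _ _) (Or.inr (by omega))
    have : i < k := T.2 i k (hab.trans hk0.symm) (Or.inl ⟨by rw [hk1, hr], by rw [hk2]; omega⟩)
    rw [Fin.lt_def] at this hk
    omega
  · obtain ⟨k, hk, hk0, hk1, hk2⟩ := exists_subBox T.2 j (p := (T.1 j).2.1.1 - 1)
      (q := (T.1 j).2.1.2) (Nat.sub_le _ _) le_rfl (Or.inl (by omega))
    have : i < k := T.2 i k (hab.trans hk0.symm) (Or.inr ⟨by rw [hk2, hc], by rw [hk1]; omega⟩)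
    rw [Fin.lt_def] at this hk
    omega

/-- Between two boxes of one diagonal lie the boxes just right of and just below the first. They
hold two distinct entries strictly between `i` and `j`, so `j ≥ i + 3`. The case of distance 2 is
needed for the braid relation. -/
theorem ct_ne {T : Fin n ≃ Box lam} (hT : IsStandard T) {i j : Fin n} (hij : i < j)
    (hj : j.1 ≤ i.1 + 2) (h : beta (T i) = beta (T j)) : ct (T i) ≠ ct (T j) := by
  intro hc
  simp only [ct] at hc
  have hlt : (T i).2.1.1 < (T j).2.1.1 := by
    by_contra hle
    exact absurd (box_lt_of_le hT h.symm (not_lt.mp hle) (by omega) hij.ne') hij.not_gt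
  obtain ⟨k, hk, hk0, hk1, hk2⟩ := exists_subBox hT j (p := (T i).2.1.1)
    (q := (T i).2.1.2 + 1) hlt.le (by omega) (Or.inl (by omega))
  obtain ⟨l, hl, hl0, hl1, hl2⟩ := exists_subBox hT j (p := (T i).2.1.1 + 1)
    (q := (T i).2.1.2) (by omega) (by omega) (Or.inr (by omega))
  have hik : i < k := box_lt_of_le hT (h.trans hk0.symm) (by omega) (by omega)
    (fun e => by subst e; omega)
  have hil : i < l := box_lt_of_le hT (h.trans hl0.symm) (by omega) (by omega)
    (fun e => by subst e; omega)
  have hkl : k ≠ l := fun e => by subst e; omega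
  rw [Fin.lt_def] at *
  exact hkl (Fin.ext (by omega))

/-- Build both tableaux entry by entry. Two candidate boxes for `i` lie on one diagonal of one
component; if they differed, the north-western one would already have been filled in the other
tableau by a smaller entry, at which both agree. -/
theorem eq_of_ct_eq {T S : SYT lam} (hb : ∀ i, beta (T.1 i) = beta (S.1 i))
    (hc : ∀ i, ct (T.1 i) = ct (S.1 i)) : T = S := by
  have aux : ∀ {T S : SYT lam} (i : Fin n), (∀ k, k < i → T.1 k = S.1 k) →
      beta (T.1 i) = beta (S.1 i) → ct (T.1 i) = ct (S.1 i) →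
      ¬ (T.1 i).2.1.1 < (S.1 i).2.1.1 := by
    intro T S i ih hb hc hlt
    simp only [ct] at hc
    obtain ⟨k, hk, hk0, hk1, hk2⟩ := exists_subBox S.2 i (p := (T.1 i).2.1.1)
      (q := (T.1 i).2.1.2) hlt.le (by omega) (Or.inl hlt.ne)
    have : T.1 k = T.1 i := by
      rw [ih k hk]
      exact box_ext (hk0.trans hb.symm) hk1 hk2
    exact hk.ne (T.1.injective this)
  have key : ∀ i, T.1 i = S.1 i := fun i => by
    induction i using WellFoundedLT.induction with
    | ind i ih =>
      have h1 := aux i ih (hb i) (hc i)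
      have h2 := aux i (fun k hk => (ih k hk).symm) (hb i).symm (hc i).symm
      have h3 := hc i
      simp only [ct] at h3
      exact box_ext (hb i) (by omega) (by omega)
  exact Subtype.ext (Equiv.ext key)

end TableauLemmas

end

end Cherednik

namespace Cherednik

noncomputable section

/-! ### The standard module -/

section StandardModuleLemmas

set_option linter.unusedSectionVars false

variable {F : Type} [Field F] [Algebra ℂ F] {r n : ℕ} [NeZero r] (P : Params F r)
  {lam : RPartition r n}

theorem algebraMap_smul_M (c : F) (m : M P lam) : algebraMap F (H P n) c • m = c • m := rfl

instance : IsScalarTower F (H P n) (M P lam) where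
  smul_assoc c h m := by
    rw [Algebra.smul_def, mul_smul, algebraMap_smul_M]

instance : SMulCommClass F (H P n) (M P lam) := IsScalarTower.to_smulCommClass

instance : SMulCommClass (H P n) F (M P lam) := SMulCommClass.symm _ _ _

variable (lam) in
/-- The projection from the free module on the `v_T`. -/
def mkM : (SYT lam →₀ H P n) →ₗ[H P n] M P lam :=
  Submodule.mkQ (Submodule.span (H P n) {m | StdRel P lam m})

theorem mk_single (T : SYT lam) (h : H P n) : mkM P lam (Finsupp.single T h) = h • v P T := by
  have : Finsupp.single T h = h • Finsupp.single T (1 : H P n) := by simp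
  rw [this, map_smul]
  rfl

theorem stdRel_eq_zero {m : SYT lam →₀ H P n} (h : StdRel P lam m) : mkM P lam m = 0 :=
  (Submodule.Quotient.mk_eq_zero _).mpr (Submodule.subset_span h)

theorem y_smul_v (i : Fin n) (T : SYT lam) : y P i • v P T = 0 := by
  rw [← mk_single]
  exact stdRel_eq_zero P (StdRel.y i T)

theorem jm_smul_v (i : Fin n) (T : SYT lam) :
    jm P i • v P T = ((r : F) * ((ct (T.1 i) : ℤ) : F)) • v P T := by
  have := stdRel_eq_zero P (StdRel.jm i T)
  rwa [mk_single, sub_smul, sub_eq_zero] at this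

/-- The root of unity by which `ζ_i` acts on `v_T`, shifted by `-a`. -/
def rootWt (T : SYT lam) (i : Fin n) (a : ℕ) : rootsOfUnity r ℂ :=
  zetaRoot r ^ (((beta (T.1 i) : ℕ) : ℤ) - (a : ℤ))

theorem diag_smul_v (i : Fin n) (T : SYT lam) :
    t P (diagG r i) • v P T = rootF F (rootWt T i 0) • v P T := by
  have := stdRel_eq_zero P (StdRel.diag i T)
  rw [mk_single, sub_smul, sub_eq_zero] at this
  rw [this, algebraMap_smul_M, rootWt, rootF]
  simp

/-- A geometric sum over the powers of `η θ⁻¹`, equal to `r` or 0. The module is arbitrary because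
the same computation serves `M(λ)` and the model module that shows `v_T ≠ 0`. -/
theorem piH_smul {N : Type*} [AddCommGroup N] [Module F N] [Module (H P n) N]
    [IsScalarTower F (H P n) N] [SMulCommClass (H P n) F N] {i j : Fin n}
    {η θ : rootsOfUnity r ℂ} {m : N}
    (hi : t P (diagG r i) • m = rootF F η • m) (hj : t P (diagG r j) • m = rootF F θ • m) :
    piH P i j • m = (if η = θ then (r : F) else 0) • m := by
  have hj' : t P (diagG r j)⁻¹ • m = rootF F θ⁻¹ • m := by
    have h1 : t P (diagG r j)⁻¹ • t P (diagG r j) • m = m := by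
      rw [← mul_smul, t_inv_mul, one_smul]
    rw [hj, smul_comm] at h1
    rw [← one_smul F (t P (diagG r j)⁻¹ • m), ← rootF_inv_mul θ, mul_smul, h1]
  have h1 : t P (diagG r i * (diagG r j)⁻¹) • m = rootF F (η * θ⁻¹) • m := by
    rw [t_mul, mul_smul, hj', smul_comm, hi, smul_smul, rootF_mul, mul_comm]
  have h2 : ∀ l : ℕ, t P (diagG r i * (diagG r j)⁻¹) ^ l • m = rootF F (η * θ⁻¹) ^ l • m := by
    intro l
    induction l with
    | zero => simp
    | succ l ih => rw [pow_succ, mul_smul, h1, smul_comm, ih, smul_smul, pow_succ, mul_comm]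
  rw [piH, Finset.sum_smul, Finset.sum_congr rfl fun l _ => h2 l, ← Finset.sum_smul]
  congr 1
  split_ifs with h
  · rw [h, mul_inv_cancel, rootF_one]
    simp
  · have hne : rootF F (η * θ⁻¹) - 1 ≠ 0 := fun e => h ?_
    · have hp : rootF F (η * θ⁻¹) ^ r = 1 := by
        rw [rootF, ← map_pow, coe_root_pow, map_one]
      have := mul_geom_sum (rootF F (η * θ⁻¹)) r
      rw [hp, sub_self] at this
      exact (mul_eq_zero.mp this).resolve_left hne
    · rw [sub_eq_zero, rootF, map_eq_one_iff _ (algebraMap ℂ F).injective] at e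
      exact mul_inv_eq_one.mp (rootsOfUnity_ext (by simpa using e))

theorem zetaRoot_zpow_eq_iff {a b : ℤ} :
    zetaRoot r ^ a = zetaRoot r ^ b ↔ (a : ZMod r) = (b : ZMod r) := by
  have h : IsPrimitiveRoot (zetaRoot r) r :=
    IsPrimitiveRoot.of_map_of_injective (f := (Units.coeHom ℂ).comp (rootsOfUnity r ℂ).subtype)
      (zeta_isPrimitiveRoot r) (fun a b h => rootsOfUnity_ext h)
  rw [← sub_eq_zero (b := (b : ZMod r)), ← Int.cast_sub, ZMod.intCast_zmod_eq_zero_iff_dvd,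
    ← h.zpow_eq_one_iff_dvd, zpow_sub, mul_inv_eq_one]

/-- `e_{ij}` projects onto the `ζ^j`-eigenspace of `t_{ζ_i}`, so on a `ζ^b`-eigenvector only the
term with `j` congruent to `b` survives. -/
theorem dSum_smul {i : Fin n} {b : ℤ} {m : M P lam}
    (hi : t P (diagG r i) • m = rootF F (zetaRoot r ^ b) • m) :
    dSum P i • m = (P.d b - P.d ((b : ZMod r) - 1)) • m := by
  have hr : (r : F) ≠ 0 := by
    have := (algebraMap ℂ F).injective.ne (Nat.cast_ne_zero.mpr (NeZero.ne r) : (r : ℂ) ≠ 0)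
    simpa using this
  have hl : ∀ l : ℕ, t P (diagG r i ^ l) • m = rootF F (zetaRoot r ^ b) ^ l • m := by
    intro l
    induction l with
    | zero => simp [t_one]
    | succ l ih =>
      rw [pow_succ, t_mul, mul_smul, hi, smul_comm, ih, smul_smul, pow_succ, mul_comm]
  have he : ∀ j : ℕ, toH P n (fe F i j) • m = (if (b : ZMod r) = (j : ZMod r) then (1 : F) else 0) • m := by
    intro j
    have h1 : ∀ l ∈ Finset.range r, toH P n (algebraMap ℂ F ((zeta r ^ (l * j))⁻¹) •
        ft F (diagG r i ^ l)) • m = rootF F (zetaRoot r ^ (b - j)) ^ l • m := fun l _ => by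
      rw [map_smul, smul_assoc]
      change _ • t P (diagG r i ^ l) • m = _
      rw [hl, smul_smul, zpow_sub, rootF_mul, mul_pow, mul_comm, rootF_inv, rootF, rootF]
      congr 2
      simp [pow_mul, mul_comm]
    rw [fe, map_smul, smul_assoc, map_sum, Finset.sum_smul, Finset.sum_congr rfl h1,
      ← Finset.sum_smul, smul_smul]
    congr 1
    split_ifs with h
    · have : zetaRoot r ^ (b - j) = 1 := by
        rw [zpow_sub, mul_inv_eq_one, zetaRoot_zpow_eq_iff, h, Int.cast_natCast]
      rw [this, rootF_one]
      simp [hr]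
    · have hne : rootF F (zetaRoot r ^ (b - j)) - 1 ≠ 0 := fun e => h ?_
      · have hp : rootF F (zetaRoot r ^ (b - j)) ^ r = 1 := by
          rw [rootF, ← map_pow, coe_root_pow, map_one]
        have := mul_geom_sum (rootF F (zetaRoot r ^ (b - j))) r
        rw [hp, sub_self] at this
        rw [(mul_eq_zero.mp this).resolve_left hne, mul_zero]
      · rw [sub_eq_zero, rootF, map_eq_one_iff _ (algebraMap ℂ F).injective] at e
        have h3 : zetaRoot r ^ (b - j) = 1 := rootsOfUnity_ext (by simpa using e)
        rw [zpow_sub, mul_inv_eq_one, zetaRoot_zpow_eq_iff, Int.cast_natCast] at h3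
        exact h3
  rw [dSum, Finset.sum_smul]
  have h2 : ∀ j ∈ Finset.range r, ((P.d (j : ZMod r) - P.d ((j : ZMod r) - 1)) •
      toH P n (fe F i j)) • m
      = (if (b : ZMod r) = (j : ZMod r) then (P.d b - P.d ((b : ZMod r) - 1)) else 0) • m := by
    intro j _
    rw [smul_assoc, he, smul_smul]
    split_ifs with h
    · rw [h, mul_one]
    · rw [mul_zero]
  rw [Finset.sum_congr rfl h2, ← Finset.sum_smul]
  congr 1
  rw [Finset.sum_eq_single_of_mem (ZMod.val (b : ZMod r))
    (Finset.mem_range.mpr (ZMod.val_lt _))]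
  · rw [ZMod.natCast_zmod_val, if_pos rfl]
  · intro j hj hne
    rw [if_neg]
    intro e
    apply hne
    rw [e, ZMod.val_natCast_of_lt (Finset.mem_range.mp hj)]

/-! ### Monomials -/

theorem prod_ofFn_mul {A : Type*} [Monoid A] {k : ℕ} (g : Fin k → A)
    (hg : ∀ i j, Commute (g i) (g j)) (μ : Fin k → ℕ) (i : Fin k) :
    (List.ofFn fun j => g j ^ (μ + Pi.single i 1 : Fin k → ℕ) j).prod
      = g i * (List.ofFn fun j => g j ^ μ j).prod := by
  induction k with
  | zero => exact i.elim0
  | succ k ih =>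
    rw [List.ofFn_succ, List.ofFn_succ, List.prod_cons, List.prod_cons]
    refine Fin.cases ?_ (fun i => ?_) i
    · simp [pow_succ', mul_assoc]
    · have := ih (fun j => g j.succ) (fun a b => hg _ _) (fun j => μ j.succ) i
      have h2 : (fun j : Fin k => g j.succ ^ (μ + Pi.single i.succ 1 : Fin (k + 1) → ℕ) j.succ)
          = fun j : Fin k => g j.succ ^ ((fun j : Fin k => μ j.succ) + Pi.single i 1 : Fin k → ℕ) j := by
        funext j
        simp [Pi.single_apply]
      rw [h2, this]
      simp only [Pi.add_apply, Pi.single_apply, (Fin.succ_ne_zero i).symm, if_false, add_zero]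
      rw [← mul_assoc, ← mul_assoc, ((hg 0 i.succ).pow_left (μ 0)).eq]

theorem xpow_add_single (μ : Fin n → ℕ) (i : Fin n) :
    xpow P (μ + Pi.single i 1) = x P i * xpow P μ :=
  prod_ofFn_mul (x P) (x_comm P) μ i

theorem xpow_zero : xpow P (0 : Fin n → ℕ) = 1 := by
  simp [xpow]

theorem comp_induction {p : (Fin n → ℕ) → Prop} (h0 : p 0)
    (hs : ∀ μ i, p μ → p (μ + Pi.single i 1)) (μ : Fin n → ℕ) : p μ := by
  induction h : ∑ i, μ i generalizing μ with
  | zero =>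
    have : μ = 0 := funext fun i => (Finset.sum_eq_zero_iff.mp h) i (Finset.mem_univ i)
    rwa [this]
  | succ N ih =>
    obtain ⟨i, hi⟩ : ∃ i, μ i ≠ 0 := by
      by_contra hcon
      push Not at hcon
      simp [hcon] at h
    have e : μ = (μ - Pi.single i 1) + Pi.single i 1 := by
      funext k
      by_cases hk : k = i
      · subst hk; simp; omega
      · simp [hk]
    rw [e]
    apply hs
    apply ih
    have h2 : ∑ k, μ k = ∑ k, ((μ - Pi.single i 1) + Pi.single i 1 : Fin n → ℕ) k := by rw [← e]
    simp only [Pi.add_apply, Finset.sum_add_distrib, Finset.sum_pi_single', Finset.mem_univ,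
      if_true] at h2
    omega

theorem t_perm_mul_xpow (σ : Equiv.Perm (Fin n)) (μ : Fin n → ℕ) :
    t P (permG r σ) * xpow P μ = xpow P (μ ∘ σ.symm) * t P (permG r σ) := by
  induction μ using comp_induction with
  | h0 => rw [show (0 : Fin n → ℕ) ∘ σ.symm = 0 from rfl, xpow_zero, mul_one, one_mul]
  | hs μ i ih =>
    have : (μ + Pi.single i 1) ∘ σ.symm = μ ∘ σ.symm + Pi.single (σ i) 1 := by
      funext k
      simp [Pi.single_apply, Equiv.symm_apply_eq]
    rw [this, xpow_add_single, xpow_add_single, ← mul_assoc, t_perm_x, mul_assoc, ih, mul_assoc]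

/-! ### Spanning of the standard module by the vectors `x^μ v_T^μ` -/

variable (lam) in
/-- The span of the generators `v_T`. -/
def vSpan : Submodule F (M P lam) := Submodule.span F (Set.range (v P))

/-- `t_{s_i} v_T + (φ_i - φ_{i+1})⁻¹ π_i v_T` for a non-standard `s_i.T`. -/
theorem tau_smul_v_of_not {i j : Fin n} (hij : i.1 + 1 = j.1) (T : SYT lam)
    (h : ¬ IsStandard (swapT i j T)) :
    (t P (permG r (Equiv.swap i j)) + ((r : F) * ((ct (T.1 i) : ℤ) : F)
      - (r : F) * ((ct (T.1 j) : ℤ) : F))⁻¹ • piH P i j) • v P T = 0 := by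
  have := stdRel_eq_zero P (StdRel.tau i j hij T)
  rwa [tauValue, dif_neg h, sub_zero, mk_single] at this

/-- The coefficient in Young's orthonormal form. -/
def youngCoef (i j : Fin n) (T : SYT lam) : ℂ :=
  if beta (T.1 i) = beta (T.1 j) then seminormal j i T else 1

theorem tau_smul_v {i j : Fin n} (hij : i.1 + 1 = j.1) (T : SYT lam)
    (h : IsStandard (swapT i j T)) :
    (t P (permG r (Equiv.swap i j)) + ((r : F) * ((ct (T.1 i) : ℤ) : F)
      - (r : F) * ((ct (T.1 j) : ℤ) : F))⁻¹ • piH P i j) • v P T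
      = algebraMap ℂ F (youngCoef i j T) • v P ⟨swapT i j T, h⟩ := by
  have h0 := stdRel_eq_zero P (StdRel.tau i j hij T)
  rw [map_sub, mk_single, sub_eq_zero] at h0
  rw [h0, youngCoef, tauValue, dif_pos h]
  by_cases h1 : beta (T.1 i) = beta (T.1 j)
  · rw [if_neg (not_not.mpr h1), if_pos h1]
    exact mk_single P (⟨swapT i j T, h⟩ : SYT lam) _
  · rw [if_pos h1, if_neg h1, map_one, one_smul]
    exact (mk_single P (⟨swapT i j T, h⟩ : SYT lam) 1).trans (one_smul _ _)

theorem piH_smul_v (i j : Fin n) (T : SYT lam) :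
    piH P i j • v P T = (if rootWt T i 0 = rootWt T j 0 then (r : F) else 0) • v P T :=
  piH_smul P (diag_smul_v P i T) (diag_smul_v P j T)

theorem t_smul_mem_vSpan (g : G r n) {u : M P lam} (hu : u ∈ vSpan P lam) :
    t P g • u ∈ vSpan P lam := by
  have hv : ∀ T, v P T ∈ vSpan P lam := fun T => Submodule.subset_span ⟨T, rfl⟩
  have key : ∀ g : G r n, (∀ T, t P g • v P T ∈ vSpan P lam) →
      ∀ u ∈ vSpan P lam, t P g • u ∈ vSpan P lam := by
    intro g hg u hu
    induction hu using Submodule.span_induction with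
    | mem u h => obtain ⟨T, rfl⟩ := h; exact hg T
    | zero => rw [smul_zero]; exact zero_mem _
    | add a b _ _ ha hb => rw [smul_add]; exact add_mem ha hb
    | smul c a _ ha => rw [smul_comm]; exact Submodule.smul_mem _ _ ha
  refine key g ?_ u hu
  clear hu u
  induction g using G_induction with
  | hd i => intro T; rw [diag_smul_v]; exact Submodule.smul_mem _ _ (hv T)
  | hs i j hij =>
    intro T
    by_cases h : IsStandard (swapT i j T)
    · have := tau_smul_v P hij T h
      rw [add_smul, smul_assoc, piH_smul_v, ← eq_sub_iff_add_eq] at this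
      rw [this]
      exact sub_mem (Submodule.smul_mem _ _ (hv _))
        (Submodule.smul_mem _ _ (Submodule.smul_mem _ _ (hv T)))
    · have := tau_smul_v_of_not P hij T h
      rw [add_smul, smul_assoc, piH_smul_v, ← eq_sub_iff_add_eq] at this
      rw [this]
      exact sub_mem (zero_mem _)
        (Submodule.smul_mem _ _ (Submodule.smul_mem _ _ (hv T)))
  | h1 => intro T; rw [t_one, one_smul]; exact hv T
  | hm a b ha hb => intro T; rw [t_mul, mul_smul]; exact key a ha _ (hb T)

/-- The span of the `v_T` is stable under the group, so twisting it by `w_μ⁻¹` does not change it.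
-/
theorem xpow_smul_mem {u : M P lam} (hu : u ∈ vSpan P lam) (μ : Fin n → ℕ) :
    xpow P μ • u ∈ Submodule.span F (Set.range fun S => xv P (lam := lam) μ S) := by
  have h1 : u = t P (permG r (wPerm μ)⁻¹) • t P (permG r (wPerm μ)) • u := by
    rw [← mul_smul, permG_inv, t_inv_mul, one_smul]
  rw [h1]
  have h2 := t_smul_mem_vSpan P (permG r (wPerm μ)) hu
  generalize t P (permG r (wPerm μ)) • u = w at h2
  induction h2 using Submodule.span_induction with
  | mem u h => obtain ⟨T, rfl⟩ := h; exact Submodule.subset_span ⟨T, rfl⟩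
  | zero => rw [smul_zero, smul_zero]; exact zero_mem _
  | add a b _ _ ha hb => rw [smul_add, smul_add]; exact add_mem ha hb
  | smul c a _ ha => rw [smul_comm (t P _) c, smul_comm (xpow P μ) c]; exact Submodule.smul_mem _ _ ha

theorem twist_mem_vSpan (σ : Equiv.Perm (Fin n)) (T : SYT lam) :
    t P (permG r σ) • v P T ∈ vSpan P lam :=
  t_smul_mem_vSpan P _ (Submodule.subset_span ⟨T, rfl⟩)

variable (lam) in
/-- The span of all vectors `x^μ v_T`. -/
def xSpan : Submodule F (M P lam) :=
  Submodule.span F {m | ∃ μ : Fin n → ℕ, ∃ u ∈ vSpan P lam, m = xpow P μ • u}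

theorem xpow_smul_mem_xSpan (μ : Fin n → ℕ) {u : M P lam} (hu : u ∈ vSpan P lam) :
    xpow P μ • u ∈ xSpan P lam := Submodule.subset_span ⟨μ, u, hu, rfl⟩

theorem smul_mem_of_span {N : Set (M P lam)} {K : Submodule F (M P lam)} (h : H P n) {m : M P lam}
    (hm : m ∈ Submodule.span F N) (hK : ∀ m ∈ N, h • m ∈ K) : h • m ∈ K := by
  induction hm using Submodule.span_induction with
  | mem u hu => exact hK u hu
  | zero => rw [smul_zero]; exact zero_mem _
  | add a b _ _ ha hb => rw [smul_add]; exact add_mem ha hb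
  | smul c a _ ha => rw [smul_comm]; exact Submodule.smul_mem _ _ ha

theorem x_smul_mem_xSpan (i : Fin n) {m : M P lam} (hm : m ∈ xSpan P lam) :
    x P i • m ∈ xSpan P lam := by
  refine smul_mem_of_span P (x P i) hm ?_
  rintro _ ⟨μ, u, hu, rfl⟩
  rw [← mul_smul, ← xpow_add_single]
  exact xpow_smul_mem_xSpan P _ hu

theorem t_smul_mem_xSpan (g : G r n) {m : M P lam} (hm : m ∈ xSpan P lam) :
    t P g • m ∈ xSpan P lam := by
  refine smul_mem_of_span P (t P g) hm ?_
  rintro _ ⟨μ, u, hu, rfl⟩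
  induction μ using comp_induction with
  | h0 =>
    have := xpow_smul_mem_xSpan P 0 (t_smul_mem_vSpan P g hu)
    rwa [xpow_zero, one_smul] at this ⊢
  | hs μ i ih =>
    obtain ⟨w, e, rfl⟩ := exists_monG g
    rw [xpow_add_single, ← mul_smul, ← mul_assoc, t_x, smul_mul_assoc, smul_assoc, mul_assoc,
      mul_smul, mul_smul]
    exact Submodule.smul_mem _ _ (x_smul_mem_xSpan P _ ih)

/-- Induction on the degree: moving `y_i` past a variable costs only group-algebra elements and the
scalar `κ`, and `y_i` kills degree zero. -/
theorem y_smul_mem_xSpan (i : Fin n) {m : M P lam} (hm : m ∈ xSpan P lam) :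
    y P i • m ∈ xSpan P lam := by
  refine smul_mem_of_span P (y P i) hm ?_
  rintro _ ⟨μ, u, hu, rfl⟩
  have hmem : ∀ μ, xpow P μ • u ∈ xSpan P lam := fun μ => xpow_smul_mem_xSpan P μ hu
  have hrefl : ∀ (μ : Fin n → ℕ) (j : Fin n), reflSum P i j • xpow P μ • u ∈ xSpan P lam := by
    intro μ j
    rw [reflSum, Finset.sum_smul]
    exact sum_mem fun η _ => t_smul_mem_xSpan P _ (hmem μ)
  induction μ using comp_induction with
  | h0 =>
    rw [xpow_zero, one_smul]
    refine smul_mem_of_span P (y P i) hu ?_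
    rintro _ ⟨T, rfl⟩
    rw [y_smul_v]
    exact zero_mem _
  | hs μ j ih =>
    rw [xpow_add_single, ← mul_smul, ← mul_assoc, mul_smul]
    by_cases hij : i = j
    · subst hij
      rw [yx_eq, sub_smul, sub_smul, add_smul, mul_smul, smul_assoc, Finset.sum_smul, dSum,
        Finset.sum_smul]
      refine sub_mem (sub_mem (add_mem (x_smul_mem_xSpan P i ih)
        (Submodule.smul_mem _ _ (hmem μ))) (sum_mem fun j _ => ?_))
        (Submodule.smul_mem _ _ (sum_mem fun j _ => hrefl μ j))
      rw [smul_assoc, fe, map_smul, smul_assoc, map_sum, Finset.sum_smul]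
      refine Submodule.smul_mem _ _ (Submodule.smul_mem _ _ (sum_mem fun l _ => ?_))
      rw [map_smul, smul_assoc]
      exact Submodule.smul_mem _ _ (t_smul_mem_xSpan P _ (hmem μ))
    · rw [yx_ne P i j hij, add_smul, mul_smul, smul_assoc, Finset.sum_smul]
      refine add_mem (x_smul_mem_xSpan P j ih) (Submodule.smul_mem _ _ (sum_mem fun η _ => ?_))
      rw [smul_assoc]
      exact Submodule.smul_mem _ _ (t_smul_mem_xSpan P _ (hmem μ))

/-- The span is stable under all generators of `ℍ` and contains every `v_T`. This is the spanning
half of a triangular decomposition. -/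
theorem xSpan_eq_top : xSpan P lam = ⊤ := by
  have hH : ∀ (a : FreeAlgebra F (Gen r n)) (m : M P lam), m ∈ xSpan P lam →
      toH P n a • m ∈ xSpan P lam := by
    intro a
    induction a using FreeAlgebra.induction with
    | grade0 c =>
      intro m hm
      rw [AlgHom.commutes]
      exact Submodule.smul_mem _ c hm
    | grade1 g =>
      intro m hm
      cases g with
      | x i => exact x_smul_mem_xSpan P i hm
      | y i => exact y_smul_mem_xSpan P i hm
      | t w => exact t_smul_mem_xSpan P w hm
    | mul a b ha hb => intro m hm; rw [map_mul, mul_smul]; exact ha _ (hb _ hm)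
    | add a b ha hb => intro m hm; rw [map_add, add_smul]; exact add_mem (ha _ hm) (hb _ hm)
  rw [eq_top_iff]
  rintro m -
  obtain ⟨s, rfl⟩ : ∃ s, mkM P lam s = m := Submodule.mkQ_surjective _ m
  induction s using Finsupp.induction_linear with
  | zero => rw [map_zero]; exact zero_mem _
  | add a b ha hb => rw [map_add]; exact add_mem ha hb
  | single T h =>
    obtain ⟨a, rfl⟩ : ∃ a, toH P n a = h := RingQuot.mkAlgHom_surjective F (Rel P n) h
    have h0 := xpow_smul_mem_xSpan P 0 (Submodule.subset_span ⟨T, rfl⟩ : v P T ∈ vSpan P lam)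
    rw [xpow_zero, one_smul] at h0
    rw [mk_single]
    exact hH a _ h0

theorem span_xv_eq_top :
    Submodule.span F {u | ∃ μ S, u = xv P (lam := lam) μ S} = ⊤ := by
  rw [eq_top_iff, ← xSpan_eq_top P (lam := lam), xSpan, Submodule.span_le]
  rintro _ ⟨μ, u, hu, rfl⟩
  refine Submodule.span_mono ?_ (xpow_smul_mem P hu μ)
  rintro _ ⟨S, rfl⟩
  exact ⟨μ, S, rfl⟩

end StandardModuleLemmas

end

end Cherednik

namespace Cherednik

noncomputable section

/-! ### Weights and existence of the eigenvectors -/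

section Weights

set_option linter.unusedSectionVars false

variable {F : Type} [Field F] [Algebra ℂ F] {r n : ℕ} [NeZero r] (P : Params F r)
  {lam : RPartition r n}

/-- The eigenvalue of `z_i` on the eigenvector attached to `μ` and `T`. -/
def wtZ (μ : Fin n → ℕ) (T : SYT lam) (i : Fin n) : F :=
  P.κ * ((μ i : F) + 1)
    - (P.d ((beta (T.1 (wPerm μ i)) : ℕ) : ZMod r)
      - P.d (((beta (T.1 (wPerm μ i)) : ℕ) : ZMod r) - ((μ i : ZMod r) + 1)))
    - P.c₀ * r * ((ct (T.1 (wPerm μ i)) : ℤ) : F)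

/-- The eigenvalue of `t_{ζ_i}` on the eigenvector attached to `μ` and `T`. -/
def wtD (μ : Fin n → ℕ) (T : SYT lam) (i : Fin n) : rootsOfUnity r ℂ :=
  rootWt T (wPerm μ i) (μ i)

/-- `m` is a joint eigenvector of the `z_i` and the `t_{ζ_i}`. -/
def HasWt (a : Fin n → F) (η : Fin n → rootsOfUnity r ℂ) (m : M P lam) : Prop :=
  (∀ i, z P i • m = a i • m) ∧ ∀ i, t P (diagG r i) • m = rootF F (η i) • m

/-- A form of algebraic independence of the parameters. -/
def Generic : Prop := ∀ (a b : ℤ) (p q p' q' : ZMod r),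
  (a : F) * P.κ + (b : F) * P.c₀ = P.d p - P.d q - (P.d p' - P.d q') → a = 0 ∧ b = 0

variable {P}

theorem natCast_r_ne_zero : (r : F) ≠ 0 := by
  have := (algebraMap ℂ F).injective.ne (Nat.cast_ne_zero.mpr (NeZero.ne r) : (r : ℂ) ≠ 0)
  simpa using this

theorem Generic.c₀_ne_zero (hP : Generic P) : P.c₀ ≠ 0 := fun h => by
  have := hP 0 1 0 0 0 0 (by rw [h]; ring)
  exact one_ne_zero this.2

/-- The coefficients of `κ` and `c₀` are compared; the four `d`-terms have exactly the shape allowed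
in `Generic`. The value `k = 0` separates weights, and `k = ±r` serves to show that the squares of
intertwiners do not vanish. -/
theorem wtZ_sub_eq (hP : Generic P) {μ ν : Fin n → ℕ} {T S : SYT lam} {i j : Fin n} {k : ℤ}
    (h : wtZ P μ T i - wtZ P ν S j = P.c₀ * (k : F)) :
    μ i = ν j ∧ (r : ℤ) * (ct (S.1 (wPerm ν j)) - ct (T.1 (wPerm μ i))) = k := by
  have := hP ((μ i : ℤ) - ν j)
    ((r : ℤ) * (ct (S.1 (wPerm ν j)) - ct (T.1 (wPerm μ i))) - k)
    ((beta (T.1 (wPerm μ i)) : ℕ) : ZMod r)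
    (((beta (T.1 (wPerm μ i)) : ℕ) : ZMod r) - ((μ i : ZMod r) + 1))
    ((beta (S.1 (wPerm ν j)) : ℕ) : ZMod r)
    (((beta (S.1 (wPerm ν j)) : ℕ) : ZMod r) - ((ν j : ZMod r) + 1))
    (by
      rw [wtZ, wtZ] at h
      push_cast
      linear_combination h)
  omega

theorem wtZ_eq (hP : Generic P) {μ ν : Fin n → ℕ} {T S : SYT lam} {i j : Fin n}
    (h : wtZ P μ T i = wtZ P ν S j) :
    μ i = ν j ∧ ct (T.1 (wPerm μ i)) = ct (S.1 (wPerm ν j)) := by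
  have := wtZ_sub_eq hP (μ := μ) (ν := ν) (T := T) (S := S) (i := i) (j := j) (k := 0) (by rw [h]; simp)
  refine ⟨this.1, ?_⟩
  rcases mul_eq_zero.mp this.2 with h0 | h0
  · exact absurd h0 (Nat.cast_ne_zero.mpr (NeZero.ne r))
  · omega

theorem wtZ_ne_zero (hP : Generic P) (μ : Fin n → ℕ) (T : SYT lam) (i : Fin n) :
    wtZ P μ T i ≠ 0 := fun h => by
  have := hP ((μ i : ℤ) + 1) (-(r * ct (T.1 (wPerm μ i))))
    ((beta (T.1 (wPerm μ i)) : ℕ) : ZMod r)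
    (((beta (T.1 (wPerm μ i)) : ℕ) : ZMod r) - ((μ i : ZMod r) + 1)) 0 0 (by
      rw [wtZ] at h
      push_cast
      linear_combination h)
  omega

theorem beta_eq_of_rootWt_eq {T S : SYT lam} {i j : Fin n} {a : ℕ}
    (h : rootWt T i a = rootWt S j a) : beta (T.1 i) = beta (S.1 j) := by
  rw [rootWt, rootWt, zetaRoot_zpow_eq_iff] at h
  push_cast at h
  have h2 := sub_left_injective h
  have h3 := congrArg ZMod.val h2
  rw [ZMod.val_natCast_of_lt (beta (T.1 i)).2, ZMod.val_natCast_of_lt (beta (S.1 j)).2] at h3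
  exact Fin.ext h3

/-- The `κ`-part gives `μ` and the `c₀`-part the contents. The components are read off from the
diagonal matrices, and contents with components determine a standard tableau. -/
theorem weight_injective (hP : Generic P) {μ ν : Fin n → ℕ} {T S : SYT lam}
    (hz : wtZ P μ T = wtZ P ν S) (hd : wtD μ T = wtD ν S) : μ = ν ∧ T = S := by
  have h1 : μ = ν := funext fun i => (wtZ_eq hP (congrFun hz i)).1
  subst h1
  refine ⟨rfl, eq_of_ct_eq (fun i => ?_) (fun i => ?_)⟩
  · have := congrFun hd ((wPerm μ).symm i)
    rw [wtD, wtD] at this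
    have := beta_eq_of_rootWt_eq this
    rwa [Equiv.apply_symm_apply] at this
  · have := (wtZ_eq hP (congrFun hz ((wPerm μ).symm i))).2
    rwa [Equiv.apply_symm_apply] at this

/-- For `μ = 0` the permutation `w_μ` reverses the order, so it carries the reflections with lines
after `i` to a Jucys–Murphy element, whose value on `v_T` is known. -/
theorem hasWt_zero (T : SYT lam) : HasWt P (wtZ P 0 T) (wtD 0 T) (xv P 0 T) := by
  have hdiag : ∀ i, t P (diagG r i) • xv P 0 T = rootF F (wtD 0 T i) • xv P 0 T := fun i => by
    rw [xv, xpow_zero, one_smul, ← mul_smul, ← t_mul]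
    have : diagG r i * permG r (wPerm (0 : Fin n → ℕ))⁻¹
        = permG r (wPerm (0 : Fin n → ℕ))⁻¹ * diagG r (wPerm (0 : Fin n → ℕ) i) := by
      rw [permG_eq, diagG_eq, diagG_eq, monG_mul_diagRoot]
      simp
    rw [this, t_mul, mul_smul, diag_smul_v, smul_comm]
    rfl
  refine ⟨fun i => ?_, hdiag⟩
  set w := wPerm (0 : Fin n → ℕ) with hw
  have hlt : ∀ a b : Fin n, b < a → w a < w b := fun a b h => wPerm_lt _ (Or.inr ⟨rfl, h⟩)
  have hd := dSum_smul P (b := ((beta (T.1 (w i)) : ℕ) : ℤ)) (m := xv P 0 T) (i := i) (by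
    rw [hdiag, wtD, rootWt, ← hw]
    simp)
  have hy : y P i • xv P 0 T = 0 := by
    rw [xv, xpow_zero, one_smul, ← mul_smul, permG_eq]
    have h1 := t_y P w⁻¹ (fun _ => (1 : rootsOfUnity r ℂ)) (w i)
    rw [rootF_one, one_smul] at h1
    rw [← hw, show y P i = y P (w⁻¹ (w i)) by simp, ← h1, mul_smul, y_smul_v, smul_zero]
  -- The reflections with smaller index cancel against the Jucys–Murphy part of `z_i`; those with
  -- larger index remain.
  have hsum : (∑ j ∈ Finset.univ.erase i, reflSum P i j)
      = jm P i + ∑ j ∈ Finset.Ioi i, reflSum P i j := by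
    rw [jm_eq, ← Finset.sum_union]
    · congr 1
      ext k
      simp [lt_or_lt_iff_ne]
    · rw [Finset.disjoint_left]
      intro k h1 h2
      exact absurd (Finset.mem_Iio.mp h1) (Finset.mem_Ioi.mp h2).not_gt
  have hjm : (∑ j ∈ Finset.Ioi i, reflSum P i j) • xv P 0 T
      = ((r : F) * ((ct (T.1 (w i)) : ℤ) : F)) • xv P 0 T := by
    rw [xv, xpow_zero, one_smul, ← mul_smul, ← hw]
    have : (∑ j ∈ Finset.Ioi i, reflSum P i j) * t P (permG r w⁻¹)
        = t P (permG r w⁻¹) * jm P (w i) := by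
      rw [jm_eq, Finset.sum_mul, Finset.mul_sum]
      refine Finset.sum_equiv w (fun k => ?_) (fun k hk => ?_)
      · rw [Finset.mem_Ioi, Finset.mem_Iio]
        refine ⟨fun h => hlt _ _ h, fun h => ?_⟩
        by_contra hle
        rcases (not_lt.mp hle).lt_or_eq with h2 | h2
        · exact absurd (hlt _ _ h2) h.not_gt
        · rw [h2] at h; exact lt_irrefl _ h
      · rw [t_perm_reflSum P _ _ _ (fun e => (Finset.mem_Ioi.mp hk).ne (w.injective e))]
        simp
    rw [this, mul_smul, jm_smul_v, smul_comm]
  rw [z, yx_eq, hsum, smul_add]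
  simp only [add_smul, sub_smul, mul_smul, smul_assoc]
  rw [hy, smul_zero, algebraMap_smul_M, hd, hjm, wtZ, ← hw]
  push_cast
  simp only [Pi.zero_apply, Nat.cast_zero, zero_add]
  generalize jm P i • xv P 0 T = m'
  module

/-- The scalar by which `c₀ (z_i - z_j)⁻¹ π_i` acts. -/
def sigmaScalar (P : Params F r) (a : Fin n → F) (η : Fin n → rootsOfUnity r ℂ) (i j : Fin n) :
    F :=
  P.c₀ * (if η i = η j then (r : F) else 0) / (a i - a j)

/-- The scalar is chosen so that the `π_i`-term in the commutation of `t_{s_i}` with `z_i` is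
compensated; the weight is then permuted by `s_i`. -/
theorem HasWt.sigma {a : Fin n → F} {η : Fin n → rootsOfUnity r ℂ} {m : M P lam}
    (hm : HasWt P a η m) {i j : Fin n} (hij : i.1 + 1 = j.1) (h : a i ≠ a j ∨ η i ≠ η j) :
    HasWt P (a ∘ Equiv.swap i j) (η ∘ Equiv.swap i j)
      (t P (permG r (Equiv.swap i j)) • m + sigmaScalar P a η i j • m) := by
  obtain ⟨hz, hd⟩ := hm
  set e := sigmaScalar P a η i j with he
  have hpi := piH_smul P (hd i) (hd j)
  have hne : i ≠ j := fun e => by subst e; omega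
  -- This also covers `a i = a j`: then `η i ≠ η j`, so both sides are 0.
  have hea : e * (a i - a j) = P.c₀ * (if η i = η j then (r : F) else 0) := by
    rw [he, sigmaScalar]
    by_cases h1 : a i - a j = 0
    · have : η i ≠ η j := h.resolve_left (fun h2 => h2 (sub_eq_zero.mp h1))
      simp [this]
    · rw [div_mul_cancel₀ _ h1]
  -- Either the two diagonal characters agree, and exchanging them is harmless, or the correction
  -- term is absent.
  have hed : ∀ k, e • rootF F (η k) • m = e • rootF F (η (Equiv.swap i j k)) • m := fun k => by
    by_cases hη : η i = η j
    · rw [Equiv.swap_apply_def]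
      split_ifs with h1 h2
      · rw [h1, hη]
      · rw [h2, hη]
      · rfl
    · have : e = 0 := by rw [he, sigmaScalar, if_neg hη]; simp
      rw [this, zero_smul, zero_smul]
  refine ⟨fun k => ?_, fun k => ?_⟩
  · by_cases hki : k = i
    · subst hki
      rw [smul_add, ← mul_smul, z_mul_t_swap P hij, sub_smul, mul_smul, hz, smul_assoc, hpi,
        smul_comm (z P k) e, hz, Function.comp_apply, Equiv.swap_apply_left, smul_smul P.c₀, ← hea,
        smul_comm (t P _) (a j)]
      generalize (t P (permG r _) : H P n) • m = m'
      module
    · by_cases hkj : k = j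
      · subst hkj
        have h1 : z P k * t P (permG r (Equiv.swap i k))
            = t P (permG r (Equiv.swap i k)) * z P i + P.c₀ • piH P i k := by
          rw [t_swap_mul_z P hij]; abel
        rw [smul_add, ← mul_smul, h1, add_smul, mul_smul, hz, smul_assoc, hpi,
          smul_comm (z P k) e, hz, Function.comp_apply, Equiv.swap_apply_right, smul_smul P.c₀,
          ← hea, smul_comm (t P _) (a i)]
        generalize (t P (permG r _) : H P n) • m = m'
        module
      · rw [smul_add, ← mul_smul, z_mul_t_swap_of_ne P hij hki hkj, mul_smul, hz,
          smul_comm (z P k) e, hz, Function.comp_apply, Equiv.swap_apply_of_ne_of_ne hki hkj,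
          smul_comm (t P _) (a k)]
        generalize (t P (permG r _) : H P n) • m = m'
        module
  · have h1 : diagG r k * permG r (Equiv.swap i j)
        = permG r (Equiv.swap i j) * diagG r (Equiv.swap i j k) := by
      rw [permG_eq, diagG_eq, diagG_eq, monG_mul_diagRoot]
      simp
    rw [smul_add, ← mul_smul, ← t_mul, h1, t_mul, mul_smul, hd, smul_comm (t P (diagG r k)) e, hd,
      hed, Function.comp_apply, smul_comm (t P _) (rootF F _)]
    generalize (t P (permG r _) : H P n) • m = m'
    module

/-- This is `(t_s - e)(t_s + e) = 1 - e²`. After the weight has been exchanged the scalar changes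
sign, so the left side is a composite of two intertwiners. -/
theorem sigma_sq {m : M P lam} (i j : Fin n) (e : F) :
    t P (permG r (Equiv.swap i j)) • (t P (permG r (Equiv.swap i j)) • m + e • m)
      - e • (t P (permG r (Equiv.swap i j)) • m + e • m) = (1 - e ^ 2) • m := by
  rw [smul_add, ← mul_smul, t_swap_sq, one_smul, smul_comm (t P _) e]
  generalize (t P (permG r _) : H P n) • m = m'
  module

theorem wtZ_comp_swap {μ : Fin n → ℕ} {i j : Fin n} (hij : i.1 + 1 = j.1) (h : μ i ≠ μ j)
    (T : SYT lam) : wtZ P (μ ∘ Equiv.swap i j) T = wtZ P μ T ∘ Equiv.swap i j := by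
  funext k
  simp only [wtZ, wPerm_comp_swap_adj hij h, Function.comp_apply, Equiv.Perm.mul_apply]

theorem wtD_comp_swap {μ : Fin n → ℕ} {i j : Fin n} (hij : i.1 + 1 = j.1) (h : μ i ≠ μ j)
    (T : SYT lam) : wtD (μ ∘ Equiv.swap i j) T = wtD μ T ∘ Equiv.swap i j := by
  funext k
  simp only [wtD, wPerm_comp_swap_adj hij h, Function.comp_apply, Equiv.Perm.mul_apply]

theorem HasWt.phi [NeZero n] {μ : Fin n → ℕ} {T : SYT lam} {m : M P lam}
    (hm : HasWt P (wtZ P μ T) (wtD μ T) m) :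
    HasWt P (wtZ P (phiC μ) T) (wtD (phiC μ) T) (Phi P n • m) := by
  obtain ⟨hz, hd⟩ := hm
  have hrot : ∀ {i i' : Fin n}, i.1 + 1 = i'.1 → (rot n)⁻¹ i = i' := fun h => by
    rw [← rot_of_lt h]; simp
  have hrot0 : (rot n)⁻¹ (lastIdx n) = 0 := by rw [← rot_zero]; simp
  have hdiag : ∀ i, t P (diagG r i) • Phi P n • m = rootF F (wtD (phiC μ) T i) • Phi P n • m := by
    intro i
    rcases rot_zero_or (i := i) with rfl | ⟨i', h⟩
    · have : wtD (phiC μ) T (lastIdx n) = (zetaRoot r)⁻¹ * wtD μ T 0 := by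
        rw [wtD, wtD, wPerm_phiC, Equiv.Perm.mul_apply, hrot0, phiC_last, rootWt, rootWt,
          ← zpow_neg_one, ← zpow_add]
        congr 1
        push_cast
        ring
      rw [← mul_smul, t_diag_last_mul_Phi, smul_assoc, mul_smul, hd, smul_comm (Phi P n),
        smul_smul, this, rootF_mul, rootF_inv]
      simp [rootF]
    · have : wtD (phiC μ) T i = wtD μ T i' := by
        rw [wtD, wtD, wPerm_phiC, Equiv.Perm.mul_apply, hrot h, phiC_of_lt h]
      rw [← mul_smul, t_diag_mul_Phi P h, mul_smul, hd, smul_comm, this]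
  refine ⟨fun i => ?_, hdiag⟩
  rcases rot_zero_or (i := i) with rfl | ⟨i', h⟩
  · have h1 := dSum_smul P (hdiag (lastIdx n))
    -- The `d`-part of the eigenvalue telescopes: increasing the entry by one adds the single
    -- difference by which the sum of the `e_{nj}` acts.
    have h2 : wtZ P (phiC μ) T (lastIdx n) = wtZ P μ T 0 + P.κ
        - (P.d (((beta (T.1 (wPerm μ 0)) : ℕ) : ZMod r) - ((μ 0 : ZMod r) + 1))
          - P.d (((beta (T.1 (wPerm μ 0)) : ℕ) : ZMod r) - ((μ 0 : ZMod r) + 1) - 1)) := by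
      rw [wtZ, wtZ, wPerm_phiC, Equiv.Perm.mul_apply, hrot0, phiC_last]
      push_cast
      rw [show ((beta (T.1 (wPerm μ 0)) : ℕ) : ZMod r) - ((μ 0 : ZMod r) + 1 + 1)
        = ((beta (T.1 (wPerm μ 0)) : ℕ) : ZMod r) - ((μ 0 : ZMod r) + 1) - 1 by ring]
      ring
    rw [wPerm_phiC, Equiv.Perm.mul_apply, hrot0, phiC_last] at h1
    push_cast at h1
    rw [← mul_smul, z_last_mul_Phi, add_smul, mul_smul, hz, mul_smul, sub_smul,
      algebraMap_smul_M, h1, smul_comm (Phi P n), h2]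
    generalize Phi P n • m = m'
    module
  · have : wtZ P (phiC μ) T i = wtZ P μ T i' := by
      rw [wtZ, wtZ, wPerm_phiC, Equiv.Perm.mul_apply, hrot h, phiC_of_lt h]
    rw [← mul_smul, z_mul_Phi P h, mul_smul, hz, smul_comm, this]

/-! ### Leading terms -/

variable (P lam) in
/-- The span of the `x^ν v_S^ν` with `ν` below `μ` in the affine Bruhat order. -/
def affLower (μ : Fin n → ℕ) : Submodule F (M P lam) :=
  Submodule.span F {u | ∃ ν S, AffLT ν μ ∧ u = xv P ν S}

theorem xv_mem_affLower {ν μ : Fin n → ℕ} (h : AffLT ν μ) (S : SYT lam) :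
    xv P ν S ∈ affLower P lam μ := Submodule.subset_span ⟨ν, S, h, rfl⟩

theorem affLower_mono {ν μ : Fin n → ℕ} (h : ∀ κ, AffLT κ ν → AffLT κ μ) :
    affLower P lam ν ≤ affLower P lam μ := by
  refine Submodule.span_mono ?_
  rintro _ ⟨κ, S, h1, rfl⟩
  exact ⟨κ, S, h κ h1, rfl⟩

theorem xpow_smul_mem_affLower {ν μ : Fin n → ℕ} (h : AffLT ν μ) {u : M P lam}
    (hu : u ∈ vSpan P lam) : xpow P ν • u ∈ affLower P lam μ := by
  refine Submodule.span_mono ?_ (xpow_smul_mem P hu ν)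
  rintro _ ⟨S, rfl⟩
  exact ⟨ν, S, h, rfl⟩

theorem t_swap_smul_xv (i j : Fin n) (ν : Fin n → ℕ) (S : SYT lam) :
    t P (permG r (Equiv.swap i j)) • xv P ν S
      = xpow P (ν ∘ Equiv.swap i j) • t P (permG r (Equiv.swap i j * (wPerm ν)⁻¹)) • v P S := by
  rw [xv, ← mul_smul, t_perm_mul_xpow, mul_smul, ← mul_smul (t P _) (t P _), ← t_mul, ← permG_mul,
    Equiv.symm_swap]

/-- With distinct entries `w_μ` is multiplied by the same transposition as the monomial, so the
twist of `v_S` stays the prescribed one. -/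
theorem t_swap_smul_xv_of_ne {i j : Fin n} (hij : i.1 + 1 = j.1) {ν : Fin n → ℕ} (h : ν i ≠ ν j)
    (S : SYT lam) :
    t P (permG r (Equiv.swap i j)) • xv P ν S = xv P (ν ∘ Equiv.swap i j) S := by
  rw [t_swap_smul_xv, xv, wPerm_comp_swap_adj hij h, mul_inv_rev, Equiv.swap_inv]

theorem t_swap_smul_mem_affLower {i j : Fin n} {ν μ : Fin n → ℕ}
    (h : ∀ κ, AffLT κ ν → AffLT (κ ∘ Equiv.swap i j) μ) {m : M P lam}
    (hm : m ∈ affLower P lam ν) : t P (permG r (Equiv.swap i j)) • m ∈ affLower P lam μ := by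
  refine smul_mem_of_span P _ hm ?_
  rintro _ ⟨κ, S, h1, rfl⟩
  rw [t_swap_smul_xv]
  exact xpow_smul_mem_affLower (h κ h1) (twist_mem_vSpan P _ S)

theorem Phi_smul_xv [NeZero n] (ν : Fin n → ℕ) (S : SYT lam) :
    Phi P n • xv P ν S = xv P (phiC ν) S := by
  rw [xv, ← mul_smul, Phi_eq, mul_assoc, t_perm_mul_xpow, ← mul_assoc, ← xpow_add_single,
    mul_smul, ← mul_smul (t P _) (t P _), ← t_mul, ← permG_mul, xv, wPerm_phiC, mul_inv_rev, inv_inv]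
  congr 2
  funext i
  rw [Pi.add_apply, Function.comp_apply]
  change ν ((rot n)⁻¹ i) + _ = _
  rcases rot_zero_or (i := i) with rfl | ⟨i', h⟩
  · rw [phiC_last, show (rot n)⁻¹ (lastIdx n) = 0 by rw [← rot_zero]; simp]
    simp
  · have hl : lastIdx n ≠ i := fun e => by
      have := i'.2
      rw [← e] at h
      simp only [lastIdx] at h
      omega
    rw [phiC_of_lt h, show (rot n)⁻¹ i = i' by rw [← rot_of_lt h]; simp]
    simp [hl]

theorem Phi_smul_mem_affLower [NeZero n] {μ : Fin n → ℕ} {m : M P lam}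
    (hm : m ∈ affLower P lam μ) : Phi P n • m ∈ affLower P lam (phiC μ) := by
  refine smul_mem_of_span P _ hm ?_
  rintro _ ⟨κ, S, h1, rfl⟩
  rw [Phi_smul_xv]
  exact xv_mem_affLower h1.phi S

/-- `m` is a nonzero weight vector with leading term `x^μ v_T^μ`. -/
structure IsLeading (P : Params F r) (μ : Fin n → ℕ) (T : SYT lam) (m : M P lam) : Prop where
  ne_zero : m ≠ 0
  hasWt : HasWt P (wtZ P μ T) (wtD μ T) m
  sub_mem : m - xv P μ T ∈ affLower P lam μ

/-- Since `μ_i < μ_j`, the composition `μ` is itself one step below its exchange, so the correction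
term of `σ_i` contributes only lower terms. -/
theorem sigma_sub_mem {i j : Fin n} (hij : i.1 + 1 = j.1) {μ : Fin n → ℕ} (h : μ i < μ j)
    {T : SYT lam} {m : M P lam} (hm : m - xv P μ T ∈ affLower P lam μ) (e : F) :
    t P (permG r (Equiv.swap i j)) • m + e • m - xv P (μ ∘ Equiv.swap i j) T
      ∈ affLower P lam (μ ∘ Equiv.swap i j) := by
  have e1 : t P (permG r (Equiv.swap i j)) • m + e • m - xv P (μ ∘ Equiv.swap i j) T
      = t P (permG r (Equiv.swap i j)) • (m - xv P μ T)
        + (e • (m - xv P μ T) + e • xv P μ T) := by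
    rw [smul_sub, t_swap_smul_xv_of_ne hij h.ne]
    generalize (t P (permG r _) : H P n) • m = m'
    module
  rw [e1]
  have hlt : i < j := by rw [Fin.lt_def]; omega
  refine add_mem (t_swap_smul_mem_affLower (fun κ hκ => hκ.comp_swap hij h) hm)
    (add_mem (Submodule.smul_mem _ _ (affLower_mono (fun κ hκ => hκ.lt_swap hij h) hm))
      (Submodule.smul_mem _ _ (xv_mem_affLower (Relation.TransGen.single (step_swap hlt h)) T)))

/-- Vanishing would make the difference of the two `z`-eigenvalues an integer multiple of `c₀`,
while its `κ`-coefficient `μ_i - μ_j` is nonzero. -/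
theorem sigmaScalar_sq_ne_one (hP : Generic P) {μ : Fin n → ℕ} {T : SYT lam} {i j : Fin n}
    (h : μ i ≠ μ j) : 1 - sigmaScalar P (wtZ P μ T) (wtD μ T) i j ^ 2 ≠ 0 := by
  have hne : wtZ P μ T i - wtZ P μ T j ≠ 0 := fun h1 => h (wtZ_eq hP (sub_eq_zero.mp h1)).1
  rw [sigmaScalar]
  intro h2
  have hk : ∃ k : ℤ, (if wtD μ T i = wtD μ T j then (r : F) else 0) = (k : F) := by
    split_ifs
    · exact ⟨r, by simp⟩
    · exact ⟨0, by simp⟩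
  obtain ⟨k, hk⟩ := hk
  rw [hk] at h2
  have h3 : (wtZ P μ T i - wtZ P μ T j - P.c₀ * k) * (wtZ P μ T i - wtZ P μ T j + P.c₀ * k) = 0 := by
    field_simp at h2
    linear_combination h2
  rcases mul_eq_zero.mp h3 with h4 | h4
  · exact h (wtZ_sub_eq hP (sub_eq_zero.mp h4)).1
  · exact h (wtZ_sub_eq hP (k := -k) (by push_cast; linear_combination h4)).1

theorem IsLeading.sigma (hP : Generic P) {i j : Fin n} (hij : i.1 + 1 = j.1) {μ : Fin n → ℕ}
    (h : μ i < μ j) {T : SYT lam} {m : M P lam} (hm : IsLeading P μ T m) :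
    IsLeading P (μ ∘ Equiv.swap i j) T
      (t P (permG r (Equiv.swap i j)) • m + sigmaScalar P (wtZ P μ T) (wtD μ T) i j • m) where
  ne_zero h0 := by
    have h1 := sigma_sq (m := m) i j (sigmaScalar P (wtZ P μ T) (wtD μ T) i j)
    rw [h0, smul_zero, smul_zero, sub_self] at h1
    exact (smul_ne_zero (sigmaScalar_sq_ne_one hP h.ne) hm.ne_zero) h1.symm
  hasWt := by
    rw [wtZ_comp_swap hij h.ne, wtD_comp_swap hij h.ne]
    exact hm.hasWt.sigma hij (Or.inl fun h1 => h.ne (wtZ_eq hP h1).1)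
  sub_mem := sigma_sub_mem hij h hm.sub_mem _

/-- Nonvanishing holds because `Ψ` brings the vector back up to an eigenvalue of `z_1`, whose
`κ`-coefficient is positive. -/
theorem IsLeading.phi [NeZero n] (hP : Generic P) {μ : Fin n → ℕ} {T : SYT lam} {m : M P lam}
    (hm : IsLeading P μ T m) : IsLeading P (phiC μ) T (Phi P n • m) where
  ne_zero h0 := by
    have h1 : Psi P n • Phi P n • m = wtZ P μ T 0 • m := by
      rw [← mul_smul, Psi_mul_Phi, hm.hasWt.1]
    rw [h0, smul_zero] at h1
    exact (smul_ne_zero (wtZ_ne_zero hP μ T 0) hm.ne_zero) h1.symm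
  hasWt := hm.hasWt.phi
  sub_mem := by
    rw [← Phi_smul_xv, ← smul_sub]
    exact Phi_smul_mem_affLower hm.sub_mem

/-- If zeros were never preceded by a positive entry, the zero in last place would propagate to the
whole composition. -/
theorem exists_descent [NeZero n] {μ : Fin n → ℕ} (h0 : μ ≠ 0) (hl : μ (lastIdx n) = 0) :
    ∃ i j : Fin n, i.1 + 1 = j.1 ∧ μ j = 0 ∧ 0 < μ i := by
  by_contra! hcon
  apply h0
  have key : ∀ k : ℕ, ∀ i : Fin n, i.1 + k = n - 1 → μ i = 0 := by
    intro k
    induction k with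
    | zero => intro i hi; rw [show i = lastIdx n from Fin.ext (by simp only [lastIdx]; omega), hl]
    | succ k ih =>
      intro i hi
      have := hcon i ⟨i.1 + 1, by omega⟩ rfl (ih _ (by simp only; omega))
      omega
  funext i
  exact key (n - 1 - i.1) i (by omega)

/-- If the last entry is positive, undo `φ`. Otherwise a positive entry followed by a zero is moved
one place to the right and the corresponding `σ_i` brings it back. -/
theorem exists_isLeading [NeZero n] (hP : Generic P) (hv : ∀ T : SYT lam, v P T ≠ 0)
    (T : SYT lam) (μ : Fin n → ℕ) : ∃ m, IsLeading P μ T m := by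
  by_cases h0 : μ = 0
  · subst h0
    refine ⟨xv P 0 T, fun h => hv T ?_, hasWt_zero T, by rw [sub_self]; exact zero_mem _⟩
    rw [xv, xpow_zero, one_smul] at h
    have h2 := congrArg (fun m => t P (permG r (wPerm (0 : Fin n → ℕ))) • m) h
    simp only [smul_zero] at h2
    rwa [permG_inv, ← mul_smul, t_mul_inv, one_smul] at h2
  · by_cases hl : 0 < μ (lastIdx n)
    · obtain ⟨m, hm⟩ := exists_isLeading hP hv T (psiC μ)
      have := hm.phi hP
      rw [phiC_psiC hl] at this
      exact ⟨_, this⟩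
    · obtain ⟨i, j, hij, hj, hi⟩ := exists_descent h0 (by omega)
      obtain ⟨m, hm⟩ := exists_isLeading hP hv T (μ ∘ Equiv.swap i j)
      have := hm.sigma hP hij (by simp [hj, hi])
      rw [Function.comp_assoc, ← Equiv.coe_trans, Equiv.swap_swap, Equiv.coe_refl,
        Function.comp_id] at this
      exact ⟨_, this⟩
-- Undoing `φ` lowers the total degree; moving an entry to the right keeps the degree and lowers the
-- sum weighted by distance from the end.
termination_by (∑ i, μ i, ∑ i : Fin n, (n - i.1) * μ i)
decreasing_by
  · apply Prod.Lex.left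
    have h1 : ∑ i, μ i = ∑ i, phiC (psiC μ) i := by rw [phiC_psiC hl]
    have h2 : ∑ i, phiC (psiC μ) i = ∑ i, (psiC μ i + if i = 0 then 1 else 0) := by
      rw [← Equiv.sum_comp (rot n)⁻¹ (fun i => psiC μ i + if i = 0 then 1 else 0)]
      refine Finset.sum_congr rfl fun i _ => ?_
      rcases rot_zero_or (i := i) with rfl | ⟨i', h⟩
      · rw [phiC_last, show (rot n)⁻¹ (lastIdx n) = 0 by rw [← rot_zero]; simp, if_pos rfl]
      · rw [phiC_of_lt h, show (rot n)⁻¹ i = i' by rw [← rot_of_lt h]; simp, if_neg, add_zero]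
        intro e
        rw [e, Fin.val_zero] at h
        omega
    rw [h1, h2, Finset.sum_add_distrib]
    simp
  · have hne : i ≠ j := fun e => by subst e; omega
    have e1 : ∑ k, (μ ∘ Equiv.swap i j) k = ∑ k, μ k := Equiv.sum_comp (Equiv.swap i j) μ
    rw [e1]
    apply Prod.Lex.right
    rw [sum_eq_pair hne, sum_eq_pair hne (fun k => (n - k.1) * μ k)]
    have : ∑ k ∈ (Finset.univ.erase i).erase j, (n - k.1) * (μ ∘ Equiv.swap i j) k
        = ∑ k ∈ (Finset.univ.erase i).erase j, (n - k.1) * μ k := by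
      refine Finset.sum_congr rfl fun k hk => ?_
      simp only [Finset.mem_erase, Finset.mem_univ, and_true] at hk
      rw [Function.comp_apply, Equiv.swap_apply_of_ne_of_ne hk.2 hk.1]
    rw [this]
    simp only [Function.comp_apply, Equiv.swap_apply_left, Equiv.swap_apply_right, hj, mul_zero,
      zero_add, add_zero]
    have h3 : n - j.1 < n - i.1 := by omega
    have h4 := Nat.mul_lt_mul_of_pos_right h3 hi
    omega

end Weights

end

end Cherednik

namespace Cherednik

noncomputable section

/-! ### The eigenbasis and the action of the intertwiners -/

section Eigenbasis

set_option linter.unusedSectionVars false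

theorem linearIndependent_of_joint_eigen {ι A K V : Type*} [Field K] [AddCommGroup V] [Module K V]
    (u : ι → V) (hu : ∀ k, u k ≠ 0) (T : A → V →ₗ[K] V) (χ : ι → A → K)
    (h : ∀ k a, T a (u k) = χ k a • u k) (hχ : Function.Injective χ) :
    LinearIndependent K u := by
  classical
  rw [linearIndependent_iff']
  intro s
  induction s using Finset.induction_on with
  | empty => intro g _ i hi; simp at hi
  | insert k₀ s hk₀ ih =>
    intro g hg
    rw [Finset.sum_insert hk₀] at hg
    have hs : ∀ k ∈ s, g k = 0 := fun k hk => by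
      have hne : k ≠ k₀ := fun e => hk₀ (e ▸ hk)
      -- Distinct characters need only be separated by some operator, which may depend on the pair;
      -- it eliminates the term of `k₀`.
      obtain ⟨a, ha⟩ : ∃ a, χ k a ≠ χ k₀ a := by
        by_contra! hcon
        exact hne (hχ (funext hcon))
      have h1 := congrArg (T a) hg
      have h2 := congrArg (fun m => χ k₀ a • m) hg
      simp only [map_add, map_smul, map_sum, h, map_zero, smul_add, smul_zero,
        Finset.smul_sum] at h1 h2
      have h3 : ∑ i ∈ s, (g i * (χ i a - χ k₀ a)) • u i = 0 := by
        have : ∑ i ∈ s, (g i * (χ i a - χ k₀ a)) • u i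
            = (g k₀ • χ k₀ a • u k₀ + ∑ i ∈ s, g i • χ i a • u i)
              - (χ k₀ a • g k₀ • u k₀ + ∑ i ∈ s, χ k₀ a • g i • u i) := by
          rw [smul_comm (g k₀), add_sub_add_left_eq_sub, ← Finset.sum_sub_distrib]
          refine Finset.sum_congr rfl fun i _ => ?_
          module
        rw [this, h1, h2, sub_zero]
      exact (mul_eq_zero.mp (ih _ h3 k hk)).resolve_right (sub_ne_zero.mpr ha)
    rw [Finset.sum_eq_zero (fun k hk => by rw [hs k hk, zero_smul]), add_zero] at hg
    intro k hk
    rcases Finset.mem_insert.mp hk with rfl | hk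
    · exact (smul_eq_zero.mp hg).resolve_right (hu _)
    · exact hs k hk

variable {F : Type} [Field F] [Algebra ℂ F] {r n : ℕ} [NeZero r] {P : Params F r}
  {lam : RPartition r n}

variable (P lam) in
/-- The span of the `x^ν v_S^ν` with `ν < μ`. -/
def compLower (μ : Fin n → ℕ) : Submodule F (M P lam) :=
  Submodule.span F {u | ∃ ν S, CompLT ν μ ∧ u = xv P ν S}

theorem affLower_le_compLower (μ : Fin n → ℕ) : affLower P lam μ ≤ compLower P lam μ := by
  refine Submodule.span_mono ?_
  rintro _ ⟨ν, S, h, rfl⟩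
  exact ⟨ν, S, h.compLT, rfl⟩

theorem rootF_injective : Function.Injective (rootF F : rootsOfUnity r ℂ → F) := fun _ _ h =>
  rootsOfUnity_ext ((algebraMap ℂ F).injective h)

variable {f : (Fin n → ℕ) → SYT lam → M P lam} (hf : ∀ μ T, IsLeading P μ T (f μ T))
  (hP : Generic P)

include hf hP in
theorem f_linearIndependent :
    LinearIndependent F (fun p : (Fin n → ℕ) × SYT lam => f p.1 p.2) := by
  refine linearIndependent_of_joint_eigen (A := Fin n ⊕ Fin n) _ (fun p => (hf p.1 p.2).ne_zero)
    (fun a => DistribSMul.toLinearMap F (M P lam)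
      (Sum.elim (z P) (fun i => t P (diagG r i)) a))
    (fun p => Sum.elim (wtZ P p.1 p.2) (fun i => rootF F (wtD p.1 p.2 i))) ?_ ?_
  · rintro p (i | i)
    · exact (hf p.1 p.2).hasWt.1 i
    · exact (hf p.1 p.2).hasWt.2 i
  · rintro ⟨μ, T⟩ ⟨ν, S⟩ h
    have h1 : wtZ P μ T = wtZ P ν S := funext fun i => congrFun h (Sum.inl i)
    have h2 : wtD μ T = wtD ν S := funext fun i => rootF_injective (congrFun h (Sum.inr i))
    obtain ⟨rfl, rfl⟩ := weight_injective hP h1 h2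
    rfl

include hf in
-- The triangular change of basis is inverted by induction along the well-founded order.
theorem compLower_le (μ : Fin n → ℕ) :
    compLower P lam μ ≤ Submodule.span F {u | ∃ ν S, CompLT ν μ ∧ u = f ν S} := by
  induction μ using compLT_wf.induction with
  | _ μ ih =>
    rw [compLower, Submodule.span_le]
    rintro _ ⟨ν, S, h, rfl⟩
    have e : xv P ν S = f ν S - (f ν S - xv P ν S) := by abel
    rw [e]
    refine sub_mem (Submodule.subset_span ⟨ν, S, h, rfl⟩) ?_
    refine Submodule.span_mono ?_ (ih ν h (affLower_le_compLower ν (hf ν S).sub_mem))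
    rintro _ ⟨ν', S', h', rfl⟩
    exact ⟨ν', S', h'.trans h, rfl⟩

include hf in
theorem span_f_eq_top :
    ⊤ ≤ Submodule.span F (Set.range fun p : (Fin n → ℕ) × SYT lam => f p.1 p.2) := by
  rw [← span_xv_eq_top P (lam := lam), Submodule.span_le]
  rintro _ ⟨μ, T, rfl⟩
  have e : xv P μ T = f μ T - (f μ T - xv P μ T) := by abel
  rw [e]
  refine sub_mem (Submodule.subset_span ⟨(μ, T), rfl⟩) ?_
  refine Submodule.span_mono ?_
    (compLower_le hf μ (affLower_le_compLower μ (hf μ T).sub_mem))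
  rintro _ ⟨ν, S, _, rfl⟩
  exact ⟨(ν, S), rfl⟩

/-- The basis of eigenvectors. -/
def eigenBasis : Module.Basis ((Fin n → ℕ) × SYT lam) F (M P lam) :=
  Module.Basis.mk (f_linearIndependent hf hP) (span_f_eq_top hf)

theorem eigenBasis_apply (p : (Fin n → ℕ) × SYT lam) : eigenBasis hf hP p = f p.1 p.2 := by
  rw [eigenBasis, Module.Basis.mk_apply]

theorem coord_smul {h : H P n} {c : (Fin n → ℕ) × SYT lam → F}
    (hc : ∀ p, h • f p.1 p.2 = c p • f p.1 p.2) (p : (Fin n → ℕ) × SYT lam) (m : M P lam) :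
    (eigenBasis hf hP).coord p (h • m) = c p * (eigenBasis hf hP).coord p m := by
  have : (eigenBasis hf hP).coord p ∘ₗ DistribSMul.toLinearMap F (M P lam) h
      = c p • (eigenBasis hf hP).coord p := by
    refine (eigenBasis hf hP).ext fun q => ?_
    rw [LinearMap.comp_apply, DistribSMul.toLinearMap_apply, eigenBasis_apply, hc,
      ← eigenBasis_apply hf hP, map_smul, LinearMap.smul_apply, Module.Basis.coord_apply,
      Module.Basis.repr_self]
    by_cases hq : q = p
    · subst hq; rfl
    · simp [hq]
  exact LinearMap.congr_fun this m

theorem eq_zero_of_coord {m : M P lam} (h : ∀ p, (eigenBasis hf hP).coord p m = 0) : m = 0 :=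
  (eigenBasis hf hP).ext_elem fun p => by
    have := h p
    rw [Module.Basis.coord_apply] at this
    rw [this, map_zero, Finsupp.zero_apply]

theorem coord_eq_zero_of_mem {μ : Fin n → ℕ} {m : M P lam} (hm : m ∈ compLower P lam μ)
    {p : (Fin n → ℕ) × SYT lam} (hp : ¬ CompLT p.1 μ) : (eigenBasis hf hP).coord p m = 0 := by
  classical
  have h1 : Submodule.span F {u | ∃ ν S, CompLT ν μ ∧ u = f ν S}
      ≤ LinearMap.ker ((eigenBasis hf hP).coord p) := by
    rw [Submodule.span_le]
    rintro _ ⟨ν, S, h, rfl⟩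
    rw [SetLike.mem_coe, LinearMap.mem_ker, ← eigenBasis_apply hf hP (ν, S),
      Module.Basis.coord_apply, Module.Basis.repr_self, Finsupp.single_apply, if_neg]
    rintro rfl
    exact hp h
  exact h1 (compLower_le hf μ hm)

include hf hP in
-- Only basis vectors with `ν < μ` occur in the vector, and only those whose `z`-weight is `a`; the
-- hypothesis on weights would force `ν = μ`. Only `ν` is constrained, not the tableau, which is
-- what makes the principle usable for ties.
theorem eq_zero_of_mem_compLower {μ : Fin n → ℕ} {m : M P lam} (hm : m ∈ compLower P lam μ)
    {a : Fin n → F} (ha : ∀ i, z P i • m = a i • m)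
    (h : ∀ ν (S : SYT lam), a = wtZ P ν S → ν = μ) : m = 0 := by
  refine eq_zero_of_coord hf hP fun p => ?_
  by_cases hp : CompLT p.1 μ
  · by_contra hne
    refine hp.ne (h p.1 p.2 (funext fun i => ?_))
    have h1 := coord_smul hf hP (c := fun q => wtZ P q.1 q.2 i)
      (fun q => (hf q.1 q.2).hasWt.1 i) p m
    rw [ha, map_smul, smul_eq_mul] at h1
    exact mul_right_cancel₀ hne h1
  · exact coord_eq_zero_of_mem hf hP hm hp

include hf hP in
theorem eq_f {μ : Fin n → ℕ} {T : SYT lam} {m : M P lam}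
    (hm : m - xv P μ T ∈ compLower P lam μ) (ha : ∀ i, z P i • m = wtZ P μ T i • m) :
    m = f μ T := by
  rw [← sub_eq_zero]
  refine eq_zero_of_mem_compLower hf hP (μ := μ) (a := wtZ P μ T) ?_ (fun i => ?_)
    (fun ν S h => funext fun i => (wtZ_eq hP (congrFun h i)).1.symm)
  · have e : m - f μ T = (m - xv P μ T) - (f μ T - xv P μ T) := by abel
    rw [e]
    exact sub_mem hm (affLower_le_compLower μ (hf μ T).sub_mem)
  · rw [smul_sub, ha, (hf μ T).hasWt.1, smul_sub]

include hf hP in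
theorem IsLeading.eq_f {μ : Fin n → ℕ} {T : SYT lam} {m : M P lam} (hm : IsLeading P μ T m) :
    m = f μ T :=
  Cherednik.eq_f hf hP (affLower_le_compLower μ hm.sub_mem) hm.hasWt.1

/-! ### Eigenvectors, generalized weight spaces and the domain of `σ_i` -/

theorem tAlg_scalar {m : M P lam} {a : Fin n → F} {η : Fin n → rootsOfUnity r ℂ}
    (hm : HasWt P a η m) : ∀ h ∈ tAlg P n, ∃ c : F, h • m = c • m := by
  intro h hh
  induction hh using Algebra.adjoin_induction with
  | mem h hh =>
    rcases hh with ⟨i, rfl⟩ | ⟨i, rfl⟩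
    · exact ⟨_, hm.1 i⟩
    · exact ⟨_, hm.2 i⟩
  | algebraMap c => exact ⟨c, rfl⟩
  | add x y _ _ hx hy =>
    obtain ⟨c, hc⟩ := hx
    obtain ⟨d, hd⟩ := hy
    exact ⟨c + d, by rw [add_smul, add_smul, hc, hd]⟩
  | mul x y _ _ hx hy =>
    obtain ⟨c, hc⟩ := hx
    obtain ⟨d, hd⟩ := hy
    exact ⟨d * c, by rw [mul_smul, hd, smul_comm, hc, mul_smul]⟩

theorem z_mem_tAlg (i : Fin n) : z P i ∈ tAlg P n :=
  Algebra.subset_adjoin (Or.inl ⟨i, rfl⟩)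

theorem diag_mem_tAlg (i : Fin n) : t P (diagG r i) ∈ tAlg P n :=
  Algebra.subset_adjoin (Or.inr ⟨i, rfl⟩)

include hf hP in
-- An eigenvector in the sense of the theorem comes with unspecified eigenvalues. They are
-- determined by its leading term, and then uniqueness for a given weight applies.
theorem isLeadingEigenvector_iff (μ : Fin n → ℕ) (T : SYT lam) (g : M P lam) :
    IsLeadingEigenvector P μ T g ↔ g = f μ T := by
  constructor
  · rintro ⟨⟨-, hg⟩, hg2⟩
    refine Cherednik.eq_f hf hP hg2 fun i => ?_
    obtain ⟨c, hc⟩ := hg _ (z_mem_tAlg i)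
    have hirr : ¬ CompLT μ μ := fun h => h.ne rfl
    have h1 : g - f μ T ∈ compLower P lam μ := by
      have e : g - f μ T = (g - xv P μ T) - (f μ T - xv P μ T) := by abel
      rw [e]
      exact sub_mem hg2 (affLower_le_compLower μ (hf μ T).sub_mem)
    -- The coordinate at `(μ, T)` equals 1, so comparing this coordinate on both sides of the
    -- eigenvalue equation identifies the eigenvalue of `z_i`.
    have h2 := coord_eq_zero_of_mem hf hP h1 (p := (μ, T)) hirr
    have h3 : (eigenBasis hf hP).coord (μ, T) (f μ T) = 1 := by
      rw [← eigenBasis_apply hf hP (μ, T)]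
      simp
    rw [map_sub, h3, sub_eq_zero] at h2
    have h4 := coord_smul hf hP (c := fun q => wtZ P q.1 q.2 i)
      (fun q => (hf q.1 q.2).hasWt.1 i) (μ, T) g
    rw [hc, map_smul, h2, smul_eq_mul, mul_one, mul_one] at h4
    rw [hc, h4]
  · rintro rfl
    exact ⟨⟨(hf μ T).ne_zero, tAlg_scalar (hf μ T).hasWt⟩,
      affLower_le_compLower μ (hf μ T).sub_mem⟩

/-- The weight by which `𝔱` acts on an eigenvector. -/
def eigenChar {m : M P lam} (h0 : m ≠ 0) (hm : ∀ h ∈ tAlg P n, ∃ c : F, h • m = c • m) :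
    tAlg P n →ₐ[F] F :=
  AlgHom.ofLinearMap
    { toFun := fun a => (hm a.1 a.2).choose
      map_add' := fun a b => smul_left_injective F h0 (by
        change (hm (a + b : tAlg P n).1 (a + b).2).choose • m
          = ((hm a.1 a.2).choose + (hm b.1 b.2).choose) • m
        rw [add_smul, ← (hm (a + b : tAlg P n).1 (a + b).2).choose_spec,
          ← (hm a.1 a.2).choose_spec, ← (hm b.1 b.2).choose_spec, ← add_smul]
        rfl)
      map_smul' := fun c a => smul_left_injective F h0 (by
        change (hm (c • a : tAlg P n).1 (c • a).2).choose • m = (c * (hm a.1 a.2).choose) • m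
        rw [mul_smul, ← (hm (c • a : tAlg P n).1 (c • a).2).choose_spec,
          ← (hm a.1 a.2).choose_spec, ← smul_assoc]
        rfl) }
    (smul_left_injective F h0 (by
      change (hm (1 : tAlg P n).1 (1 : tAlg P n).2).choose • m = (1 : F) • m
      rw [← (hm (1 : tAlg P n).1 (1 : tAlg P n).2).choose_spec, one_smul]
      exact one_smul _ m))
    (fun a b => smul_left_injective F h0 (by
      change (hm (a * b : tAlg P n).1 (a * b).2).choose • m
        = ((hm a.1 a.2).choose * (hm b.1 b.2).choose) • m
      rw [← (hm (a * b : tAlg P n).1 (a * b).2).choose_spec, mul_comm, mul_smul,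
        ← (hm a.1 a.2).choose_spec, smul_comm, ← (hm b.1 b.2).choose_spec, ← mul_smul]
      rfl))

theorem eigenChar_smul {m : M P lam} (h0 : m ≠ 0)
    (hm : ∀ h ∈ tAlg P n, ∃ c : F, h • m = c • m) (a : tAlg P n) :
    (a : H P n) • m = eigenChar h0 hm a • m :=
  (hm a.1 a.2).choose_spec

include hf hP in
-- An operator diagonal in the eigenbasis has no nilpotent part, so on a generalized weight space it
-- acts by the scalar itself.
theorem smul_of_mem_weightSpace {α : tAlg P n →ₐ[F] F} {u : M P lam}
    (hu : u ∈ weightSpace P lam α) {h : H P n} (hh : h ∈ tAlg P n)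
    {c : (Fin n → ℕ) × SYT lam → F} (hc : ∀ p, h • f p.1 p.2 = c p • f p.1 p.2) :
    h • u = α ⟨h, hh⟩ • u := by
  obtain ⟨q, -, hq⟩ := hu
  have hq' := hq ⟨h, hh⟩
  simp only at hq'
  set a := α ⟨h, hh⟩ with ha
  rw [← sub_eq_zero]
  refine eq_zero_of_coord hf hP fun p => ?_
  rw [map_sub, coord_smul hf hP hc, map_smul, smul_eq_mul, ← sub_mul]
  have hc2 : ∀ k : ℕ, ∀ p : (Fin n → ℕ) × SYT lam,
      (h - algebraMap F (H P n) a) ^ k • f p.1 p.2 = (c p - a) ^ k • f p.1 p.2 := by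
    intro k p
    induction k with
    | zero => simp
    | succ k ih =>
      rw [pow_succ, mul_smul, sub_smul, hc, algebraMap_smul_M, ← sub_smul, smul_comm, ih,
        smul_smul, pow_succ, mul_comm]
  have h1 := coord_smul hf hP (hc2 q) p u
  rw [hq', map_zero] at h1
  rcases mul_eq_zero.mp h1.symm with h2 | h2
  · rw [eq_zero_of_pow_eq_zero h2, zero_mul]
  · rw [h2, mul_zero]

include hf hP in
-- On the generalized weight space of `f_{μ,T}` all generators of `𝔱` act by the scalars they have
-- on `f_{μ,T}`. Inverting `z_i - z_j` is thus division by a scalar.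
theorem sigmaEq_f {μ : Fin n → ℕ} {T : SYT lam} {i j : Fin n}
    (h : wtZ P μ T i ≠ wtZ P μ T j ∨ wtD μ T i ≠ wtD μ T j) :
    SigmaEq P i j (f μ T)
      (t P (permG r (Equiv.swap i j)) • f μ T
        + sigmaScalar P (wtZ P μ T) (wtD μ T) i j • f μ T) := by
  have h0 := (hf μ T).ne_zero
  have hs := tAlg_scalar (hf μ T).hasWt
  set α := eigenChar h0 hs with hα
  have hz : ∀ k, ∀ u ∈ weightSpace P lam α, z P k • u = wtZ P μ T k • u := fun k u hu => by
    rw [smul_of_mem_weightSpace hf hP hu (z_mem_tAlg k) (c := fun q => wtZ P q.1 q.2 k)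
      (fun q => (hf q.1 q.2).hasWt.1 k)]
    congr 1
    refine smul_left_injective F h0 ?_
    simp only
    rw [hα, ← eigenChar_smul h0 hs ⟨z P k, z_mem_tAlg k⟩]
    exact (hf μ T).hasWt.1 k
  have hd : ∀ k, ∀ u ∈ weightSpace P lam α,
      t P (diagG r k) • u = rootF F (wtD μ T k) • u := fun k u hu => by
    rw [smul_of_mem_weightSpace hf hP hu (diag_mem_tAlg k)
      (c := fun q => rootF F (wtD q.1 q.2 k)) (fun q => (hf q.1 q.2).hasWt.2 k)]
    congr 1
    refine smul_left_injective F h0 ?_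
    simp only
    rw [hα, ← eigenChar_smul h0 hs ⟨t P (diagG r k), diag_mem_tAlg k⟩]
    exact (hf μ T).hasWt.2 k
  have hpi : ∀ u ∈ weightSpace P lam α, piH P i j • u
      = (if wtD μ T i = wtD μ T j then (r : F) else 0) • u := fun u hu =>
    piH_smul P (hd i u hu) (hd j u hu)
  have hsmul : ∀ (c : F), ∀ u ∈ weightSpace P lam α, c • u ∈ weightSpace P lam α := by
    rintro c u ⟨q, hq, hu⟩
    exact ⟨q, hq, fun a => by rw [smul_comm, hu, smul_zero]⟩
  have hmem : f μ T ∈ weightSpace P lam α :=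
    ⟨1, one_pos, fun a => by
      rw [pow_one, sub_smul, eigenChar_smul h0 hs, algebraMap_smul_M, sub_self]⟩
  refine ⟨α, hmem, ?_⟩
  -- If the eigenvalues coincide then the diagonal characters differ and `π_i` kills the weight
  -- space: the second clause of the domain of `σ_i`.
  by_cases hne : wtZ P μ T i = wtZ P μ T j
  · have hη := h.resolve_left (fun h2 => h2 hne)
    refine Or.inr ⟨fun u hu => ?_, ?_⟩
    · rw [hpi u hu, if_neg hη, zero_smul]
    · rw [sigmaScalar, if_neg hη, mul_zero, zero_div, zero_smul, add_zero]
  · have hne' : wtZ P μ T i - wtZ P μ T j ≠ 0 := sub_ne_zero.mpr hne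
    have hzz : ∀ u ∈ weightSpace P lam α,
        (z P i - z P j) • u = (wtZ P μ T i - wtZ P μ T j) • u := fun u hu => by
      rw [sub_smul, hz i u hu, hz j u hu, sub_smul]
    refine Or.inl ⟨⟨fun u hu => ?_, fun u hu w hw e => ?_, fun u hu => ?_⟩, ?_⟩
    · simp only
      rw [hzz u hu]
      exact hsmul _ u hu
    · simp only at e
      rw [hzz u hu, hzz w hw] at e
      exact smul_right_injective _ hne' e
    · refine ⟨(wtZ P μ T i - wtZ P μ T j)⁻¹ • u, hsmul _ u hu, ?_⟩
      simp only
      rw [hzz _ (hsmul _ u hu), smul_smul, mul_inv_cancel₀ hne', one_smul]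
    · refine ⟨((if wtD μ T i = wtD μ T j then (r : F) else 0)
        / (wtZ P μ T i - wtZ P μ T j)) • f μ T, hsmul _ _ hmem, ?_, ?_⟩
      · rw [hzz _ (hsmul _ _ hmem), hpi _ hmem, smul_smul, mul_div_cancel₀ _ hne']
      · rw [sigmaScalar, smul_smul, mul_div_assoc]

theorem rootWt_eq_iff {T : SYT lam} {i j : Fin n} {a b : ℕ} :
    rootWt T i a = rootWt T j b ↔ ((a : ℤ) - (b : ℤ) ≡
      ((beta (T.1 i) : ℕ) : ℤ) - ((beta (T.1 j) : ℕ) : ℤ) [ZMOD (r : ℤ)]) := by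
  rw [rootWt, rootWt, zetaRoot_zpow_eq_iff, ← ZMod.intCast_eq_intCast_iff]
  push_cast
  constructor
  · intro h; linear_combination -h
  · intro h; linear_combination -h

theorem rootWt_eq_iff_beta {T : SYT lam} {i j : Fin n} {a : ℕ} :
    rootWt T i a = rootWt T j a ↔ beta (T.1 i) = beta (T.1 j) :=
  ⟨beta_eq_of_rootWt_eq, fun h => by rw [rootWt, rootWt, h]⟩

/-! ### The action of `σ_i` on the eigenbasis -/

theorem sigmaScalar_comp_swap (a : Fin n → F) (η : Fin n → rootsOfUnity r ℂ) (i j : Fin n) :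
    sigmaScalar P (a ∘ Equiv.swap i j) (η ∘ Equiv.swap i j) i j = - sigmaScalar P a η i j := by
  simp only [sigmaScalar, Function.comp_apply, Equiv.swap_apply_left, Equiv.swap_apply_right,
    eq_comm (a := η j)]
  rw [← neg_sub (a i), div_neg]

include hf hP in
theorem sigma_f_of_lt {μ : Fin n → ℕ} {T : SYT lam} {i j : Fin n} (hij : i.1 + 1 = j.1)
    (h : μ i < μ j) :
    t P (permG r (Equiv.swap i j)) • f μ T
      + sigmaScalar P (wtZ P μ T) (wtD μ T) i j • f μ T = f (μ ∘ Equiv.swap i j) T :=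
  ((hf μ T).sigma hP hij h).eq_f hf hP

theorem comp_swap_swap (μ : Fin n → ℕ) (i j : Fin n) :
    (μ ∘ Equiv.swap i j) ∘ Equiv.swap i j = μ := by
  funext k
  simp

include hf hP in
-- The exchanged composition is ascending, so `f_{μ,T}` is its image under `σ_i`; applying `σ_i`
-- once more gives the square.
theorem sigma_f_of_gt {μ : Fin n → ℕ} {T : SYT lam} {i j : Fin n} (hij : i.1 + 1 = j.1)
    (h : μ j < μ i) :
    t P (permG r (Equiv.swap i j)) • f μ T
      + sigmaScalar P (wtZ P μ T) (wtD μ T) i j • f μ T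
      = (1 - sigmaScalar P (wtZ P μ T) (wtD μ T) i j ^ 2) • f (μ ∘ Equiv.swap i j) T := by
  have h1 := sigma_f_of_lt hf hP (T := T) hij (μ := μ ∘ Equiv.swap i j) (by simpa using h)
  rw [wtZ_comp_swap hij h.ne', wtD_comp_swap hij h.ne', sigmaScalar_comp_swap,
    comp_swap_swap] at h1
  have h2 := sigma_sq (m := f (μ ∘ Equiv.swap i j) T) i j
    (-sigmaScalar P (wtZ P μ T) (wtD μ T) i j)
  rw [h1, neg_sq] at h2
  rw [← h2, neg_smul, sub_neg_eq_add]

/-- For equal entries in the same component the `κ`- and `d`-parts cancel and `c₀` divides out,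
leaving the coefficient of Young's form. The two boxes appear in reverse order because `w_μ`
reverses ties. -/
theorem sigmaScalar_tie (hc : P.c₀ ≠ 0) {μ : Fin n → ℕ} {T : SYT lam} {i j : Fin n}
    (h : μ i = μ j) :
    sigmaScalar P (wtZ P μ T) (wtD μ T) i j
      = ((r : F) * ((ct (T.1 (wPerm μ j)) : ℤ) : F) - (r : F) * ((ct (T.1 (wPerm μ i)) : ℤ) : F))⁻¹
        * (if rootWt T (wPerm μ j) 0 = rootWt T (wPerm μ i) 0 then (r : F) else 0) := by
  rw [sigmaScalar, wtD, wtD, h]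
  simp only [rootWt_eq_iff_beta, eq_comm (a := beta (T.1 (wPerm μ j)))]
  split_ifs with hb
  · have e : wtZ P μ T i - wtZ P μ T j
        = P.c₀ * ((r : F) * ((ct (T.1 (wPerm μ j)) : ℤ) : F)
          - (r : F) * ((ct (T.1 (wPerm μ i)) : ℤ) : F)) := by
      rw [wtZ, wtZ, h, hb]
      ring
    rw [e, mul_div_mul_left _ _ hc, div_eq_inv_mul]
  · simp

include hf in
-- A transposition of equal entries passes through `w_μ⁻¹` as the transposition of their ranks, so
-- it acts on `v_T` and leaves the monomial alone; lower terms stay lower by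
-- `AffLT.comp_swap_of_eq`.
theorem sigma_tie_sub_mem {μ : Fin n → ℕ} {T : SYT lam} {i j : Fin n} (hij : i.1 + 1 = j.1)
    (h : μ i = μ j) (e : F) :
    t P (permG r (Equiv.swap i j)) • f μ T + e • f μ T
      - xpow P μ • t P (permG r (wPerm μ)⁻¹) •
        (t P (permG r (Equiv.swap (wPerm μ j) (wPerm μ i))) • v P T + e • v P T)
      ∈ compLower P lam μ := by
  have hμ : μ ∘ Equiv.swap i j = μ := by
    funext k
    rw [Function.comp_apply, Equiv.swap_apply_def]
    split_ifs with h1 h2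
    · rw [h1, h]
    · rw [h2, h]
    · rfl
  have hw : Equiv.swap i j * (wPerm μ)⁻¹
      = (wPerm μ)⁻¹ * Equiv.swap (wPerm μ j) (wPerm μ i) := by
    rw [Equiv.swap_comm (wPerm μ j), Equiv.swap_apply_apply]
    group
  have e1 : xpow P μ • t P (permG r (wPerm μ)⁻¹) •
        (t P (permG r (Equiv.swap (wPerm μ j) (wPerm μ i))) • v P T + e • v P T)
      = t P (permG r (Equiv.swap i j)) • xv P μ T + e • xv P μ T := by
    rw [t_swap_smul_xv, hμ, hw, permG_mul, t_mul, mul_smul, smul_add, smul_add,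
      smul_comm (t P _) e, smul_comm (xpow P μ) e]
    rfl
  have e2 : t P (permG r (Equiv.swap i j)) • f μ T + e • f μ T
        - (t P (permG r (Equiv.swap i j)) • xv P μ T + e • xv P μ T)
      = t P (permG r (Equiv.swap i j)) • (f μ T - xv P μ T) + e • (f μ T - xv P μ T) := by
    rw [smul_sub, smul_sub]
    abel
  rw [e1, e2]
  have h1 := (hf μ T).sub_mem
  exact affLower_le_compLower μ (add_mem
    (t_swap_smul_mem_affLower (fun κ hκ => hκ.comp_swap_of_eq hij h) h1)
    (Submodule.smul_mem _ _ h1))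

/-- Equal entries receive consecutive ranks, and consecutive entries of a standard tableau never lie
on the same diagonal of the same component. -/
theorem tie_ne (hP : Generic P) {μ : Fin n → ℕ} (T : SYT lam) {i j : Fin n} (hij : i.1 + 1 = j.1)
    (h : μ i = μ j) : wtZ P μ T i ≠ wtZ P μ T j ∨ wtD μ T i ≠ wtD μ T j := by
  have htie := wPerm_tie hij h
  by_contra! hcon
  obtain ⟨h1, h2⟩ := hcon
  rw [wtD, wtD, h, rootWt_eq_iff_beta] at h2
  exact ct_ne T.2 (i := wPerm μ j) (j := wPerm μ i) (by rw [Fin.lt_def]; omega) (by omega) h2.symm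
    (wtZ_eq hP h1).2.symm

include hf hP in
-- Young's form kills the leading term. What is left is a weight vector of lower terms, whose weight
-- still determines `μ` because the two exchanged entries are equal.
theorem sigma_f_tie_of_not {μ : Fin n → ℕ} {T : SYT lam} {i j : Fin n} (hij : i.1 + 1 = j.1)
    (h : μ i = μ j) (hns : ¬ IsStandard (swapT (wPerm μ j) (wPerm μ i) T)) :
    t P (permG r (Equiv.swap i j)) • f μ T
      + sigmaScalar P (wtZ P μ T) (wtD μ T) i j • f μ T = 0 := by
  have htie := wPerm_tie hij h
  have h1 := tau_smul_v_of_not P htie T hns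
  rw [add_smul, smul_assoc, piH_smul_v, smul_smul, ← sigmaScalar_tie hP.c₀_ne_zero h] at h1
  have h2 := sigma_tie_sub_mem hf hij (T := T) h (sigmaScalar P (wtZ P μ T) (wtD μ T) i j)
  rw [h1, smul_zero, smul_zero, sub_zero] at h2
  refine eq_zero_of_mem_compLower hf hP h2 ((hf μ T).hasWt.sigma hij (tie_ne hP T hij h)).1 ?_
  intro ν S e
  funext k
  have h3 := (wtZ_eq hP (congrFun e k)).1
  rw [← h3, Equiv.swap_apply_def]
  split_ifs with h4 h5
  · rw [h4, h]
  · rw [h5, h]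
  · rfl

theorem wtZ_swapT {μ : Fin n → ℕ} {T : SYT lam} {i j : Fin n} (h : μ i = μ j)
    (hs : IsStandard (swapT (wPerm μ j) (wPerm μ i) T)) :
    wtZ P μ ⟨swapT (wPerm μ j) (wPerm μ i) T, hs⟩ = wtZ P μ T ∘ Equiv.swap i j := by
  funext k
  have h1 : swapT (wPerm μ j) (wPerm μ i) T (wPerm μ k) = T.1 (wPerm μ (Equiv.swap i j k)) := by
    rw [swapT, Equiv.trans_apply, Equiv.swap_comm]
    congr 1
    rw [Equiv.swap_apply_apply]
    simp
  have h2 : μ (Equiv.swap i j k) = μ k := by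
    rw [Equiv.swap_apply_def]
    split_ifs with h1 h2
    · rw [h1, h]
    · rw [h2, h]
    · rfl
  simp only [wtZ, Function.comp_apply, h1, h2]

include hf hP in
-- Both sides have the same leading term by Young's form and the same weight, so their difference is
-- zero by `eq_zero_of_mem_compLower`.
theorem sigma_f_tie {μ : Fin n → ℕ} {T : SYT lam} {i j : Fin n} (hij : i.1 + 1 = j.1)
    (h : μ i = μ j) (hs : IsStandard (swapT (wPerm μ j) (wPerm μ i) T)) :
    t P (permG r (Equiv.swap i j)) • f μ T
      + sigmaScalar P (wtZ P μ T) (wtD μ T) i j • f μ T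
      = algebraMap ℂ F (youngCoef (wPerm μ j) (wPerm μ i) T)
        • f μ ⟨swapT (wPerm μ j) (wPerm μ i) T, hs⟩ := by
  have htie := wPerm_tie hij h
  have h1 := tau_smul_v P htie T hs
  rw [add_smul, smul_assoc, piH_smul_v, smul_smul, ← sigmaScalar_tie hP.c₀_ne_zero h] at h1
  have h2 := sigma_tie_sub_mem hf hij (T := T) h (sigmaScalar P (wtZ P μ T) (wtD μ T) i j)
  set T' : SYT lam := ⟨swapT (wPerm μ j) (wPerm μ i) T, hs⟩ with hT'
  rw [h1, smul_comm (t P _) (algebraMap ℂ F _), smul_comm (xpow P μ)] at h2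
  change _ - _ • xv P μ T' ∈ _ at h2
  rw [← sub_eq_zero]
  refine eq_zero_of_mem_compLower hf hP (μ := μ) (a := wtZ P μ T ∘ Equiv.swap i j) ?_
    (fun k => ?_) ?_
  · have h3 := (compLower P lam μ).smul_mem
      (algebraMap ℂ F (youngCoef (wPerm μ j) (wPerm μ i) T))
      (affLower_le_compLower μ (hf μ T').sub_mem)
    have h4 := sub_mem h2 h3
    rw [smul_sub] at h4
    convert h4 using 1
    abel
  · rw [smul_sub, ((hf μ T).hasWt.sigma hij (tie_ne hP T hij h)).1 k,
      smul_comm (z P k), (hf μ T').hasWt.1 k, hT', wtZ_swapT h hs, smul_sub,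
      smul_comm (algebraMap ℂ F _)]
  · intro ν S e
    funext k
    have h3 := (wtZ_eq hP (congrFun e k)).1
    rw [← h3, Equiv.swap_apply_def]
    split_ifs with h4 h5
    · rw [h4, h]
    · rw [h5, h]
    · rfl

theorem seminormal_comm (k j : Fin n) (T : SYT lam) : seminormal k j T = seminormal j k T := by
  rw [seminormal, seminormal, ← neg_sub (ct (T.1 j)), Int.cast_neg, div_neg, neg_sq]

/-! ### The action of `Φ` and `Ψ` on the eigenbasis -/

variable [NeZero n]

include hf hP in
theorem Phi_f (μ : Fin n → ℕ) (T : SYT lam) : Phi P n • f μ T = f (phiC μ) T :=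
  ((hf μ T).phi hP).eq_f hf hP

include hf hP in
-- `Φ` maps the eigenbasis injectively into itself, since `φ` is injective on compositions.
theorem Phi_injective {m : M P lam} (h : Phi P n • m = 0) : m = 0 := by
  refine eq_zero_of_coord hf hP fun p => ?_
  have h1 : (eigenBasis hf hP).coord (phiC p.1, p.2)
      ∘ₗ DistribSMul.toLinearMap F (M P lam) (Phi P n) = (eigenBasis hf hP).coord p := by
    refine (eigenBasis hf hP).ext fun q => ?_
    rw [LinearMap.comp_apply, DistribSMul.toLinearMap_apply, eigenBasis_apply,
      Phi_f hf hP, ← eigenBasis_apply hf hP (phiC q.1, q.2), ← eigenBasis_apply hf hP q, Module.Basis.coord_apply,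
      Module.Basis.coord_apply, Module.Basis.repr_self, Module.Basis.repr_self]
    classical
    simp only [Finsupp.single_apply, Prod.mk.injEq, phiC_injective.eq_iff]
    congr 1
    rw [Prod.ext_iff]
  rw [← h1, LinearMap.comp_apply, DistribSMul.toLinearMap_apply, h, map_zero]

include hf hP in
theorem Psi_f_of_pos {μ : Fin n → ℕ} (T : SYT lam) (h : 0 < μ (lastIdx n)) :
    Psi P n • f μ T = wtZ P (psiC μ) T 0 • f (psiC μ) T := by
  have h1 := Phi_f hf hP (psiC μ) T
  rw [phiC_psiC h] at h1
  rw [← h1, ← mul_smul, Psi_mul_Phi, (hf (psiC μ) T).hasWt.1]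

include hf hP in
-- By injectivity of `Φ` it is enough that `ΦΨ = z_n - κ + ∑ (d_j - d_{j-1}) e_{nj}` vanishes. A
-- zero in last place has the least rank, so its box is the first one and has content 0, and the
-- remaining terms cancel.
theorem Psi_f_of_zero {μ : Fin n → ℕ} (T : SYT lam) (h : μ (lastIdx n) = 0) :
    Psi P n • f μ T = 0 := by
  refine Phi_injective hf hP ?_
  have h1 := dSum_smul P ((hf μ T).hasWt.2 (lastIdx n))
  rw [← mul_smul, Phi_mul_Psi, add_smul, sub_smul, (hf μ T).hasWt.1, algebraMap_smul_M, h1, wtZ,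
    ct_first T.2 (wPerm_last h), h]
  simp only [Nat.cast_zero, Int.cast_zero, Int.cast_natCast, sub_zero, zero_add]
  module

theorem wtZ_psiC {μ : Fin n → ℕ} (T : SYT lam) (h : 0 < μ (lastIdx n)) :
    wtZ P (psiC μ) T 0 = P.κ * (μ (lastIdx n) : F)
      - (P.d ((beta (T.1 (wPerm μ (lastIdx n))) : ℕ) : ZMod r)
        - P.d (((beta (T.1 (wPerm μ (lastIdx n))) : ℕ) : ZMod r) - (μ (lastIdx n) : ZMod r)))
      - r * ((ct (T.1 (wPerm μ (lastIdx n))) : ℤ) : F) * P.c₀ := by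
  have hw : wPerm μ (lastIdx n) = wPerm (psiC μ) 0 := by
    conv_lhs => rw [← phiC_psiC h, wPerm_phiC]
    rw [Equiv.Perm.mul_apply, show (rot n)⁻¹ (lastIdx n) = 0 by rw [← rot_zero]; simp]
  have h0 : psiC μ 0 + 1 = μ (lastIdx n) := by
    rw [← phiC_last, phiC_psiC h]
  rw [wtZ, ← hw, ← h0]
  push_cast
  ring

end Eigenbasis

end

end Cherednik

namespace Cherednik

noncomputable section

/-! ### The induced module on `F[x_1, …, x_n] ⊗ V` -/

section Abstract

set_option linter.unusedSectionVars false

open scoped IsMulCommutative in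
/-- Commuting elements define a homomorphism from the polynomial ring. -/
theorem exists_polynomial_hom {F σ A : Type*} [Field F] [Ring A] [Algebra F A] (a : σ → A)
    (h : ∀ i j, a i * a j = a j * a i) :
    ∃ φ : MvPolynomial σ F →ₐ[F] A, ∀ i, φ (MvPolynomial.X i) = a i := by
  have hc := Algebra.isMulCommutative_adjoin F (s := Set.range a) (by
    rintro _ ⟨i, rfl⟩ _ ⟨j, rfl⟩
    exact h i j)
  refine ⟨(Algebra.adjoin F (Set.range a)).val.comp
    (MvPolynomial.aeval (S₁ := Algebra.adjoin F (Set.range a)) fun i => ⟨a i, Algebra.subset_adjoin ⟨i, rfl⟩⟩), fun i => ?_⟩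
  rw [AlgHom.comp_apply, MvPolynomial.aeval_X]
  rfl

/-- A derivation twisted by `φ` is the second component of an algebra map `φ + ε δ` to the dual
numbers over `A`. Such a map from a polynomial ring exists as soon as the images of the variables
commute, which is the hypothesis on `b`. -/
theorem exists_twisted_derivation {F σ A : Type*} [Field F] [Ring A] [Algebra F A]
    (φ : MvPolynomial σ F →ₐ[F] A) (b : σ → A)
    (h : ∀ k l, b k * φ (MvPolynomial.X l) + φ (MvPolynomial.X k) * b l
      = b l * φ (MvPolynomial.X k) + φ (MvPolynomial.X l) * b k) :
    ∃ δ : MvPolynomial σ F →ₗ[F] A, δ 1 = 0 ∧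
      ∀ k p, δ (MvPolynomial.X k * p) = b k * φ p + φ (MvPolynomial.X k) * δ p := by
  obtain ⟨Φ, hΦ⟩ := exists_polynomial_hom (F := F) (A := TrivSqZeroExt A A)
    (fun k => TrivSqZeroExt.inl (φ (MvPolynomial.X k)) + TrivSqZeroExt.inr (b k)) (fun k l => by
      ext
      · simp only [TrivSqZeroExt.fst_mul, TrivSqZeroExt.fst_add, TrivSqZeroExt.fst_inl,
          TrivSqZeroExt.fst_inr, add_zero]
        rw [← map_mul, ← map_mul, mul_comm]
      · simp only [TrivSqZeroExt.snd_mul, TrivSqZeroExt.fst_add, TrivSqZeroExt.fst_inl,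
          TrivSqZeroExt.fst_inr, TrivSqZeroExt.snd_add, TrivSqZeroExt.snd_inl,
          TrivSqZeroExt.snd_inr, add_zero, zero_add, smul_eq_mul, MulOpposite.smul_eq_mul_unop,
          MulOpposite.unop_op]
        rw [add_comm, h, add_comm])
  have hfst : ∀ p, (Φ p).fst = φ p := fun p => by
    have : (TrivSqZeroExt.fstHom F A A).comp Φ = φ := MvPolynomial.algHom_ext fun k => by
      rw [AlgHom.comp_apply, hΦ]
      simp
    exact AlgHom.congr_fun this p
  refine ⟨(TrivSqZeroExt.sndHom A A).restrictScalars F ∘ₗ Φ.toLinearMap, ?_, fun k p => ?_⟩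
  · simp
  · simp [hΦ, hfst, add_comm]

variable {F : Type} [Field F] [Algebra ℂ F] {r n : ℕ} [NeZero r] (P : Params F r)
  {A : Type*} [Ring A] [Algebra F A] (T : G r n →* A)

/-- `∑_j (d_j - d_{j-1}) e_{ij}` in a representation of `G(r,1,n)`. -/
def repDSum (i : Fin n) : A :=
  ∑ j ∈ Finset.range r, (P.d (j : ZMod r) - P.d ((j : ZMod r) - 1)) •
    (r : F)⁻¹ • ∑ l ∈ Finset.range r, algebraMap ℂ F ((zeta r ^ (l * j))⁻¹) • T (diagG r i ^ l)

/-- The commutator of `y_i` and `x_k` in a representation of `G(r,1,n)`. -/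
def repComm (i k : Fin n) : A :=
  if i = k then algebraMap F A P.κ - repDSum P T i
    - P.c₀ • ∑ j ∈ Finset.univ.erase i, ∑ η, T (reflRoot i j η)
  else P.c₀ • ∑ η, rootF F η⁻¹ • T (reflRoot i k η)

theorem T_mul_repDSum (w : Equiv.Perm (Fin n)) (e : Fin n → rootsOfUnity r ℂ) (i : Fin n) :
    T (monG w e) * repDSum P T i = repDSum P T (w i) * T (monG w e) := by
  simp only [repDSum, Finset.mul_sum, Finset.sum_mul, mul_smul_comm, smul_mul_assoc, ← map_mul,
    diagG_pow, monG_mul_diagRoot]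

/-- The commutator transforms under the group as `y_i x_k` does. -/
theorem T_mul_repComm (w : Equiv.Perm (Fin n)) (e : Fin n → rootsOfUnity r ℂ) (i k : Fin n) :
    T (monG w e) * repComm P T i k
      = (rootF F (e i) * rootF F (e k)⁻¹) • (repComm P T (w i) (w k) * T (monG w e)) := by
  by_cases h : i = k
  · subst h
    have h1 : ∑ j ∈ Finset.univ.erase i, ∑ η, T (monG w e) * T (reflRoot i j η)
        = ∑ j ∈ Finset.univ.erase (w i), ∑ η, T (reflRoot (w i) j η) * T (monG w e) := by
      refine Finset.sum_equiv w (by simp) fun j hj => ?_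
      symm
      rw [← Equiv.sum_comp (Equiv.mulRight (e i * (e j)⁻¹))]
      refine Finset.sum_congr rfl fun η _ => ?_
      rw [← map_mul, ← map_mul, monG_mul_reflRoot w e i j (Finset.ne_of_mem_erase hj).symm]
      rfl
    rw [repComm, repComm, if_pos rfl, if_pos rfl, mul_comm (rootF F _), rootF_inv_mul, one_smul,
      mul_sub, mul_sub, sub_mul, sub_mul, T_mul_repDSum, ← Algebra.commutes, mul_smul_comm,
      smul_mul_assoc]
    simp only [Finset.mul_sum, Finset.sum_mul, h1]
  · rw [repComm, repComm, if_neg h, if_neg fun h' => h (w.injective h'), mul_smul_comm,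
      smul_mul_assoc, smul_comm _ P.c₀]
    simp only [Finset.mul_sum, Finset.sum_mul, Finset.smul_sum]
    symm
    rw [← Equiv.sum_comp (Equiv.mulRight (e i * (e k)⁻¹))]
    refine Finset.sum_congr rfl fun η _ => ?_
    rw [mul_smul_comm, smul_mul_assoc, ← map_mul, ← map_mul, monG_mul_reflRoot w e i k h,
      Equiv.coe_mulRight, smul_smul (_ * _)]
    congr 2
    rw [← rootF_mul, ← rootF_mul]
    congr 1
    rw [mul_inv, mul_inv, inv_inv]
    calc _ = (e i * (e i)⁻¹) * ((e k)⁻¹ * e k) * η⁻¹ := by ac_rfl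
      _ = _ := by simp

/-- The commutator with `z`. -/
def adR (z : A) : A →ₗ[F] A := LinearMap.mulRight F z - LinearMap.mulLeft F z

theorem adR_apply (z a : A) : adR (F := F) z a = a * z - z * a := rfl

variable {c : rootsOfUnity r ℂ →* F} {Z : Fin n → A}
  (hZ : ∀ w e k, T (monG w e) * Z k = c (e k) • (Z (w k) * T (monG w e)))

include hZ in
-- The family `Z` transforms by a character `c` of the entries: `c` is inversion for the `x_k` and
-- the identity for the `y_k`, so both cases are treated at once.
theorem T_refl_mul_left (i j : Fin n) (η : rootsOfUnity r ℂ) :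
    T (reflRoot i j η) * Z i = c η⁻¹ • (Z j * T (reflRoot i j η)) := by
  rw [reflRoot, hZ]; simp

include hZ in
theorem T_refl_mul_right (i j : Fin n) (h : i ≠ j) (η : rootsOfUnity r ℂ) :
    T (reflRoot i j η) * Z j = c η • (Z i * T (reflRoot i j η)) := by
  rw [reflRoot, hZ]; simp [h.symm]

include hZ in
theorem T_refl_mul_of_ne (i j k : Fin n) (hi : k ≠ i) (hj : k ≠ j) (η : rootsOfUnity r ℂ) :
    T (reflRoot i j η) * Z k = Z k * T (reflRoot i j η) := by
  rw [reflRoot, hZ, Equiv.swap_apply_of_ne_of_ne hi hj]; simp [hi, hj]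

include hZ in
theorem adR_repComm_of_ne {i k l : Fin n} (h : i ≠ k) (hi : l ≠ i) (hk : l ≠ k) :
    adR (F := F) (Z l) (repComm P T i k) = 0 := by
  rw [repComm, if_neg h, map_smul, map_sum, Finset.sum_eq_zero, smul_zero]
  intro η _
  rw [map_smul, adR_apply, T_refl_mul_of_ne T hZ i k l hi hk, sub_self, smul_zero]

include hZ in
theorem adR_repComm_left {i l : Fin n} (h : i ≠ l) :
    adR (F := F) (Z i) (repComm P T i l) = P.c₀ • ∑ η, rootF F η⁻¹ •
      (c η⁻¹ • (Z l * T (reflRoot i l η)) - Z i * T (reflRoot i l η)) := by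
  rw [repComm, if_neg h, map_smul, map_sum]
  congr 1
  refine Finset.sum_congr rfl fun η _ => ?_
  rw [map_smul, adR_apply, T_refl_mul_left T hZ]

include hZ in
theorem adR_repComm_right {i l : Fin n} (h : i ≠ l) :
    adR (F := F) (Z l) (repComm P T i l) = P.c₀ • ∑ η, rootF F η⁻¹ •
      (c η • (Z i * T (reflRoot i l η)) - Z l * T (reflRoot i l η)) := by
  rw [repComm, if_neg h, map_smul, map_sum]
  congr 1
  refine Finset.sum_congr rfl fun η _ => ?_
  rw [map_smul, adR_apply, T_refl_mul_right T hZ i l h]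

include hZ in
theorem adR_repDSum {i l : Fin n} (h : l ≠ i) : adR (F := F) (Z l) (repDSum P T i) = 0 := by
  rw [repDSum, map_sum]
  refine Finset.sum_eq_zero fun j _ => ?_
  rw [map_smul, map_smul, map_sum, Finset.sum_eq_zero, smul_zero, smul_zero]
  intro k _
  rw [map_smul, adR_apply, diagG_pow, diagRoot, hZ]
  simp [h]

include hZ in
theorem adR_repComm_self {i l : Fin n} (h : i ≠ l) :
    adR (F := F) (Z l) (repComm P T i i) = P.c₀ • ∑ η,
      (Z l * T (reflRoot i l η) - c η • (Z i * T (reflRoot i l η))) := by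
  have h1 : adR (F := F) (Z l) (algebraMap F A P.κ) = 0 := by
    rw [adR_apply, Algebra.commutes, sub_self]
  rw [repComm, if_pos rfl, map_sub, map_sub, h1, adR_repDSum P T hZ h.symm, map_smul, map_sum,
    ← Finset.add_sum_erase _ _ (Finset.mem_erase.mpr ⟨h.symm, Finset.mem_univ l⟩),
    Finset.sum_eq_zero (s := (Finset.univ.erase i).erase l), add_zero, sub_zero, zero_sub,
    ← smul_neg, map_sum, ← Finset.sum_neg_distrib]
  · congr 1
    refine Finset.sum_congr rfl fun η _ => ?_
    rw [adR_apply, T_refl_mul_right T hZ i l h, neg_sub]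
  · intro k hk
    rw [map_sum]
    refine Finset.sum_eq_zero fun η _ => ?_
    rw [adR_apply, T_refl_mul_of_ne T hZ i k l h.symm (Finset.ne_of_mem_erase hk).symm, sub_self]

/-- `rootF` as a character, and its inverse. -/
def rootChar : rootsOfUnity r ℂ →* F where
  toFun := rootF F
  map_one' := rootF_one
  map_mul' := rootF_mul

theorem rootF_mul_inv (a : rootsOfUnity r ℂ) : rootF F a * rootF F a⁻¹ = 1 := by
  rw [mul_comm, rootF_inv_mul]

/-- This is the Jacobi identity for `y_i, x_k, x_l` with commuting `x`'s: the compatibility that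
lets `y_i` act on polynomials. With three distinct indices both sides vanish; otherwise the
reflection terms match. -/
theorem repComm_x {X : Fin n → A}
    (hX : ∀ w e k, T (monG w e) * X k = rootF F (e k)⁻¹ • (X (w k) * T (monG w e)))
    (i k l : Fin n) : adR (F := F) (X l) (repComm P T i k) = adR (F := F) (X k) (repComm P T i l) := by
  have hZ : ∀ w e k, T (monG w e) * X k
      = (rootChar.comp (invMonoidHom : rootsOfUnity r ℂ →* _) : _ →* F) (e k)
        • (X (w k) * T (monG w e)) := hX
  have hc : ∀ η, (rootChar.comp (invMonoidHom : rootsOfUnity r ℂ →* _) : _ →* F) η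
      = rootF F η⁻¹ := fun _ => rfl
  have key : ∀ l, i ≠ l →
      adR (F := F) (X l) (repComm P T i i) = adR (F := F) (X i) (repComm P T i l) := fun l h => by
    rw [adR_repComm_self P T hZ h, adR_repComm_left P T hZ h]
    congr 1
    refine Finset.sum_congr rfl fun η _ => ?_
    rw [hc, hc, smul_sub, smul_smul, inv_inv, rootF_inv_mul, one_smul]
  rcases eq_or_ne k l with rfl | hkl
  · rfl
  rcases eq_or_ne i k with rfl | hik
  · exact key l hkl
  rcases eq_or_ne i l with rfl | hil
  · exact (key k hik).symm
  rw [adR_repComm_of_ne P T hZ hik hil.symm hkl.symm, adR_repComm_of_ne P T hZ hil hik.symm hkl]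

/-- This is the Jacobi identity for `y_i, y_j, x_k`; it makes the Dunkl–Opdam operators commute. -/
theorem repComm_y {Y : Fin n → A}
    (hY : ∀ w e k, T (monG w e) * Y k = rootF F (e k) • (Y (w k) * T (monG w e)))
    (i j k : Fin n) : adR (F := F) (Y i) (repComm P T j k) = adR (F := F) (Y j) (repComm P T i k) := by
  have hZ : ∀ w e k, T (monG w e) * Y k
      = (rootChar : _ →* F) (e k) • (Y (w k) * T (monG w e)) := hY
  have hc : ∀ η : rootsOfUnity r ℂ, (rootChar : _ →* F) η = rootF F η := fun _ => rfl
  have key : ∀ i j, i ≠ j →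
      adR (F := F) (Y i) (repComm P T j i) = adR (F := F) (Y j) (repComm P T i i) := fun i j h => by
    rw [adR_repComm_self P T hZ h, adR_repComm_right P T hZ h.symm,
      ← Equiv.sum_comp (Equiv.inv (rootsOfUnity r ℂ))]
    congr 1
    refine Finset.sum_congr rfl fun η _ => ?_
    rw [Equiv.inv_apply, ← reflRoot_comm i j h, hc, hc, smul_sub, smul_smul, inv_inv,
      rootF_mul_inv, one_smul]
  rcases eq_or_ne i j with rfl | hij
  · rfl
  rcases eq_or_ne k i with rfl | hki
  · exact key k j hij
  rcases eq_or_ne k j with rfl | hkj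
  · exact (key k i hij.symm).symm
  rw [adR_repComm_of_ne P T hZ hkj.symm hij hki.symm,
    adR_repComm_of_ne P T hZ hki.symm hij.symm hkj.symm]

end Abstract

end

end Cherednik

namespace Cherednik

noncomputable section

/-! ### Dunkl–Opdam operators and the action of `ℍ` on `F[x] ⊗ V` -/

section Induced

set_option linter.unusedSectionVars false

open scoped TensorProduct

variable {F : Type} [Field F] [Algebra ℂ F] {r n : ℕ} [NeZero r] (P : Params F r)
  {V : Type} [AddCommGroup V] [Module F V] (ρ : G r n →* Module.End F V)

variable (F n V) in
/-- The space `F[x_1, …, x_n] ⊗ V`. -/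
def Ind : Type := MvPolynomial (Fin n) F ⊗[F] V

instance : AddCommGroup (Ind F n V) :=
  inferInstanceAs (AddCommGroup (MvPolynomial (Fin n) F ⊗[F] V))

instance : Module F (Ind F n V) := inferInstanceAs (Module F (MvPolynomial (Fin n) F ⊗[F] V))

variable (F n V) in
/-- The element `p ⊗ u`. -/
def indMk : MvPolynomial (Fin n) F →ₗ[F] V →ₗ[F] Ind F n V :=
  TensorProduct.mk F (MvPolynomial (Fin n) F) V

theorem ind_hom_ext {W : Type*} [AddCommGroup W] [Module F W] {f g : Ind F n V →ₗ[F] W}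
    (h : ∀ p u, f (indMk F n V p u) = g (indMk F n V p u)) : f = g :=
  TensorProduct.ext' h

/-- The linear map induced by a bilinear map. -/
def indLift {W : Type*} [AddCommGroup W] [Module F W]
    (b : MvPolynomial (Fin n) F →ₗ[F] V →ₗ[F] W) : Ind F n V →ₗ[F] W :=
  TensorProduct.lift b

theorem indLift_mk {W : Type*} [AddCommGroup W] [Module F W]
    (b : MvPolynomial (Fin n) F →ₗ[F] V →ₗ[F] W) (p : MvPolynomial (Fin n) F) (u : V) :
    indLift b (indMk F n V p u) = b p u :=
  TensorProduct.lift.tmul p u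

/-- Evaluation of polynomials at 0 retracts onto `V`. -/
theorem indMk_one_injective {u : V} (h : indMk F n V 1 u = 0) : u = 0 := by
  have h1 := congrArg (indLift (LinearMap.lsmul F V ∘ₗ
    (MvPolynomial.aeval (R := F) (fun _ : Fin n => (0 : F))).toLinearMap)) h
  rw [indLift_mk] at h1
  simpa using h1

variable (F n V) in
/-- Multiplication by a polynomial. -/
def indMul : MvPolynomial (Fin n) F →ₐ[F] Module.End F (Ind F n V) :=
  AlgHom.ofLinearMap
    { toFun := fun p => indLift (indMk F n V ∘ₗ LinearMap.mulLeft F p)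
      map_add' := fun p q => ind_hom_ext fun _ _ => by
        simp [indLift_mk, add_mul]
      map_smul' := fun c p => ind_hom_ext fun _ _ => by
        simp [indLift_mk] }
    (ind_hom_ext fun _ _ => by simp [indLift_mk])
    (fun p q => ind_hom_ext fun _ _ => by simp [indLift_mk])

theorem indMul_mk (p q : MvPolynomial (Fin n) F) (u : V) :
    indMul F n V p (indMk F n V q u) = indMk F n V (p * q) u :=
  indLift_mk _ _ _

variable (F V) in
/-- The action of `x_k`. -/
def indX (k : Fin n) : Module.End F (Ind F n V) := indMul F n V (MvPolynomial.X k)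

theorem indX_mk (k : Fin n) (q : MvPolynomial (Fin n) F) (u : V) :
    indX F V k (indMk F n V q u) = indMk F n V (MvPolynomial.X k * q) u :=
  indMul_mk _ _ _

variable (F) in
/-- The action of `G(r,1,n)` on polynomials. -/
def polyT (g : G r n) : MvPolynomial (Fin n) F →ₐ[F] MvPolynomial (Fin n) F :=
  MvPolynomial.aeval fun j =>
    ∑ i, algebraMap ℂ F ((g⁻¹ : G r n).1.1 j i) • MvPolynomial.X i

theorem polyT_monG (w : Equiv.Perm (Fin n)) (e : Fin n → rootsOfUnity r ℂ) (j : Fin n) :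
    polyT F (monG w e) (MvPolynomial.X j) = rootF F (e j)⁻¹ • MvPolynomial.X (w j) := by
  rw [polyT, MvPolynomial.aeval_X, monG_inv, Finset.sum_eq_single (w j)]
  · rw [monG_apply]
    simp [rootF]
  · intro b _ hb
    rw [monG_apply, if_neg, map_zero, zero_smul]
    rintro rfl
    simp at hb
  · simp

theorem polyT_one : polyT F (1 : G r n) = AlgHom.id F _ := by
  refine MvPolynomial.algHom_ext fun j => ?_
  rw [← monG_one, polyT_monG, inv_one, rootF_one, one_smul]
  rfl

theorem polyT_mul (g h : G r n) : polyT F (g * h) = (polyT F g).comp (polyT F h) := by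
  obtain ⟨w, e, rfl⟩ := exists_monG g
  obtain ⟨w', e', rfl⟩ := exists_monG h
  refine MvPolynomial.algHom_ext fun j => ?_
  rw [AlgHom.comp_apply, monG_mul, polyT_monG, polyT_monG, map_smul, polyT_monG, smul_smul,
    ← rootF_mul, mul_inv, mul_comm]
  rfl

/-- The action of `G(r,1,n)` on the induced module. -/
def indT : G r n →* Module.End F (Ind F n V) where
  toFun g := indLift ((indMk F n V).compl₁₂ (polyT F g).toLinearMap (ρ g))
  map_one' := by
    refine ind_hom_ext fun p u => ?_
    rw [indLift_mk, LinearMap.compl₁₂_apply, polyT_one, map_one, AlgHom.toLinearMap_apply,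
      AlgHom.id_apply, Module.End.one_apply, Module.End.one_apply]
  map_mul' g h := by
    refine ind_hom_ext fun p u => ?_
    simp only [Module.End.mul_apply, indLift_mk, LinearMap.compl₁₂_apply, polyT_mul, map_mul,
      AlgHom.toLinearMap_apply, AlgHom.comp_apply]

theorem indT_mk (g : G r n) (p : MvPolynomial (Fin n) F) (u : V) :
    indT ρ g (indMk F n V p u) = indMk F n V (polyT F g p) (ρ g u) := by
  change indLift _ _ = _
  rw [indLift_mk, LinearMap.compl₁₂_apply, AlgHom.toLinearMap_apply]

theorem indT_mul_indX (w : Equiv.Perm (Fin n)) (e : Fin n → rootsOfUnity r ℂ) (k : Fin n) :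
    indT ρ (monG w e) * indX F V k = rootF F (e k)⁻¹ • (indX F V (w k) * indT ρ (monG w e)) := by
  refine ind_hom_ext fun p u => ?_
  rw [LinearMap.smul_apply, Module.End.mul_apply, Module.End.mul_apply, indX_mk, indT_mk,
    indT_mk, indX_mk, map_mul, polyT_monG, smul_mul_assoc, map_smul,
    LinearMap.smul_apply]

/-- Induction on the degree: an operator killing degree zero and passing through each variable, up
to a change of the other factor, is zero. Relations among the `y_i` and `t_w` are verified by
applying this to the difference of the two sides. -/
theorem ind_ext {E : Module.End F (Ind F n V)} (h0 : ∀ u, E (indMk F n V 1 u) = 0)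
    (h : ∀ k, ∃ Y : Module.End F (Ind F n V), E * indX F V k = Y * E) : E = 0 := by
  refine ind_hom_ext fun p u => ?_
  induction p using MvPolynomial.induction_on with
  | C a =>
    rw [← mul_one (MvPolynomial.C a), ← MvPolynomial.smul_eq_C_mul, map_smul,
      LinearMap.smul_apply, map_smul, h0, smul_zero, LinearMap.zero_apply]
  | add p q hp hq => rw [map_add, LinearMap.add_apply, map_add, hp, hq, map_add]
  | mul_X p k hp =>
    obtain ⟨Y, hY⟩ := h k
    rw [mul_comm, ← indX_mk, ← Module.End.mul_apply, hY, Module.End.mul_apply, hp,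
      LinearMap.zero_apply, map_zero, LinearMap.zero_apply]

/-- Take the derivation twisted by multiplication with value the prescribed commutator on each
variable, and evaluate it on degree-zero vectors. -/
theorem exists_dunkl (i : Fin n) : ∃ D : Module.End F (Ind F n V), (∀ u, D (indMk F n V 1 u) = 0) ∧
    ∀ k, D * indX F V k = indX F V k * D + repComm P (indT ρ) i k := by
  obtain ⟨δ, h1, hX⟩ := exists_twisted_derivation (indMul F n V) (repComm P (indT ρ) i)
    (fun k l => by
      have := repComm_x P (indT ρ) (indT_mul_indX ρ) i k l
      rw [adR_apply, adR_apply, sub_eq_sub_iff_add_eq_add] at this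
      exact this)
  refine ⟨indLift ((LinearMap.llcomp F V (Ind F n V) (Ind F n V)).flip (indMk F n V 1) ∘ₗ δ),
    fun u => ?_, fun k => ?_⟩
  · rw [indLift_mk]
    simp [h1]
  · refine ind_hom_ext fun p u => ?_
    rw [LinearMap.add_apply, Module.End.mul_apply, Module.End.mul_apply, indX_mk, indLift_mk,
      indLift_mk]
    simp [hX, indMul_mk, indX, add_comm]

/-- The action of `y_i` on the induced module: a Dunkl–Opdam operator. -/
def indY (i : Fin n) : Module.End F (Ind F n V) := (exists_dunkl P ρ i).choose

theorem indY_one_mk (i : Fin n) (u : V) : indY P ρ i (indMk F n V 1 u) = 0 :=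
  (exists_dunkl P ρ i).choose_spec.1 u

theorem indY_mul_indX (i k : Fin n) :
    indY P ρ i * indX F V k = indX F V k * indY P ρ i + repComm P (indT ρ) i k :=
  (exists_dunkl P ρ i).choose_spec.2 k

theorem indT_mul_indY (w : Equiv.Perm (Fin n)) (e : Fin n → rootsOfUnity r ℂ) (j : Fin n) :
    indT ρ (monG w e) * indY P ρ j = rootF F (e j) • (indY P ρ (w j) * indT ρ (monG w e)) := by
  rw [← sub_eq_zero]
  refine ind_ext (fun u => ?_) fun k => ⟨rootF F (e k)⁻¹ • indX F V (w k), ?_⟩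
  · rw [LinearMap.sub_apply, LinearMap.smul_apply, Module.End.mul_apply, Module.End.mul_apply,
      indY_one_mk, indT_mk, map_one, indY_one_mk, map_zero, smul_zero, sub_zero]
  · have h1 : indT ρ (monG w e) * indY P ρ j * indX F V k
        = rootF F (e k)⁻¹ • (indX F V (w k) * (indT ρ (monG w e) * indY P ρ j))
          + (rootF F (e j) * rootF F (e k)⁻¹) •
            (repComm P (indT ρ) (w j) (w k) * indT ρ (monG w e)) := by
      rw [mul_assoc, indY_mul_indX, mul_add, T_mul_repComm, ← mul_assoc, indT_mul_indX,
        smul_mul_assoc, mul_assoc]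
    have h2 : indY P ρ (w j) * indT ρ (monG w e) * indX F V k
        = rootF F (e k)⁻¹ • (indX F V (w k) * (indY P ρ (w j) * indT ρ (monG w e))
          + repComm P (indT ρ) (w j) (w k) * indT ρ (monG w e)) := by
      rw [mul_assoc, indT_mul_indX, mul_smul_comm, ← mul_assoc, indY_mul_indX, add_mul, mul_assoc]
    rw [sub_mul, h1, smul_mul_assoc, h2, smul_mul_assoc, mul_sub, mul_smul_comm]
    module

theorem indY_comm (i j : Fin n) : indY P ρ i * indY P ρ j = indY P ρ j * indY P ρ i := by
  rw [← sub_eq_zero]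
  refine ind_ext (fun u => ?_) fun k => ⟨indX F V k, ?_⟩
  · rw [LinearMap.sub_apply, Module.End.mul_apply, Module.End.mul_apply, indY_one_mk,
      indY_one_mk, map_zero, map_zero, sub_zero]
  · have h := repComm_y P (indT ρ) (indT_mul_indY P ρ) i j k
    rw [adR_apply, adR_apply] at h
    have key : ∀ i j, indY P ρ i * indY P ρ j * indX F V k = indX F V k * (indY P ρ i * indY P ρ j)
        + repComm P (indT ρ) i k * indY P ρ j + indY P ρ i * repComm P (indT ρ) j k := fun i j => by
      rw [mul_assoc, indY_mul_indX, mul_add, ← mul_assoc, indY_mul_indX]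
      noncomm_ring
    rw [sub_mul, key, key, mul_sub, ← sub_eq_zero]
    rw [← sub_eq_zero] at h
    rw [← neg_eq_zero, ← h]
    abel

/-- The action of the free generators on the induced module. -/
def indGen : Gen r n → Module.End F (Ind F n V)
  | .x i => indX F V i
  | .y i => indY P ρ i
  | .t g => indT ρ g

theorem lift_indGen_fe (i : Fin n) (j : ℕ) :
    FreeAlgebra.lift F (indGen P ρ) (fe F i j) = (r : F)⁻¹ • ∑ l ∈ Finset.range r,
      algebraMap ℂ F ((zeta r ^ (l * j))⁻¹) • indT ρ (diagG r i ^ l) := by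
  rw [fe, map_smul, map_sum]
  simp only [map_smul, ft, FreeAlgebra.lift_ι_apply, indGen]

theorem lift_indGen_tx (g : G r n) (j : Fin n) :
    FreeAlgebra.lift F (indGen P ρ) (ft F g * fx F j)
      = FreeAlgebra.lift F (indGen P ρ)
        ((∑ i, algebraMap ℂ F ((g⁻¹ : G r n).1.1 j i) • fx F i) * ft F g) := by
  obtain ⟨w, e, rfl⟩ := exists_monG g
  simp only [ft, fx, map_mul, map_sum, map_smul, FreeAlgebra.lift_ι_apply, indGen]
  rw [indT_mul_indX, monG_inv, Finset.sum_eq_single (w j)]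
  · rw [monG_apply]
    simp [rootF]
  · intro b _ hb
    rw [monG_apply, if_neg, map_zero, zero_smul]
    rintro rfl
    simp at hb
  · simp

theorem lift_indGen_ty (g : G r n) (j : Fin n) :
    FreeAlgebra.lift F (indGen P ρ) (ft F g * fy F j)
      = FreeAlgebra.lift F (indGen P ρ) ((∑ i, algebraMap ℂ F (g.1.1 i j) • fy F i) * ft F g) := by
  obtain ⟨w, e, rfl⟩ := exists_monG g
  simp only [ft, fy, map_mul, map_sum, map_smul, FreeAlgebra.lift_ι_apply, indGen]
  rw [indT_mul_indY, Finset.sum_eq_single (w j)]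
  · rw [monG_apply, if_pos rfl, smul_mul_assoc]
    rfl
  · intro b _ hb
    rw [monG_apply, if_neg hb, map_zero, zero_smul]
  · simp

theorem lift_indGen_yx_ne (i j : Fin n) (h : i ≠ j) :
    FreeAlgebra.lift F (indGen P ρ) (fy F i * fx F j)
      = FreeAlgebra.lift F (indGen P ρ) (fx F j * fy F i
        + P.c₀ • ∑ l ∈ Finset.range r, algebraMap ℂ F ((zeta r ^ l)⁻¹) • ft F (reflG r i j l)) := by
  have hs : ∑ l ∈ Finset.range r, algebraMap ℂ F ((zeta r ^ l)⁻¹) • indT ρ (reflG r i j l)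
      = ∑ η, rootF F η⁻¹ • indT ρ (reflRoot i j η) := by
    rw [← sum_range_zetaRoot]
    refine Finset.sum_congr rfl fun l _ => ?_
    rw [reflG_eq i j h, rootF]
    simp
  have h' := indY_mul_indX P ρ i j
  rw [repComm, if_neg h, ← hs] at h'
  simp only [ft, fx, fy, map_mul, map_add, map_sum, map_smul, FreeAlgebra.lift_ι_apply, indGen]
  exact h'

theorem lift_indGen_yx_eq (i : Fin n) :
    FreeAlgebra.lift F (indGen P ρ) (fy F i * fx F i)
      = FreeAlgebra.lift F (indGen P ρ) (fx F i * fy F i + algebraMap F _ P.κ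
        - ∑ j ∈ Finset.range r, (P.d (j : ZMod r) - P.d ((j : ZMod r) - 1)) • fe F i j
        - P.c₀ • ∑ j ∈ Finset.univ.erase i, ∑ l ∈ Finset.range r, ft F (reflG r i j l)) := by
  have h : ∑ j ∈ Finset.univ.erase i, ∑ l ∈ Finset.range r, indT ρ (reflG r i j l)
      = ∑ j ∈ Finset.univ.erase i, ∑ η, indT ρ (reflRoot i j η) := by
    refine Finset.sum_congr rfl fun j hj => ?_
    rw [← sum_range_zetaRoot]
    exact Finset.sum_congr rfl fun l _ => by rw [reflG_eq i j (Finset.ne_of_mem_erase hj).symm]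
  have h' := indY_mul_indX P ρ i i
  rw [repComm, if_pos rfl, repDSum, ← h, ← add_sub_assoc, ← add_sub_assoc] at h'
  simp only [ft, fx, fy, map_mul, map_add, map_sub, map_sum, map_smul, AlgHom.commutes,
    FreeAlgebra.lift_ι_apply, indGen, lift_indGen_fe]
  exact h'

theorem lift_indGen_rel {a b : FreeAlgebra F (Gen r n)} (h : Rel P n a b) :
    FreeAlgebra.lift F (indGen P ρ) a = FreeAlgebra.lift F (indGen P ρ) b := by
  cases h with
  | xx i j =>
    simp only [fx, map_mul, FreeAlgebra.lift_ι_apply, indGen]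
    rw [indX, indX, ← map_mul, mul_comm, map_mul]
  | yy i j =>
    simp only [fy, map_mul, FreeAlgebra.lift_ι_apply, indGen]
    exact indY_comm P ρ i j
  | t_one =>
    simp only [ft, map_one, FreeAlgebra.lift_ι_apply, indGen]
  | t_mul u w =>
    simp only [ft, map_mul, FreeAlgebra.lift_ι_apply, indGen]
  | tx g j => exact lift_indGen_tx P ρ g j
  | ty g j => exact lift_indGen_ty P ρ g j
  | yx_ne i j h => exact lift_indGen_yx_ne P ρ i j h
  | yx_eq i => exact lift_indGen_yx_eq P ρ i

/-- The action of `ℍ` on the induced module. -/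
def indRep : H P n →ₐ[F] Module.End F (Ind F n V) :=
  RingQuot.liftAlgHom F ⟨FreeAlgebra.lift F (indGen P ρ), fun _ _ h => lift_indGen_rel P ρ h⟩

theorem indRep_toH (a : FreeAlgebra F (Gen r n)) :
    indRep P ρ (toH P n a) = FreeAlgebra.lift F (indGen P ρ) a :=
  RingQuot.liftAlgHom_mkAlgHom_apply F (FreeAlgebra.lift F (indGen P ρ))
    (fun _ _ h => lift_indGen_rel P ρ h) a

theorem indRep_t_one_mk (g : G r n) (u : V) :
    indRep P ρ (t P g) (indMk F n V 1 u) = indMk F n V 1 (ρ g u) := by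
  rw [t, indRep_toH, ft, FreeAlgebra.lift_ι_apply, indGen, indT_mk, map_one]

theorem indRep_y_one_mk (i : Fin n) (u : V) : indRep P ρ (y P i) (indMk F n V 1 u) = 0 := by
  rw [y, indRep_toH, fy, FreeAlgebra.lift_ι_apply, indGen, indY_one_mk]

end Induced

end

end Cherednik

namespace Cherednik

noncomputable section

/-! ### Homomorphisms from the symmetric group given on simple transpositions -/

section Presentation

variable {n : ℕ}

theorem exists_adjacent_descent {w : Equiv.Perm (Fin n)} (hw : w ≠ 1) :
    ∃ i j : Fin n, i.1 + 1 = j.1 ∧ w j < w i := by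
  by_contra! hcon
  apply hw
  have hmono : StrictMono w := by
    rcases n with _ | n
    · intro i; exact i.elim0
    · refine Fin.strictMono_iff_lt_succ.mpr fun i => ?_
      refine lt_of_le_of_ne (hcon i.castSucc i.succ (by simp)) fun h => ?_
      exact absurd (w.injective h) (Fin.castSucc_lt_succ).ne
  have h1 : (hmono.orderIsoOfSurjective w w.surjective) = OrderIso.refl (Fin n) :=
    Subsingleton.elim _ _
  ext i
  have := congrArg (fun e : Fin n ≃o Fin n => (e i).1) h1
  simpa using this

/-- The relations of the simple transpositions. -/
structure IsBraidFamily {A : Type*} [Monoid A] (g : Fin n → Fin n → A) : Prop where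
  sq : ∀ i j, i.1 + 1 = j.1 → g i j * g i j = 1
  comm : ∀ i j k l, i.1 + 1 = j.1 → k.1 + 1 = l.1 → j.1 < k.1 → g i j * g k l = g k l * g i j
  braid : ∀ i j k, i.1 + 1 = j.1 → j.1 + 1 = k.1 →
    g i j * g j k * g i j = g j k * g i j * g j k

variable {A : Type*} [Monoid A] (g : Fin n → Fin n → A)

/-- `a` is the product along some reduced word of `w`. -/
inductive IsReducedProd : Equiv.Perm (Fin n) → A → Prop
  | one : IsReducedProd 1 1
  | step (w : Equiv.Perm (Fin n)) (a : A) (i j : Fin n) (hij : i.1 + 1 = j.1) (h : w i < w j)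
      (hw : IsReducedProd w a) : IsReducedProd (w * Equiv.swap i j) (a * g i j)

variable {g}

theorem IsReducedProd.of_descent {w : Equiv.Perm (Fin n)} {a : A} {i j : Fin n}
    (hij : i.1 + 1 = j.1) (h : w j < w i) (hw : IsReducedProd g (w * Equiv.swap i j) a) :
    IsReducedProd g w (a * g i j) := by
  have := IsReducedProd.step _ a i j hij (by simpa using h) hw
  rwa [mul_assoc, Equiv.swap_mul_self, mul_one] at this

theorem exists_isReducedProd (w : Equiv.Perm (Fin n)) : ∃ a, IsReducedProd g w a := by
  induction hk : len w using Nat.strong_induction_on generalizing w with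
  | _ k ih =>
    subst hk
    by_cases hw : w = 1
    · subst hw; exact ⟨1, .one⟩
    · obtain ⟨i, j, hij, h⟩ := exists_adjacent_descent hw
      obtain ⟨a, ha⟩ := ih _ (len_mul_swap_lt (by rw [Fin.lt_def]; omega) h) _ rfl
      exact ⟨_, ha.of_descent hij h⟩

theorem IsReducedProd.cases' {w : Equiv.Perm (Fin n)} {a : A} (h : IsReducedProd g w a) :
    (w = 1 ∧ a = 1) ∨ ∃ b i j, i.1 + 1 = j.1 ∧ w j < w i ∧ a = b * g i j
      ∧ IsReducedProd g (w * Equiv.swap i j) b := by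
  cases h with
  | one => exact Or.inl ⟨rfl, rfl⟩
  | step w a i j hij h hw =>
    refine Or.inr ⟨a, i, j, hij, by simpa using h, rfl, ?_⟩
    rwa [mul_assoc, Equiv.swap_mul_self, mul_one]

/-- Matsumoto's argument, by induction on the length. Two reduced words of `w` end in letters that
are both descents of `w`. If the letters differ, both words are compared with words ending in the
two sides of the commutation or braid relation. -/
theorem IsReducedProd.unique (hg : IsBraidFamily g) {w : Equiv.Perm (Fin n)} {a a' : A}
    (h : IsReducedProd g w a) (h' : IsReducedProd g w a') : a = a' := by
  induction hk : len w using Nat.strong_induction_on generalizing w a a' with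
  | _ k ih =>
    subst hk
    rcases h.cases' with ⟨rfl, rfl⟩ | ⟨b, i, j, hij, hlt, rfl, hb⟩
    · rcases h'.cases' with ⟨-, rfl⟩ | ⟨b, i, j, hij, hlt, rfl, hb⟩
      · rfl
      · simp only [Equiv.Perm.one_apply, Fin.lt_def] at hlt
        omega
    rcases h'.cases' with ⟨rfl, rfl⟩ | ⟨b', i', j', hij', hlt', rfl, hb'⟩
    · simp only [Equiv.Perm.one_apply, Fin.lt_def] at hlt
      omega
    have hl : len (w * Equiv.swap i j) < len w := len_mul_swap_lt (by rw [Fin.lt_def]; omega) hlt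
    have hl' : len (w * Equiv.swap i' j') < len w :=
      len_mul_swap_lt (by rw [Fin.lt_def]; omega) hlt'
    have far : ∀ {i j i' j' : Fin n} {b b' : A}, i.1 + 1 = j.1 → i'.1 + 1 = j'.1 → j.1 < i'.1 →
        w j < w i → w j' < w i' → IsReducedProd g (w * Equiv.swap i j) b →
        IsReducedProd g (w * Equiv.swap i' j') b' → len (w * Equiv.swap i j) < len w →
        len (w * Equiv.swap i' j') < len w → b * g i j = b' * g i' j' := by
      intro i j i' j' b b' hij hij' hlt h1 h2 hb hb' hl hl'
      have e : w * Equiv.swap i j * Equiv.swap i' j' = w * Equiv.swap i' j' * Equiv.swap i j := by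
        rw [mul_assoc, mul_assoc, Equiv.mul_swap_eq_swap_mul, Equiv.swap_apply_of_ne_of_ne,
          Equiv.swap_apply_of_ne_of_ne]
        all_goals rw [Fin.ne_iff_vne]; omega
      -- A reduced word for `w` with both commuting letters removed; completing it by either letter
      -- gives words comparable with `b` and `b'` by induction.
      obtain ⟨c, hc⟩ := exists_isReducedProd (g := g) (w * Equiv.swap i j * Equiv.swap i' j')
      have d1 := hc.of_descent hij' (w := w * Equiv.swap i j) (by
        rw [Equiv.Perm.mul_apply, Equiv.Perm.mul_apply, Equiv.swap_apply_of_ne_of_ne,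
          Equiv.swap_apply_of_ne_of_ne]
        · exact h2
        all_goals rw [Fin.ne_iff_vne]; omega)
      rw [e] at hc
      have d2 := hc.of_descent hij (w := w * Equiv.swap i' j') (by
        rw [Equiv.Perm.mul_apply, Equiv.Perm.mul_apply, Equiv.swap_apply_of_ne_of_ne,
          Equiv.swap_apply_of_ne_of_ne]
        · exact h1
        all_goals rw [Fin.ne_iff_vne]; omega)
      rw [ih _ hl hb d1 rfl, ih _ hl' hb' d2 rfl, mul_assoc, mul_assoc,
        hg.comm i j i' j' hij hij' hlt]
    have near : ∀ {i j k : Fin n} {b b' : A}, i.1 + 1 = j.1 → j.1 + 1 = k.1 →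
        w j < w i → w k < w j → IsReducedProd g (w * Equiv.swap i j) b →
        IsReducedProd g (w * Equiv.swap j k) b' → len (w * Equiv.swap i j) < len w →
        len (w * Equiv.swap j k) < len w → b * g i j = b' * g j k := by
      intro i j k b b' hij hjk h1 h2 hb hb' hl hl'
      have n1 : i ≠ j := by rw [Fin.ne_iff_vne]; omega
      have n2 : j ≠ k := by rw [Fin.ne_iff_vne]; omega
      have n3 : i ≠ k := by rw [Fin.ne_iff_vne]; omega
      have e : w * Equiv.swap i j * Equiv.swap j k * Equiv.swap i j
          = w * Equiv.swap j k * Equiv.swap i j * Equiv.swap j k := by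
        have e1 : Equiv.swap i j * Equiv.swap j k * Equiv.swap i j = Equiv.swap i k := by
          rw [Equiv.mul_swap_eq_swap_mul (Equiv.swap i j) j k, Equiv.swap_apply_right,
            Equiv.swap_apply_of_ne_of_ne n3.symm n2.symm, mul_assoc, Equiv.swap_mul_self, mul_one]
        have e2 : Equiv.swap j k * Equiv.swap i j * Equiv.swap j k = Equiv.swap i k := by
          rw [Equiv.mul_swap_eq_swap_mul (Equiv.swap j k) i j, Equiv.swap_apply_left,
            Equiv.swap_apply_of_ne_of_ne n1 n3, mul_assoc, Equiv.swap_mul_self, mul_one]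
        simp only [mul_assoc] at e1 e2 ⊢
        rw [e1, e2]
      -- Two neighbouring descents make the whole braid word removable from the end of `w`.
      obtain ⟨c, hc⟩ := exists_isReducedProd (g := g)
        (w * Equiv.swap i j * Equiv.swap j k * Equiv.swap i j)
      have d1 := (hc.of_descent hij (w := w * Equiv.swap i j * Equiv.swap j k) (by
        simpa [Equiv.swap_apply_of_ne_of_ne, n1, n2, n3, n1.symm, n2.symm, n3.symm] using h2)).of_descent
          hjk (w := w * Equiv.swap i j) (by
        simpa [Equiv.swap_apply_of_ne_of_ne, n1, n2, n3, n1.symm, n2.symm, n3.symm] using h2.trans h1)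
      rw [e] at hc
      have d2 := (hc.of_descent hjk (w := w * Equiv.swap j k * Equiv.swap i j) (by
        simpa [Equiv.swap_apply_of_ne_of_ne, n1, n2, n3, n1.symm, n2.symm, n3.symm] using h1)).of_descent
          hij (w := w * Equiv.swap j k) (by
        simpa [Equiv.swap_apply_of_ne_of_ne, n1, n2, n3, n1.symm, n2.symm, n3.symm] using h2.trans h1)
      rw [ih _ hl hb d1 rfl, ih _ hl' hb' d2 rfl, mul_assoc, mul_assoc, mul_assoc, mul_assoc,
        ← mul_assoc (g i j), hg.braid i j k hij hjk, mul_assoc]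
    rcases lt_trichotomy i.1 i'.1 with hlt1 | heq | hgt
    · rcases (show j.1 < i'.1 ∨ j.1 = i'.1 by omega) with h1 | h1
      · exact far hij hij' h1 hlt hlt' hb hb' hl hl'
      · obtain rfl := Fin.ext h1
        exact near hij hij' hlt hlt' hb hb' hl hl'
    · obtain rfl := Fin.ext heq
      obtain rfl : j = j' := Fin.ext (by omega)
      rw [ih _ hl hb hb' rfl]
    · rcases (show j'.1 < i.1 ∨ j'.1 = i.1 by omega) with h1 | h1
      · exact (far hij' hij h1 hlt' hlt hb' hb hl' hl).symm
      · obtain rfl := Fin.ext h1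
        exact (near hij' hij hlt' hlt hb' hb hl' hl).symm

/-- This is the Coxeter presentation of the symmetric group: send `w` to its product along any
reduced word. Multiplicativity in a simple transposition is immediate when it lengthens `w`, and
follows from the square relation when it shortens `w`. -/
theorem exists_perm_hom (hg : IsBraidFamily g) :
    ∃ ρ : Equiv.Perm (Fin n) →* A, ∀ i j : Fin n, i.1 + 1 = j.1 → ρ (Equiv.swap i j) = g i j := by
  choose ρ hρ using exists_isReducedProd (g := g)
  have h1 : ρ 1 = 1 := (hρ 1).unique hg .one
  have hs : ∀ w (i j : Fin n), i.1 + 1 = j.1 → ρ (w * Equiv.swap i j) = ρ w * g i j := by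
    intro w i j hij
    have hne : w i ≠ w j := fun h => by
      have := w.injective h
      rw [this] at hij
      omega
    rcases lt_or_gt_of_ne hne with h | h
    · exact (hρ _).unique hg ((hρ w).step _ _ i j hij h)
    · rw [(hρ w).unique hg ((hρ (w * Equiv.swap i j)).of_descent hij h), mul_assoc,
        hg.sq i j hij, mul_one]
  refine ⟨⟨⟨ρ, h1⟩, fun u w => ?_⟩, fun i j hij => ?_⟩
  · change ρ (u * w) = ρ u * ρ w
    induction w using perm_induction with
    | h1 => rw [h1, mul_one, mul_one]
    | hs i j hij w ih => rw [← mul_assoc, hs _ _ _ hij, ih, hs _ _ _ hij, mul_assoc]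
  · change ρ _ = _
    rw [← one_mul (Equiv.swap i j), hs 1 i j hij, h1, one_mul]

end Presentation

end

end Cherednik

namespace Cherednik

noncomputable section

/-! ### Young's orthonormal form -/

section Coefficients

set_option linter.unusedSectionVars false

variable (F : Type) [Field F] [Algebra ℂ F] {r n : ℕ} {lam : RPartition r n}

/-- The inverse axial distance of two boxes, `0` if they lie in different components. -/
def axial (b b' : Box lam) : F :=
  if beta b = beta b' then (((ct b - ct b' : ℤ) : F))⁻¹ else 0

/-- The off-diagonal coefficient in Young's orthonormal form. -/
def orth (b b' : Box lam) : F := algebraMap ℂ F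
  (if beta b = beta b' then
    ((Real.sqrt (1 - (1 / ((ct b - ct b' : ℤ) : ℝ)) ^ 2) : ℝ) : ℂ) else 1)

variable {F}

theorem axial_swap (b b' : Box lam) : axial F b' b = - axial F b b' := by
  rw [axial, axial, ← neg_sub (ct b), Int.cast_neg, inv_neg]
  simp only [eq_comm (a := beta b')]
  split_ifs <;> simp

theorem orth_swap (b b' : Box lam) : orth F b' b = orth F b b' := by
  rw [orth, orth, ← neg_sub (ct b), Int.cast_neg, div_neg, neg_sq]
  simp only [eq_comm (a := beta b')]

/-- The contents differ by a nonzero integer, so the real number under the root is nonnegative and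
squaring recovers it. -/
theorem axial_sq_add_orth_sq {b b' : Box lam} (h : beta b = beta b' → ct b ≠ ct b') :
    axial F b b' ^ 2 + orth F b b' ^ 2 = 1 := by
  rw [axial, orth]
  split_ifs with hb
  · have hne : ct b - ct b' ≠ 0 := sub_ne_zero.mpr (h hb)
    have h1 : (0 : ℝ) ≤ 1 - (1 / ((ct b - ct b' : ℤ) : ℝ)) ^ 2 := by
      have h2 : (1 : ℤ) ≤ (ct b - ct b') ^ 2 := by
        have := Int.one_le_abs hne
        nlinarith [sq_abs (ct b - ct b')]
      have h3 : (1 : ℝ) ≤ ((ct b - ct b' : ℤ) : ℝ) ^ 2 := by exact_mod_cast h2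
      rw [div_pow, one_pow, sub_nonneg]
      exact div_le_one_of_le₀ h3 (by positivity)
    have h4 : ((1 - (1 / ((ct b - ct b' : ℤ) : ℝ)) ^ 2 : ℝ) : ℂ)
        = 1 - (((ct b - ct b' : ℤ) : ℂ)⁻¹) ^ 2 := by
      push_cast
      rw [one_div]
    rw [← map_pow, ← Complex.ofReal_pow, Real.sq_sqrt h1, h4, map_sub, map_one, map_pow, map_inv₀,
      map_intCast]
    ring
  · simp

theorem orth_eq_zero {b b' : Box lam} (hb : beta b = beta b')
    (h : ct b - ct b' = 1 ∨ ct b - ct b' = -1) : orth F b b' = 0 := by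
  rw [orth, if_pos hb]
  rcases h with h | h <;> rw [h] <;> simp

/-- This is `1/p · 1/q = 1/(p+q) · (1/p + 1/q)` for axial distances, valid also with the value 0 for
boxes in different components. It is the identity behind the braid relation. -/
theorem axial_cocycle [CharZero F] {a b c : Box lam} (hab : beta a = beta b → ct a ≠ ct b)
    (hbc : beta b = beta c → ct b ≠ ct c) (hac : beta a = beta c → ct a ≠ ct c) :
    axial F a b * axial F b c = axial F a c * (axial F a b + axial F b c) := by
  simp only [axial]
  by_cases h1 : beta a = beta b
  · by_cases h2 : beta b = beta c
    · have h3 := h1.trans h2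
      rw [if_pos h1, if_pos h2, if_pos h3]
      have k1 : ((ct a - ct b : ℤ) : F) ≠ 0 := by exact_mod_cast sub_ne_zero.mpr (hab h1)
      have k2 : ((ct b - ct c : ℤ) : F) ≠ 0 := by exact_mod_cast sub_ne_zero.mpr (hbc h2)
      have k3 : ((ct a - ct c : ℤ) : F) ≠ 0 := by exact_mod_cast sub_ne_zero.mpr (hac h3)
      field_simp
      push_cast
      ring
    · rw [if_neg h2, if_neg fun h => h2 (h1.symm.trans h)]
      simp
  · by_cases h2 : beta b = beta c
    · rw [if_neg h1, if_neg fun h : beta a = beta c => h1 (h.trans h2.symm)]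
      simp
    · rw [if_neg h1, if_neg h2]
      simp

end Coefficients

/-! ### Young's operators on all bijective tableaux, free of standardness conditions -/

section Operators

variable (F : Type) [Field F] [Algebra ℂ F] {r n : ℕ} {lam : RPartition r n}

variable (lam) in
/-- Young's operator on all tableaux. -/
def youngAll (i j : Fin n) : ((Fin n ≃ Box lam) →₀ F) →ₗ[F] ((Fin n ≃ Box lam) →₀ F) :=
  Finsupp.linearCombination F fun T => -axial F (T i) (T j) • Finsupp.single T 1
    + orth F (T i) (T j) • Finsupp.single ((Equiv.swap i j).trans T) 1

theorem youngAll_single (i j : Fin n) (T : Fin n ≃ Box lam) :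
    youngAll F lam i j (Finsupp.single T 1) = -axial F (T i) (T j) • Finsupp.single T 1
      + orth F (T i) (T j) • Finsupp.single ((Equiv.swap i j).trans T) 1 := by
  rw [youngAll, Finsupp.linearCombination_single, one_smul]

variable {F} in
theorem youngAll_sq {i j : Fin n} {T : Fin n ≃ Box lam}
    (h : beta (T i) = beta (T j) → ct (T i) ≠ ct (T j)) :
    youngAll F lam i j (youngAll F lam i j (Finsupp.single T 1)) = Finsupp.single T 1 := by
  have e : (Equiv.swap i j).trans ((Equiv.swap i j).trans T) = T := by ext; simp
  rw [youngAll_single, map_add, map_smul, map_smul, youngAll_single, youngAll_single, e]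
  simp only [Equiv.trans_apply, Equiv.swap_apply_left, Equiv.swap_apply_right]
  rw [axial_swap (T i), orth_swap (T i)]
  linear_combination (norm := module) (axial_sq_add_orth_sq (F := F) h) • Finsupp.single T (1 : F)

theorem youngAll_comm {i j k l : Fin n} (hki : k ≠ i) (hkj : k ≠ j) (hli : l ≠ i) (hlj : l ≠ j)
    (T : Fin n ≃ Box lam) :
    youngAll F lam i j (youngAll F lam k l (Finsupp.single T 1))
      = youngAll F lam k l (youngAll F lam i j (Finsupp.single T 1)) := by
  have e : (Equiv.swap i j).trans ((Equiv.swap k l).trans T)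
      = (Equiv.swap k l).trans ((Equiv.swap i j).trans T) := by
    have : Equiv.swap k l * Equiv.swap i j = Equiv.swap i j * Equiv.swap k l := by
      rw [Equiv.mul_swap_eq_swap_mul, Equiv.swap_apply_of_ne_of_ne hki.symm hli.symm,
        Equiv.swap_apply_of_ne_of_ne hkj.symm hlj.symm]
    rw [← Equiv.trans_assoc, ← Equiv.trans_assoc]
    exact congrArg (fun s : Equiv.Perm (Fin n) => s.trans T) this
  simp only [youngAll_single, map_add, map_smul, Equiv.trans_apply,
    Equiv.swap_apply_of_ne_of_ne hki hkj, Equiv.swap_apply_of_ne_of_ne hli hlj,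
    Equiv.swap_apply_of_ne_of_ne hki.symm hli.symm, Equiv.swap_apply_of_ne_of_ne hkj.symm hlj.symm,
    e]
  module

variable {F} in
-- Both sides are expanded in the tableaux obtained from `T`. The longest exchange agrees on the
-- nose, and the other coefficients differ by multiples of the cocycle identity and of the two
-- square relations.
theorem youngAll_braid [CharZero F] {i j k : Fin n} (hij : i ≠ j) (hjk : j ≠ k) (hik : i ≠ k)
    {T : Fin n ≃ Box lam} (h1 : beta (T i) = beta (T j) → ct (T i) ≠ ct (T j))
    (h2 : beta (T j) = beta (T k) → ct (T j) ≠ ct (T k))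
    (h3 : beta (T i) = beta (T k) → ct (T i) ≠ ct (T k)) :
    youngAll F lam i j (youngAll F lam j k (youngAll F lam i j (Finsupp.single T 1)))
      = youngAll F lam j k (youngAll F lam i j (youngAll F lam j k (Finsupp.single T 1))) := by
  have e1 : (Equiv.swap i j).trans ((Equiv.swap i j).trans T) = T := by ext; simp
  have e2 : (Equiv.swap j k).trans ((Equiv.swap j k).trans T) = T := by ext; simp
  have e3 : (Equiv.swap i j).trans ((Equiv.swap j k).trans ((Equiv.swap i j).trans T))
      = (Equiv.swap j k).trans ((Equiv.swap i j).trans ((Equiv.swap j k).trans T)) := by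
    have a1 : Equiv.swap i j * Equiv.swap j k * Equiv.swap i j = Equiv.swap i k := by
      rw [Equiv.mul_swap_eq_swap_mul (Equiv.swap i j) j k, Equiv.swap_apply_right,
        Equiv.swap_apply_of_ne_of_ne hik.symm hjk.symm, mul_assoc, Equiv.swap_mul_self, mul_one]
    have a2 : Equiv.swap j k * Equiv.swap i j * Equiv.swap j k = Equiv.swap i k := by
      rw [Equiv.mul_swap_eq_swap_mul (Equiv.swap j k) i j, Equiv.swap_apply_left,
        Equiv.swap_apply_of_ne_of_ne hij hik, mul_assoc, Equiv.swap_mul_self, mul_one]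
    exact congrArg (fun s : Equiv.Perm (Fin n) => s.trans T) (a1.trans a2.symm)
  have s1 := Equiv.swap_apply_of_ne_of_ne hik.symm hjk.symm
  have s2 := Equiv.swap_apply_of_ne_of_ne hij hik
  simp only [youngAll_single, map_add, map_smul, Equiv.trans_apply, Equiv.swap_apply_left,
    Equiv.swap_apply_right, s1, s2, e1, e2, e3]
  rw [axial_swap (T i) (T j), orth_swap (T i) (T j), axial_swap (T j) (T k), orth_swap (T j) (T k)]
  have I := axial_cocycle (F := F) h1 h2 h3
  have q1 := axial_sq_add_orth_sq (F := F) h1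
  have q2 := axial_sq_add_orth_sq (F := F) h2
  generalize axial F (T i) (T j) = A at *
  generalize axial F (T j) (T k) = B at *
  generalize axial F (T i) (T k) = C at *
  generalize orth F (T i) (T j) = a at *
  generalize orth F (T j) (T k) = b at *
  generalize orth F (T i) (T k) = c at *
  -- The coefficient of `T` itself on the two sides.
  have c1 : -A ^ 2 * B - a ^ 2 * C = -B ^ 2 * A - b ^ 2 * C := by
    linear_combination (B - A) * I - C * q1 + C * q2
  linear_combination (norm := module) c1 • Finsupp.single T (1 : F)
    + (a * I) • Finsupp.single ((Equiv.swap i j).trans T) (1 : F)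
    - (b * I) • Finsupp.single ((Equiv.swap j k).trans T) (1 : F)

end Operators

end

end Cherednik

namespace Cherednik

noncomputable section

/-! ### The representation of `G(r,1,n)` in Young's orthonormal form -/

section YoungRep

set_option linter.unusedSectionVars false

variable (F : Type) [Field F] [Algebra ℂ F] {r n : ℕ} [NeZero r] {lam : RPartition r n}

open Classical in
/-- `a T` if `T` is standard, and `0` otherwise. -/
def extendSYT {N : Type*} [Zero N] (a : SYT lam → N) (T : Fin n ≃ Box lam) : N :=
  if h : IsStandard T then a ⟨T, h⟩ else 0

theorem extendSYT_of {N : Type*} [Zero N] (a : SYT lam → N) {T : Fin n ≃ Box lam}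
    (h : IsStandard T) : extendSYT a T = a ⟨T, h⟩ := dif_pos h

theorem extendSYT_of_not {N : Type*} [Zero N] (a : SYT lam → N) {T : Fin n ≃ Box lam}
    (h : ¬ IsStandard T) : extendSYT a T = 0 := dif_neg h

theorem extendSYT_val {N : Type*} [Zero N] (a : SYT lam → N) (T : SYT lam) :
    extendSYT a T.1 = a T := extendSYT_of a T.2

theorem orth_eq_zero_of_not (T : SYT lam) {i j : Fin n} (hij : i.1 + 1 = j.1)
    (h : ¬ IsStandard (swapT i j T)) : orth F (T.1 i) (T.1 j) = 0 := by
  obtain ⟨h1, h2⟩ := (isStandard_swapT_or T hij).resolve_left h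
  exact orth_eq_zero h1 h2

variable (lam) in
/-- Young's operator on standard tableaux. -/
def young (i j : Fin n) : Module.End F (SYT lam →₀ F) :=
  Finsupp.linearCombination F fun T : SYT lam => -axial F (T.1 i) (T.1 j) • Finsupp.single T 1
    + orth F (T.1 i) (T.1 j) • extendSYT (fun S => Finsupp.single S (1 : F)) (swapT i j T)

theorem young_single (i j : Fin n) (T : SYT lam) :
    young F lam i j (Finsupp.single T 1) = -axial F (T.1 i) (T.1 j) • Finsupp.single T 1
      + orth F (T.1 i) (T.1 j) • extendSYT (fun S => Finsupp.single S (1 : F)) (swapT i j T) := by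
  rw [young, Finsupp.linearCombination_single, one_smul]

variable (lam) in
/-- The inclusion of standard tableaux into all tableaux. -/
def tabIncl : (SYT lam →₀ F) →ₗ[F] ((Fin n ≃ Box lam) →₀ F) :=
  Finsupp.lmapDomain F F fun T : SYT lam => T.1

theorem tabIncl_single (T : SYT lam) (c : F) :
    tabIncl F lam (Finsupp.single T c) = Finsupp.single T.1 c :=
  Finsupp.mapDomain_single

theorem tabIncl_injective : Function.Injective (tabIncl F lam) :=
  Finsupp.mapDomain_injective fun _ _ h => Subtype.ext h

/-- The coefficient of a non-standard exchange is zero, so the span of standard tableaux is stable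
and inherits every relation verified on all tableaux. -/
theorem tabIncl_young {i j : Fin n} (hij : i.1 + 1 = j.1) (m : SYT lam →₀ F) :
    tabIncl F lam (young F lam i j m) = youngAll F lam i j (tabIncl F lam m) := by
  have : tabIncl F lam ∘ₗ young F lam i j = youngAll F lam i j ∘ₗ tabIncl F lam := by
    refine Finsupp.lhom_ext fun T c => ?_
    rw [← mul_one c, ← smul_eq_mul, ← Finsupp.smul_single, map_smul, map_smul]
    congr 1
    rw [LinearMap.comp_apply, LinearMap.comp_apply, young_single, tabIncl_single, youngAll_single,
      map_add, map_smul, map_smul, tabIncl_single]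
    congr 1
    by_cases h : IsStandard (swapT i j T)
    · obtain ⟨S, hS⟩ : ∃ S : SYT lam, S.1 = swapT i j T := ⟨⟨_, h⟩, rfl⟩
      rw [← hS, extendSYT_val, tabIncl_single, hS]
      rfl
    · rw [orth_eq_zero_of_not F T hij h, zero_smul, zero_smul]
  exact LinearMap.congr_fun this m

variable {F} in
theorem end_ext {f g : Module.End F (SYT lam →₀ F)}
    (h : ∀ T : SYT lam, f (Finsupp.single T 1) = g (Finsupp.single T 1)) : f = g := by
  refine Finsupp.lhom_ext fun T c => ?_
  rw [← mul_one c, ← smul_eq_mul, ← Finsupp.smul_single, map_smul, map_smul, h]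

theorem ct_ne_of_add_one (T : SYT lam) {i j : Fin n} (hij : i.1 + 1 = j.1) :
    beta (T.1 i) = beta (T.1 j) → ct (T.1 i) ≠ ct (T.1 j) :=
  ct_ne T.2 (by rw [Fin.lt_def]; omega) (by omega)

theorem young_isBraidFamily : IsBraidFamily (young F lam) where
  sq i j hij := end_ext fun T => tabIncl_injective F (by
    rw [Module.End.mul_apply, Module.End.one_apply, tabIncl_young F hij, tabIncl_young F hij,
      tabIncl_single, youngAll_sq (ct_ne_of_add_one T hij)])
  comm i j k l hij hkl hjk := end_ext fun T => tabIncl_injective F (by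
    simp only [Module.End.mul_apply, tabIncl_young F hij, tabIncl_young F hkl, tabIncl_single]
    apply youngAll_comm
    all_goals rw [Fin.ne_iff_vne]; omega)
  braid i j k hij hjk := end_ext fun T => tabIncl_injective F (by
    have : CharZero F := charZero_of_injective_algebraMap (algebraMap ℂ F).injective
    simp only [Module.End.mul_apply, tabIncl_young F hij, tabIncl_young F hjk, tabIncl_single]
    apply youngAll_braid
    iterate 3 rw [Fin.ne_iff_vne]; omega
    · exact ct_ne_of_add_one T hij
    · exact ct_ne_of_add_one T hjk
    · exact ct_ne T.2 (by rw [Fin.lt_def]; omega) (by omega))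

variable (lam) in
/-- Young's orthonormal representation of the symmetric group. -/
def youngPerm : Equiv.Perm (Fin n) →* Module.End F (SYT lam →₀ F) :=
  (exists_perm_hom (young_isBraidFamily F)).choose

theorem youngPerm_swap {i j : Fin n} (hij : i.1 + 1 = j.1) :
    youngPerm F lam (Equiv.swap i j) = young F lam i j :=
  (exists_perm_hom (young_isBraidFamily F)).choose_spec i j hij

/-- The character by which diagonal matrices act on `v_T`. -/
def diagChar (e : Fin n → rootsOfUnity r ℂ) (T : Fin n ≃ Box lam) : F :=
  ∏ j, rootF F (e j) ^ (beta (T j) : ℕ)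

variable (lam) in
/-- The action of diagonal matrices. -/
def youngDiag (e : Fin n → rootsOfUnity r ℂ) : Module.End F (SYT lam →₀ F) :=
  Finsupp.linearCombination F fun T : SYT lam => diagChar F e T.1 • Finsupp.single T 1

theorem youngDiag_single (e : Fin n → rootsOfUnity r ℂ) (T : SYT lam) :
    youngDiag F lam e (Finsupp.single T 1) = diagChar F e T.1 • Finsupp.single T 1 := by
  rw [youngDiag, Finsupp.linearCombination_single, one_smul]

theorem youngDiag_mul (e e' : Fin n → rootsOfUnity r ℂ) :
    youngDiag F lam e * youngDiag F lam e' = youngDiag F lam (fun j => e j * e' j) :=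
  end_ext fun T => by
    rw [Module.End.mul_apply, youngDiag_single, map_smul, youngDiag_single, youngDiag_single,
      smul_smul]
    congr 1
    simp only [diagChar, rootF_mul, mul_pow, Finset.prod_mul_distrib]
    rw [mul_comm]

theorem youngDiag_one : youngDiag F lam (fun _ => 1) = 1 :=
  end_ext fun T => by
    rw [youngDiag_single, diagChar]
    simp [rootF_one]

theorem diagChar_trans (e : Fin n → rootsOfUnity r ℂ) (s : Equiv.Perm (Fin n))
    (T : Fin n ≃ Box lam) : diagChar F (e ∘ s) (s.trans T) = diagChar F e T :=
  Equiv.prod_comp s fun j => rootF F (e j) ^ (beta (T j) : ℕ)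

theorem diagChar_comp_swap (e : Fin n → rootsOfUnity r ℂ) {i j : Fin n}
    {T : Fin n ≃ Box lam} (h : beta (T i) = beta (T j)) :
    diagChar F (e ∘ Equiv.swap i j) T = diagChar F e T := by
  rw [← diagChar_trans F e (Equiv.swap i j)]
  refine Finset.prod_congr rfl fun k _ => ?_
  congr 2
  rw [Equiv.trans_apply, Equiv.swap_apply_def]
  split_ifs with h1 h2
  · rw [h1, h]
  · rw [h2, h]
  · rfl

/-- The diagonal part of Young's operator is nonzero only if both boxes lie in one component, and
then the exchange does not affect the character; the other part permutes the character along with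
the tableau. -/
theorem young_mul_youngDiag (i j : Fin n) (e : Fin n → rootsOfUnity r ℂ) :
    young F lam i j * youngDiag F lam e = youngDiag F lam (e ∘ Equiv.swap i j) * young F lam i j :=
  end_ext fun T => by
    have h1 : diagChar F e T.1 * axial F (T.1 i) (T.1 j)
        = axial F (T.1 i) (T.1 j) * diagChar F (e ∘ Equiv.swap i j) T.1 := by
      by_cases h : beta (T.1 i) = beta (T.1 j)
      · rw [diagChar_comp_swap F e h, mul_comm]
      · rw [axial, if_neg h, mul_zero, zero_mul]
    have h2 : youngDiag F lam (e ∘ Equiv.swap i j)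
          (extendSYT (fun S => Finsupp.single S (1 : F)) (swapT i j T))
        = diagChar F e T.1 • extendSYT (fun S => Finsupp.single S (1 : F)) (swapT i j T) := by
      by_cases h : IsStandard (swapT i j T)
      · obtain ⟨S, hS⟩ : ∃ S : SYT lam, S.1 = swapT i j T := ⟨⟨_, h⟩, rfl⟩
        rw [← hS, extendSYT_val, youngDiag_single, hS]
        congr 1
        exact diagChar_trans F e (Equiv.swap i j) T.1
      · rw [extendSYT_of_not _ h, map_zero, smul_zero]
    rw [Module.End.mul_apply, Module.End.mul_apply, youngDiag_single, map_smul, young_single,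
      map_add, map_smul, map_smul, h2, youngDiag_single]
    linear_combination (norm := module) (-h1) • Finsupp.single T (1 : F)

theorem youngPerm_mul_youngDiag (w : Equiv.Perm (Fin n)) (e : Fin n → rootsOfUnity r ℂ) :
    youngPerm F lam w * youngDiag F lam (e ∘ w) = youngDiag F lam e * youngPerm F lam w := by
  induction w using perm_induction generalizing e with
  | h1 =>
    rw [map_one, one_mul, mul_one]
    rfl
  | hs i j hij w ih =>
    have : (e ∘ (w * Equiv.swap i j)) ∘ Equiv.swap i j = e ∘ w := by
      funext k
      simp
    rw [map_mul, youngPerm_swap F hij, mul_assoc, young_mul_youngDiag, this, ← mul_assoc, ih,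
      mul_assoc]

variable (lam) in
/-- The action of an element of `G(r,1,n)` on Young's orthonormal basis. -/
def youngAct (g : G r n) : Module.End F (SYT lam →₀ F) :=
  youngPerm F lam (exists_monG g).choose * youngDiag F lam (exists_monG g).choose_spec.choose

/-- Uniqueness of the monomial normal form makes the chosen decomposition the given one. -/
theorem youngAct_monG (w : Equiv.Perm (Fin n)) (e : Fin n → rootsOfUnity r ℂ) :
    youngAct F lam (monG w e) = youngPerm F lam w * youngDiag F lam e := by
  obtain ⟨h1, h2⟩ := monG_injective (exists_monG (monG w e)).choose_spec.choose_spec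
  exact congrArg₂ (fun w e => youngPerm F lam w * youngDiag F lam e) h1.symm h2.symm

variable (lam) in
/-- Young's orthonormal representation of `G(r,1,n)`. -/
def youngRep : G r n →* Module.End F (SYT lam →₀ F) where
  toFun := youngAct F lam
  map_one' := by rw [← monG_one, youngAct_monG, map_one, youngDiag_one, mul_one]
  map_mul' g h := by
    obtain ⟨w, e, rfl⟩ := exists_monG g
    obtain ⟨w', e', rfl⟩ := exists_monG h
    rw [monG_mul, youngAct_monG, youngAct_monG, youngAct_monG, map_mul, ← youngDiag_mul, mul_assoc,
      mul_assoc, ← mul_assoc (youngDiag F lam e), ← youngPerm_mul_youngDiag, mul_assoc]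
    rfl

theorem youngRep_monG (w : Equiv.Perm (Fin n)) (e : Fin n → rootsOfUnity r ℂ) :
    youngRep F lam (monG w e) = youngPerm F lam w * youngDiag F lam e :=
  youngAct_monG F w e

theorem youngRep_swap {i j : Fin n} (hij : i.1 + 1 = j.1) :
    youngRep F lam (permG r (Equiv.swap i j)) = young F lam i j := by
  rw [permG_eq, youngRep_monG, youngDiag_one, mul_one, youngPerm_swap F hij]

theorem youngRep_diagG_single (i : Fin n) (T : SYT lam) :
    youngRep F lam (diagG r i) (Finsupp.single T 1)
      = rootF F (rootWt T i 0) • Finsupp.single T 1 := by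
  rw [diagG_eq, diagRoot, youngRep_monG, map_one, one_mul, youngDiag_single, diagChar,
    Finset.prod_eq_single i]
  · rw [if_pos rfl, rootWt, rootF, rootF]
    simp
  · intro k _ hk
    rw [if_neg hk, rootF_one, one_pow]
  · simp

end YoungRep

/-! ### The generators `v_T` of the standard module do not vanish -/

section Faithful

set_option linter.unusedSectionVars false

variable {F : Type} [Field F] [Algebra ℂ F] {r n : ℕ} [NeZero r] (P : Params F r)
  {lam : RPartition r n}

theorem jm_mul_t_swap {i j : Fin n} (hij : i.1 + 1 = j.1) :
    jm P j * t P (permG r (Equiv.swap i j)) = t P (permG r (Equiv.swap i j)) * jm P i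
      + piH P i j := by
  have hne : i ≠ j := fun h => by subst h; omega
  rw [jm_eq, jm_eq, Iio_succ_eq hij, Finset.sum_insert (by simp), add_mul,
    reflSum_mul_swap P i j hne, Finset.mul_sum, Finset.sum_mul, add_comm]
  congr 1
  refine Finset.sum_congr rfl fun k hk => ?_
  have hk' := Finset.mem_Iio.mp hk
  rw [t_perm_reflSum P _ i k hk'.ne', Equiv.swap_apply_left,
    Equiv.swap_apply_of_ne_of_ne hk'.ne (fun h => by rw [Fin.lt_def, h] at hk'; omega)]

variable {N : Type} [AddCommGroup N] [Module F N] [Module (H P n) N]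
  [IsScalarTower F (H P n) N] [SMulCommClass (H P n) F N] {a : SYT lam → N}
  (hd : ∀ i T, t P (diagG r i) • a T = rootF F (rootWt T i 0) • a T)
  (hs : ∀ i j : Fin n, i.1 + 1 = j.1 → ∀ T, t P (permG r (Equiv.swap i j)) • a T
    = -axial F (T.1 i) (T.1 j) • a T + orth F (T.1 i) (T.1 j) • extendSYT a (swapT i j T))

include hd in
theorem piH_smul_of_diag (i j : Fin n) (T : SYT lam) :
    piH P i j • a T = (if beta (T.1 i) = beta (T.1 j) then (r : F) else 0) • a T := by
  rw [piH_smul P (hd i T) (hd j T)]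
  simp only [rootWt_eq_iff_beta]

theorem axial_mul_sub {b b' : Box lam} (h : beta b = beta b' → ct b ≠ ct b') :
    axial F b b' * ((r : F) * (ct b : F) - (r : F) * (ct b' : F))
      = if beta b = beta b' then (r : F) else 0 := by
  have : CharZero F := charZero_of_injective_algebraMap (algebraMap ℂ F).injective
  rw [axial]
  split_ifs with hb
  · have k1 : ((ct b - ct b' : ℤ) : F) ≠ 0 := by exact_mod_cast sub_ne_zero.mpr (h hb)
    rw [← mul_sub, ← Int.cast_sub, mul_left_comm, inv_mul_cancel₀ k1, mul_one]
  · rw [zero_mul]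

include hd hs in
-- Induction along `φ_{i+1} s_i = s_i φ_i + π_i`, starting from `φ_1 = 0` and content 0. The
-- eigenvalues of the Jucys–Murphy elements thus follow from Young's form and need no separate
-- construction.
theorem jm_smul_of_young (i : Fin n) (T : SYT lam) :
    jm P i • a T = ((r : F) * (ct (T.1 i) : F)) • a T := by
  induction hm : i.1 generalizing i T with
  | zero =>
    have h0 : Finset.Iio i = ∅ := by
      ext k
      simp only [Finset.mem_Iio, Fin.lt_def, hm, Finset.notMem_empty, iff_false]
      omega
    rw [jm, h0, Finset.sum_empty, zero_smul, ct_first T.2 hm, Int.cast_zero, mul_zero, zero_smul]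
  | succ m ih =>
    obtain ⟨k, hk⟩ : ∃ k : Fin n, k.1 = m := ⟨⟨m, by omega⟩, rfl⟩
    have hki : k.1 + 1 = i.1 := by omega
    have key : ∀ S : SYT lam, jm P i • t P (permG r (Equiv.swap k i)) • a S
        = ((r : F) * (ct (S.1 k) : F)) • t P (permG r (Equiv.swap k i)) • a S
          + (if beta (S.1 k) = beta (S.1 i) then (r : F) else 0) • a S := fun S => by
      rw [← mul_smul, jm_mul_t_swap P hki, add_smul, mul_smul, ih k S hk,
        piH_smul_of_diag P hd, smul_comm]
    have hss : t P (permG r (Equiv.swap k i)) • t P (permG r (Equiv.swap k i)) • a T = a T := by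
      rw [← mul_smul, t_swap_sq, one_smul]
    have hA := axial_mul_sub (F := F) (ct_ne_of_add_one T hki)
    have hq := axial_sq_add_orth_sq (F := F) (ct_ne_of_add_one T hki)
    have hT := key T
    have e1 := hs k i hki T
    by_cases h : IsStandard (swapT k i T)
    · have hS := key ⟨swapT k i T, h⟩
      have e2 := hs k i hki ⟨swapT k i T, h⟩
      have h1 : swapT k i T k = T.1 i := by simp [swapT]
      have h2 : swapT k i T i = T.1 k := by simp [swapT]
      have h3 : extendSYT a (swapT k i ⟨swapT k i T, h⟩) = a T := by
        have : swapT k i ⟨swapT k i T, h⟩ = T.1 := by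
          ext l : 1
          simp [swapT]
        rw [this, extendSYT_of a T.2]
        rfl
      rw [h3] at e2
      simp only [h1, h2] at hS e2
      rw [axial_swap (T.1 k), orth_swap (T.1 k)] at e2
      rw [extendSYT_of a h] at e1
      simp only [eq_comm (a := beta (T.1 i))] at hS
      rw [← hA] at hT hS
      set b := a ⟨swapT k i T, h⟩
      set A := axial F (T.1 k) (T.1 i)
      set B := orth F (T.1 k) (T.1 i)
      -- Writing `a T` as the transposition applied twice and expanding once by Young's form reduces
      -- `φ_i` to its predecessor.
      have h4 : jm P i • a T
          = -A • (jm P i • t P (permG r (Equiv.swap k i)) • a T)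
            + B • (jm P i • t P (permG r (Equiv.swap k i)) • b) := by
        conv_lhs => rw [← hss, e1]
        rw [smul_add, smul_add, smul_comm _ (-A), smul_comm _ B, smul_comm _ (-A), smul_comm _ B]
      rw [h4, hT, hS, e1, e2]
      linear_combination (norm := module) (hq * ((r : F) * (ct (T.1 i) : F))) • a T
    · rw [orth_eq_zero_of_not F T hki h] at e1 hq
      rw [zero_smul, add_zero] at e1
      rw [← hA] at hT
      set A := axial F (T.1 k) (T.1 i)
      have h4 : jm P i • a T = -A • (jm P i • t P (permG r (Equiv.swap k i)) • a T) := by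
        conv_lhs => rw [← hss, e1]
        rw [smul_comm _ (-A), smul_comm _ (-A)]
      rw [h4, hT, e1]
      linear_combination (norm := module) (hq * ((r : F) * (ct (T.1 i) : F))) • a T

include hd hs in
-- The vectors `a T` satisfy all the defining relations of `M(λ)`, so sending `v_T` to `a T` is well
-- defined on the quotient.
theorem v_ne_zero_of_module (hy : ∀ (i : Fin n) T, y P i • a T = 0) (ha : ∀ T, a T ≠ 0) (T : SYT lam) :
    v P T ≠ 0 := by
  intro h
  have hmem := (Submodule.Quotient.mk_eq_zero _).mp h
  have hle : Submodule.span (H P n) {m | StdRel P lam m}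
      ≤ LinearMap.ker (Finsupp.linearCombination (H P n) a) := by
    rw [Submodule.span_le]
    intro m hm
    rw [SetLike.mem_coe, LinearMap.mem_ker]
    cases hm with
    | diag i T =>
      rw [Finsupp.linearCombination_single, sub_smul, hd, algebraMap_smul, sub_eq_zero, rootWt,
        rootF]
      simp
    | jm i T =>
      rw [Finsupp.linearCombination_single, sub_smul, jm_smul_of_young P hd hs, algebraMap_smul,
        sub_self]
    | tau i j hij T =>
      have hc : ((r : F) * (ct (T.1 i) : F) - (r : F) * (ct (T.1 j) : F))⁻¹
          * (if beta (T.1 i) = beta (T.1 j) then (r : F) else 0) = axial F (T.1 i) (T.1 j) := by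
        rw [axial]
        split_ifs with hb
        · rw [← mul_sub, mul_inv, Int.cast_sub, mul_comm, ← mul_assoc,
            mul_inv_cancel₀ natCast_r_ne_zero, one_mul]
        · rw [mul_zero]
      rw [map_sub, Finsupp.linearCombination_single, add_smul, smul_assoc,
        piH_smul_of_diag P hd, smul_smul, hc, hs i j hij, sub_eq_zero, tauValue]
      by_cases h : IsStandard (swapT i j T)
      · rw [dif_pos h, extendSYT_of a h]
        have hlc : ∀ c : H P n, c • a ⟨swapT i j T, h⟩ = Finsupp.linearCombination (H P n) a
            (Finsupp.single (⟨swapT i j T, h⟩ : SYT lam) c) := fun c =>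
          (Finsupp.linearCombination_single (H P n) c _).symm
        by_cases hb : beta (T.1 i) = beta (T.1 j)
        · rw [if_neg (not_not.mpr hb)]
          refine Eq.trans ?_ (hlc _)
          rw [algebraMap_smul, orth, if_pos hb, ← seminormal, seminormal_comm i j]
          module
        · rw [if_pos hb]
          refine Eq.trans ?_ (hlc _)
          rw [one_smul, orth, if_neg hb, map_one]
          module
      · rw [dif_neg h, orth_eq_zero_of_not F T hij h, map_zero]
        module
    | y i T => rw [Finsupp.linearCombination_single, hy]
  have := hle hmem
  rw [LinearMap.mem_ker, Finsupp.linearCombination_single, one_smul] at this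
  exact ha T this

/-- The model is `F[x] ⊗ S^λ` with `S^λ` in Young's form, and `a T` is the degree-zero copy of the
basis vector `T`. -/
theorem v_ne_zero (T : SYT lam) : v P T ≠ 0 := by
  let : Module (H P n) (Ind F n (SYT lam →₀ F)) :=
    Module.compHom _ (indRep P (youngRep F lam)).toRingHom
  have hsmul : ∀ (h : H P n) (m : Ind F n (SYT lam →₀ F)),
    h • m = indRep P (youngRep F lam) h m := fun _ _ => rfl
  have : IsScalarTower F (H P n) (Ind F n (SYT lam →₀ F)) := ⟨fun c h m => by
    rw [hsmul, hsmul, map_smul, LinearMap.smul_apply]⟩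
  have : SMulCommClass (H P n) F (Ind F n (SYT lam →₀ F)) := ⟨fun h c m => by
    rw [hsmul, hsmul, map_smul]⟩
  refine v_ne_zero_of_module P 
    (a := fun T => indMk F n (SYT lam →₀ F) 1 (Finsupp.single T 1)) (fun i T => ?_)
    (fun i j hij T => ?_) (fun i T => ?_) (fun T h => ?_) T
  · rw [hsmul, indRep_t_one_mk, youngRep_diagG_single, map_smul]
  · rw [hsmul, indRep_t_one_mk, youngRep_swap F hij, young_single, map_add, map_smul, map_smul]
    congr 2
    by_cases h : IsStandard (swapT i j T)
    · obtain ⟨S, hS⟩ : ∃ S : SYT lam, S.1 = swapT i j T := ⟨⟨_, h⟩, rfl⟩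
      rw [← hS, extendSYT_val, extendSYT_val]
    · rw [extendSYT_of_not _ h, extendSYT_of_not _ h, map_zero]
  · rw [hsmul, indRep_y_one_mk]
  · exact one_ne_zero (Finsupp.single_eq_zero.mp (indMk_one_injective h))

end Faithful

end

end Cherednik

namespace Cherednik

noncomputable section

/-! ### Generic parameters and the main statement -/

section Generic

/-- The parameters `d_j` as polynomials. -/
def dPoly {r : ℕ} [NeZero r] (j : ZMod r) : MvPolynomial (ParamIndex r) ℂ :=
  if h : j ≠ 0 then MvPolynomial.X (ParamIndex.d ⟨j, h⟩)
  else - ∑ k : {k : ZMod r // k ≠ 0}, MvPolynomial.X (ParamIndex.d k)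

theorem genericParams_d {r : ℕ} [NeZero r] (j : ZMod r) :
    (genericParams r).d j = algebraMap (MvPolynomial (ParamIndex r) ℂ) (RatField r) (dPoly j) := by
  unfold genericParams dPoly
  simp only
  split_ifs
  · rfl
  · simp only [map_neg, map_sum]
    rfl

theorem eval_dPoly {r : ℕ} [NeZero r] {e : ParamIndex r → ℂ} (he : ∀ k, e (ParamIndex.d k) = 0)
    (j : ZMod r) : MvPolynomial.eval e (dPoly j) = 0 := by
  unfold dPoly
  split_ifs
  · simp [he]
  · simp [he]

/-- The relation holds between polynomials, since they embed in their fraction field. Setting all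
`d_k` to zero kills the right side. -/
theorem generic_genericParams (r : ℕ) [NeZero r] : Generic (genericParams r) := by
  intro a b p q p' q' h
  have h1 : algebraMap (MvPolynomial (ParamIndex r) ℂ) (RatField r)
      ((a : MvPolynomial (ParamIndex r) ℂ) * MvPolynomial.X ParamIndex.κ
        + (b : MvPolynomial (ParamIndex r) ℂ) * MvPolynomial.X ParamIndex.c₀)
      = algebraMap (MvPolynomial (ParamIndex r) ℂ) (RatField r)
        (dPoly p - dPoly q - (dPoly p' - dPoly q')) := by
    simp only [map_sub, ← genericParams_d]
    rw [← h]
    simp only [map_add, map_mul, map_intCast]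
    rfl
  have h2 := IsFractionRing.injective (MvPolynomial (ParamIndex r) ℂ) (RatField r) h1
  have key : ∀ e : ParamIndex r → ℂ, (∀ k, e (ParamIndex.d k) = 0) →
      (a : ℂ) * e ParamIndex.κ + (b : ℂ) * e ParamIndex.c₀ = 0 := fun e he => by
    have h3 := congrArg (MvPolynomial.eval e) h2
    simpa [eval_dPoly he] using h3
  -- The points `(κ, c₀) = (1, 0)` and `(0, 1)` isolate the two coefficients.
  have k1 := key (fun i => match i with | .κ => 1 | _ => 0) (fun _ => rfl)
  have k2 := key (fun i => match i with | .c₀ => 1 | _ => 0) (fun _ => rfl)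
  simp only [mul_one, mul_zero, add_zero, zero_add, Int.cast_eq_zero] at k1 k2
  exact ⟨k1, k2⟩

end Generic

/-! ### The formulas (a), (b), (c) for the partial operator `σ_i` -/

section Main

set_option linter.unusedSectionVars false

variable {F : Type} [Field F] [Algebra ℂ F] {r n : ℕ} [NeZero r] {P : Params F r}
  {lam : RPartition r n}
variable {f : (Fin n → ℕ) → SYT lam → M P lam} (hf : ∀ μ T, IsLeading P μ T (f μ T))
  (hP : Generic P)

include hf hP in
theorem sigmaEq_f_of_ne {μ : Fin n → ℕ} {T : SYT lam} {i i' : Fin n} (hi : i.1 + 1 = i'.1)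
    (hne : μ i ≠ μ i')
    (h : μ i < μ i' ∨ ¬ ((μ i : ℤ) - (μ i' : ℤ) ≡
      ((beta (T.1 (wPerm μ i)) : ℕ) : ℤ) - ((beta (T.1 (wPerm μ i')) : ℕ) : ℤ) [ZMOD (r : ℤ)])) :
    SigmaEq P i i' (f μ T) (f (μ ∘ Equiv.swap i i') T) := by
  have h1 := sigmaEq_f hf hP (μ := μ) (T := T) (i := i) (j := i')
    (Or.inl fun e => hne (wtZ_eq hP e).1)
  rcases lt_or_gt_of_ne hne with hlt | hgt
  · rwa [sigma_f_of_lt hf hP hi hlt] at h1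
  · have h2 : wtD μ T i ≠ wtD μ T i' := fun e => h.resolve_left hgt.not_gt (rootWt_eq_iff.mp e)
    rw [sigma_f_of_gt hf hP hi hgt, sigmaScalar, if_neg h2] at h1
    simpa using h1

include hf hP in
-- The congruence makes the shifted `d`-terms of the two eigenvalues cancel, so `δ` is the
-- difference of the eigenvalues of `z_i` and `z_{i+1}`. Here `π_i` acts by `r`, and `1 - (r c₀ /
-- δ)²` is the stated factor.
theorem sigmaEq_f_of_modEq {μ : Fin n → ℕ} {T : SYT lam} {i i' : Fin n} (hi : i.1 + 1 = i'.1)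
    (hgt : μ i' < μ i)
    (h : (μ i : ℤ) - (μ i' : ℤ) ≡
      ((beta (T.1 (wPerm μ i)) : ℕ) : ℤ) - ((beta (T.1 (wPerm μ i')) : ℕ) : ℤ) [ZMOD (r : ℤ)])
    {δ : F} (hδ : δ = P.κ * ((μ i : F) - μ i')
            - (P.d ((beta (T.1 (wPerm μ i)) : ℕ) : ZMod r)
                - P.d ((beta (T.1 (wPerm μ i')) : ℕ) : ZMod r))
            - P.c₀ * r * ((ct (T.1 (wPerm μ i)) : F) - ct (T.1 (wPerm μ i')))) :
    δ ≠ 0 ∧ SigmaEq P i i' (f μ T)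
      (((δ - r * P.c₀) * (δ + r * P.c₀) / δ ^ 2) • f (μ ∘ Equiv.swap i i') T) := by
  have hne : wtZ P μ T i ≠ wtZ P μ T i' := fun e => hgt.ne' (wtZ_eq hP e).1
  have e1 : wtZ P μ T i - wtZ P μ T i' = δ := by
    have h3 := (ZMod.intCast_eq_intCast_iff _ _ r).mpr h
    push_cast at h3
    have h4 : (((beta (T.1 (wPerm μ i)) : ℕ) : ZMod r) - ((μ i : ZMod r) + 1))
        = (((beta (T.1 (wPerm μ i')) : ℕ) : ZMod r) - ((μ i' : ZMod r) + 1)) := by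
      linear_combination -h3
    rw [hδ, wtZ, wtZ]
    rw [h4]
    ring
  have hδ0 : δ ≠ 0 := e1 ▸ sub_ne_zero.mpr hne
  refine ⟨hδ0, ?_⟩
  have h1 := sigmaEq_f hf hP (μ := μ) (T := T) (i := i) (j := i') (Or.inl hne)
  have h2 : wtD μ T i = wtD μ T i' := rootWt_eq_iff.mpr h
  rw [sigma_f_of_gt hf hP hi hgt, sigmaScalar, if_pos h2, e1] at h1
  convert h1 using 2
  field_simp
  ring

include hf hP in
theorem sigmaEq_f_of_eq {μ : Fin n → ℕ} {T : SYT lam} {i i' : Fin n} (hi : i.1 + 1 = i'.1)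
    (h : μ i = μ i') :
    ∃ k : Fin n, k.1 + 1 = (wPerm μ i).1 ∧
      (¬ IsStandard (swapT k (wPerm μ i) T) → SigmaEq P i i' (f μ T) 0) ∧
      (beta (T.1 (wPerm μ i)) ≠ beta (T.1 k) →
        ∃ h : IsStandard (swapT k (wPerm μ i) T),
          SigmaEq P i i' (f μ T) (f μ ⟨swapT k (wPerm μ i) T, h⟩)) ∧
      (∀ h : IsStandard (swapT k (wPerm μ i) T), beta (T.1 (wPerm μ i)) = beta (T.1 k) →
        SigmaEq P i i' (f μ T)
          (algebraMap ℂ F (seminormal k (wPerm μ i) T) • f μ ⟨swapT k (wPerm μ i) T, h⟩)) := by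
  have h1 := sigmaEq_f hf hP (μ := μ) (T := T) (i := i) (j := i') (tie_ne hP T hi h)
  have htie := wPerm_tie hi h
  refine ⟨wPerm μ i', htie, fun hns => ?_, fun hb => ?_, fun hs hb => ?_⟩
  · rwa [sigma_f_tie_of_not hf hP hi h hns] at h1
  · have hs := (isStandard_swapT_or T htie).resolve_right fun h2 => hb h2.1.symm
    refine ⟨hs, ?_⟩
    rw [sigma_f_tie hf hP hi h hs, youngCoef, if_neg hb.symm, map_one, one_smul] at h1
    exact h1
  · rw [sigma_f_tie hf hP hi h hs, youngCoef, if_pos hb.symm, seminormal_comm] at h1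
    exact h1

end Main

end

end Cherednik

theorem lemma5 (r n : ℕ) [NeZero r] [NeZero n] (lam : RPartition r n) :
    ∃ f : (Fin n → ℕ) → SYT lam → M (genericParams r) lam,
      -- `f μ T` is the unique normalized eigenvector attached to `μ` and `T`
      (∀ μ T g, IsLeadingEigenvector (genericParams r) μ T g ↔ g = f μ T) ∧
      -- (a)
      (∀ (μ : Fin n → ℕ) (T : SYT lam) (i i' : Fin n), i.1 + 1 = i'.1 →
        μ i ≠ μ i' →
        (μ i < μ i' ∨
          ¬ ((μ i : ℤ) - (μ i' : ℤ) ≡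
            ((beta (T.1 (wPerm μ i)) : ℕ) : ℤ)
              - ((beta (T.1 (wPerm μ i')) : ℕ) : ℤ) [ZMOD (r : ℤ)])) →
        SigmaEq (genericParams r) i i' (f μ T) (f (μ ∘ Equiv.swap i i') T)) ∧
      -- (b)
      (∀ (μ : Fin n → ℕ) (T : SYT lam) (i i' : Fin n), i.1 + 1 = i'.1 →
        μ i' < μ i →
        (μ i : ℤ) - (μ i' : ℤ) ≡
          ((beta (T.1 (wPerm μ i)) : ℕ) : ℤ)
            - ((beta (T.1 (wPerm μ i')) : ℕ) : ℤ) [ZMOD (r : ℤ)] →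
        ∀ δ : RatField r,
          δ = (genericParams r).κ * ((μ i : RatField r) - μ i')
            - ((genericParams r).d
                  ((beta (T.1 (wPerm μ i)) : ℕ) : ZMod r)
                - (genericParams r).d
                  ((beta (T.1 (wPerm μ i')) : ℕ) : ZMod r))
            - (genericParams r).c₀ * r
              * ((ct (T.1 (wPerm μ i)) : RatField r)
                - ct (T.1 (wPerm μ i'))) →
          δ ≠ 0 ∧
          SigmaEq (genericParams r) i i' (f μ T)
            (((δ - r * (genericParams r).c₀) * (δ + r * (genericParams r).c₀)
              / δ ^ 2) • f (μ ∘ Equiv.swap i i') T)) ∧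
      -- (c), where `j = w_μ(i)` and `k = j - 1`
      (∀ (μ : Fin n → ℕ) (T : SYT lam) (i i' : Fin n), i.1 + 1 = i'.1 →
        μ i = μ i' →
        ∀ j : Fin n, j = wPerm μ i →
        ∃ k : Fin n, k.1 + 1 = j.1 ∧
          (¬ IsStandard (swapT k j T) →
            SigmaEq (genericParams r) i i' (f μ T) 0) ∧
          (beta (T.1 j) ≠ beta (T.1 k) →
            ∃ h : IsStandard (swapT k j T),
              SigmaEq (genericParams r) i i' (f μ T)
                (f μ ⟨swapT k j T, h⟩)) ∧
          (∀ h : IsStandard (swapT k j T),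
            beta (T.1 j) = beta (T.1 k) →
            SigmaEq (genericParams r) i i' (f μ T)
              (algebraMap ℂ (RatField r) (seminormal k j T)
                • f μ ⟨swapT k j T, h⟩))) ∧
      -- (d)
      (∀ (μ : Fin n → ℕ) (T : SYT lam),
        Phi (genericParams r) n • f μ T = f (phiC μ) T) ∧
      -- (e)
      (∀ (μ : Fin n → ℕ) (T : SYT lam),
        (0 < μ (lastIdx n) →
          Psi (genericParams r) n • f μ T =
            ((genericParams r).κ * (μ (lastIdx n) : RatField r)
              - ((genericParams r).d
                    ((beta (T.1 (wPerm μ (lastIdx n))) : ℕ) : ZMod r)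
                  - (genericParams r).d
                    (((beta (T.1 (wPerm μ (lastIdx n))) : ℕ) : ZMod r)
                      - (μ (lastIdx n) : ZMod r)))
              - r * (ct (T.1 (wPerm μ (lastIdx n))) :
                  RatField r) * (genericParams r).c₀)
              • f (psiC μ) T) ∧
        (μ (lastIdx n) = 0 →
          Psi (genericParams r) n • f μ T = 0)) := by
  have hP := generic_genericParams r
  choose f hf using fun (μ : Fin n → ℕ) (T : SYT lam) => exists_isLeading hP (v_ne_zero (genericParams r)) T μ
  refine ⟨f, isLeadingEigenvector_iff hf hP, ?_, ?_, ?_, Phi_f hf hP, ?_⟩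
  · exact fun μ T i i' hi hne h => sigmaEq_f_of_ne hf hP hi hne h
  · exact fun μ T i i' hi hgt h δ hδ => sigmaEq_f_of_modEq hf hP hi hgt h hδ
  · rintro μ T i i' hi h _ rfl
    exact sigmaEq_f_of_eq hf hP hi h
  · intro μ T
    refine ⟨fun h => ?_, Psi_f_of_zero hf hP T⟩
    rw [Psi_f_of_pos hf hP T h, wtZ_psiC T h]
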